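/- **Setting.** Let $d\ge 1$, $q\ge 0$, and let $\mathbf d$ be a distance on $\{1,\dots,d\}$. Consider the linear system $$X_{n+1}=A_nX_n+b_n+\xi_{n+1},\quad \xi_{n+1}\sim\mathcal N(0,\Sigma_n),\qquad Y_n=HX_n+\zeta_n,\quad \zeta_n\sim\mathcal N(0,\sigma_o^2I_q),$$ $n\ge 0$, in $\mathbb R^d$, where $\sigma_o>0$ and $[H]_{k,j}=\mathbf 1_{j=o_k}$ for distinct observed indices $o_1,\dots,o_q\in\{1,\dots,d\}$. Fix a localization radius $l\ge 0$, an inflation ratio $r>1$ and an ensemble size $K$. For a matrix $C\in\mathbb R^{d\times d}$ let $\mathcal K(C)$ be the $d\times q$ matrix whose $i$-th row is the $i$-th row of $C^iH^T(\sigma_o^2I_q+HC^iH^T)^{-1}$, where $C^i=P_iCP_i$ and $P_i$ is the coordinate projection onto $\{j:\mathbf d(i,j)\le l\}$. The localized ensemble Kalman filter (LEnKF) starts from a random ensemble $\widehat X_0^{(1)},\dots,\widehat X_0^{(K)}$ with mean $\overline{\widehat X}_0$ and spread $\Delta\widehat X_0^{(k)}=\widehat X_0^{(k)}-\overline{\widehat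 X}_0$, and, for $n\ge0$, $$\widehat C_n=\frac1K\sum_{k=1}^K\Delta\widehat X_n^{(k)}\otimes\Delta\widehat X_n^{(k)},\quad \widehat K_n=\mathcal K(\widehat C_n),\quad \Delta X_n^{(k)}=(I-\widehat K_nH)\Delta\widehat X_n^{(k)}+\widehat K_n\zeta_n^{(k)},$$ $$\Delta\widehat X_{n+1}^{(k)}=\sqrt r\,(A_n\Delta X_n^{(k)}+\xi_{n+1}^{(k)}),\quad \overline X_n=(I-\widehat K_nH)\overline{\widehat X}_n+\widehat K_nY_n,\quad \overline{\widehat X}_{n+1}=A_n\overline X_n+b_n,$$ with $\xi_{n+1}^{(k)}\sim\mathcal N(0,\Sigma_n)$ and $\zeta_n^{(k)}\sim\mathcal N(0,\sigma_o^2I_q)$. All the noises $\xi_n,\zeta_n,\xi_n^{(k)},\zeta_n^{(k)}$ and the initial data $(X_0,\widehat X_0^{(1)},\dots,\widehat X_0^{(K)})$ are mutually independent. Let $\mathbb E_n$ be the conditional expectation given $\mathcal F_n=\sigma\{X_0,\widehat X_0^{(k)},\xi_t,\zeta_{t-1},\xi_t^{(k)},\zeta_{t-1}^{(k)}: 1\le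 t\le n,\ 1\le k\le K\}$; expectations of nonnegative variables are allowed to be $+\infty$. For a decreasing $\Phi:[0,\infty)\to[0,1]$ with $\Phi(0)=1$, the sequence $\widehat C_n$ follows an $(M_n,\Phi,L)$-localized structure if $|[\widehat C_n]_{i,j}|\le M_n\Phi(\mathbf d(i,j))$ when $\mathbf d(i,j)\le L$ and $|[\widehat C_n]_{i,j}|\le M_n\Phi(L)$ when $\mathbf d(i,j)>L$. Put $$\psi_{\lambda}(M,\delta)=(r+\delta)\max\{\lambda M(1+\sigma_o^{-2}M)^2+\lambda\sigma_o^{-2}M^2,\ \lambda^2M+\sigma_\xi^2\},\qquad \Gamma(x,d)=\max\Big\{9x^2,\tfrac{24x}{c},\tfrac{18x^2}{c}\log d\Big\}.$$ **Theorem.** There is an absolute constant $c>0$ (entering also $\Gamma$) such that the following holds. Let $L\ge 0$ be an integer and suppose: 1. $\Sigma_n=\sigma_\xi^2I_d$ for all $n$, with $\sigma_\xi>0$, and $\mathbf d(o_i,o_j)>2l$ for all $i\ne j$; 2. there is $0<\lambda_A<r^{-1}$ with $\max_i\sum_{k=1}^d|[A_n]_{i,k}|\lambda_A^{-\mathbf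 d(i,k)}\le\lambda_A$ for all $n$; 3. $0<\delta_*<\min\{\tfrac14,\tfrac12(\lambda_A^{-1}-r)\}$, $M_*\ge\frac{(r+2\delta_*)\sigma_\xi^2}{1-\lambda_A}$ and $\psi_{\lambda_A}(M_*,\delta_*)\le M_*$; 4. with $n_*=2L+\Big\lceil\frac{\log(4\delta_*^{-1})}{\log\lambda_A^{-1}}\Big\rceil$, $$K>\max\Big\{\frac{1}{c\,\delta_*^2\lambda_A^{2L}}\log(16d^2n_*\delta_*^{-2}),\ \Gamma(2r\delta_*^{-1},d)\Big\}.$$ Let $M_n=\max_{i,j}|[\widehat C_n]_{i,j}|\lambda_A^{-\min\{\mathbf d(i,j),L\}}$. Then $\widehat C_n$ follows an $(M_n,\Phi,L)$-localized structure with $\Phi(x)=\lambda_A^x$, the sequence $M_n$ is dissipative every $n_*$ steps, i.e. for every $n\ge0$, almost surely, $$\mathbb E_nM_{n+n_*}\le\tfrac12M_n+(1+2\delta_*)M_*\qquad\text{(in particular } \mathbb E_0M_{n_*}\le\tfrac12M_0+(1+2\delta_*)M_*),$$ and for every $T\ge1$ (with $\|\cdot\|$ the $\ell_2$ operator norm)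 $$\frac1T\sum_{k=1}^T\mathbb E M_k\le\frac{2n_*}{T\lambda_A^L}\big(\mathbb E\|\widehat C_0\|+M_*\big)+2(1+\delta_*)M_*.$$ -/

import Mathlib

open MeasureTheory ProbabilityTheory
open scoped ENNReal Matrix

noncomputable section

namespace LEnKF

/-- The parameters of the signal-observation system and of the filter: the linear dynamics
`A n`, `b n`, the system noise covariances `Sig n`, the standard deviation `sigmaO` of the
observation noise, the observed coordinates `obs`, the spatial distance `dist` between
coordinates, the radius `l` of the domain localization and the inflation ratio `r`. -/
structure Model (d q : ℕ) where
  A : ℕ → Matrix (Fin d) (Fin d) ℝ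
  b : ℕ → EuclideanSpace ℝ (Fin d)
  Sig : ℕ → Matrix (Fin d) (Fin d) ℝ
  sigmaO : ℝ
  obs : Fin q → Fin d
  dist : Fin d → Fin d → ℝ
  l : ℝ
  r : ℝ

/-- Standing assumptions on the parameters: `dist` is a distance on the index set, the observed
coordinates are distinct, the observation noise is nondegenerate, `l ≥ 0` and `r > 1`. -/
structure Model.Standing {d q : ℕ} (m : Model d q) : Prop where
  dist_eq_zero : ∀ i j, m.dist i j = 0 ↔ i = j
  dist_symm : ∀ i j, m.dist i j = m.dist j i
  dist_triangle : ∀ i j k, m.dist i k ≤ m.dist i j + m.dist j k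
  obs_injective : Function.Injective m.obs
  sigmaO_pos : 0 < m.sigmaO
  l_nonneg : 0 ≤ m.l
  one_lt_r : 1 < m.r

/-- The observation matrix `H`, with entries `1` if `j = o_k` and `0` otherwise. -/
def Model.H {d q : ℕ} (m : Model d q) : Matrix (Fin q) (Fin d) ℝ :=
  Matrix.of fun k j => if j = m.obs k then 1 else 0

open Classical in
/-- The projection onto the coordinates within distance `l` of `i`. -/
def Model.proj {d q : ℕ} (m : Model d q) (i : Fin d) : Matrix (Fin d) (Fin d) ℝ :=
  Matrix.diagonal fun j => if m.dist i j ≤ m.l then 1 else 0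

/-- The local covariance `P_i C P_i` relevant to the `i`-th coordinate. -/
def Model.localCov {d q : ℕ} (m : Model d q) (C : Matrix (Fin d) (Fin d) ℝ) (i : Fin d) :
    Matrix (Fin d) (Fin d) ℝ :=
  m.proj i * C * m.proj i

/-- The Kalman gain `C_i Hᵀ (σ_o² I + H C_i Hᵀ)⁻¹` of the `i`-th local covariance. -/
def Model.localGain {d q : ℕ} (m : Model d q) (C : Matrix (Fin d) (Fin d) ℝ) (i : Fin d) :
    Matrix (Fin d) (Fin q) ℝ :=
  m.localCov C i * m.Hᵀ *
    (m.sigmaO ^ 2 • (1 : Matrix (Fin q) (Fin q) ℝ) + m.H * m.localCov C i * m.Hᵀ)⁻¹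

/-- The domain-localized Kalman gain: its `i`-th row is the `i`-th row of the `i`-th local gain. -/
def Model.gain {d q : ℕ} (m : Model d q) (C : Matrix (Fin d) (Fin d) ℝ) :
    Matrix (Fin d) (Fin q) ℝ :=
  Matrix.of fun i k => m.localGain C i i k

/-- The random inputs: initial signal `X0`, initial forecast ensemble `Xhat0`, system noise `xi`
(`xi n` drives the signal into time `n`, for `n ≥ 1`), observation noise `zeta`, and the sample
noises `xiS`, `zetaS` of the ensemble members. -/
structure Input (Ω : Type*) [MeasurableSpace Ω] (d q K : ℕ) where
  X0 : Ω → EuclideanSpace ℝ (Fin d)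
  Xhat0 : Fin K → Ω → EuclideanSpace ℝ (Fin d)
  xi : ℕ → Ω → EuclideanSpace ℝ (Fin d)
  zeta : ℕ → Ω → EuclideanSpace ℝ (Fin q)
  xiS : ℕ → Fin K → Ω → EuclideanSpace ℝ (Fin d)
  zetaS : ℕ → Fin K → Ω → EuclideanSpace ℝ (Fin q)
  measurable_X0 : Measurable X0
  measurable_Xhat0 : ∀ k, Measurable (Xhat0 k)
  measurable_xi : ∀ n, Measurable (xi n)
  measurable_zeta : ∀ n, Measurable (zeta n)
  measurable_xiS : ∀ n k, Measurable (xiS n k)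
  measurable_zetaS : ∀ n k, Measurable (zetaS n k)

/-- Labels of the independent sources of randomness. -/
inductive Source (K : ℕ) where
  | init : Source K
  | xi (n : ℕ) : Source K
  | zeta (n : ℕ) : Source K
  | xiS (n : ℕ) (k : Fin K) : Source K
  | zetaS (n : ℕ) (k : Fin K) : Source K

section Dynamics

variable {Ω : Type*} [mΩ : MeasurableSpace Ω] {d q K : ℕ}

/-- The σ-algebra generated by the initial signal and the initial ensemble. -/
@[reducible] def Input.initSigma (u : Input Ω d q K) : MeasurableSpace Ω :=
  MeasurableSpace.comap u.X0 inferInstance ⊔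
    ⨆ k, MeasurableSpace.comap (u.Xhat0 k) inferInstance

/-- The σ-algebra generated by each source; the noises `xi`, `xiS` act from time `1` on. -/
@[reducible] def Input.sourceSigma (u : Input Ω d q K) : Source K → MeasurableSpace Ω
  | .init => u.initSigma
  | .xi n => MeasurableSpace.comap (u.xi (n + 1)) inferInstance
  | .zeta n => MeasurableSpace.comap (u.zeta n) inferInstance
  | .xiS n k => MeasurableSpace.comap (u.xiS (n + 1) k) inferInstance
  | .zetaS n k => MeasurableSpace.comap (u.zetaS n k) inferInstance

/-- The σ-algebra generated by `ξ_t, ζ_{t-1}, ξ_t^{(k)}, ζ_{t-1}^{(k)}` at time `t = s + 1`. -/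
@[reducible] def Input.stepSigma (u : Input Ω d q K) (s : ℕ) : MeasurableSpace Ω :=
  (MeasurableSpace.comap (u.xi (s + 1)) inferInstance ⊔
      MeasurableSpace.comap (u.zeta s) inferInstance) ⊔
    ⨆ k, (MeasurableSpace.comap (u.xiS (s + 1) k) inferInstance ⊔
      MeasurableSpace.comap (u.zetaS s k) inferInstance)

lemma Input.initSigma_le (u : Input Ω d q K) : u.initSigma ≤ mΩ :=
  sup_le u.measurable_X0.comap_le (iSup_le fun k => (u.measurable_Xhat0 k).comap_le)

lemma Input.stepSigma_le (u : Input Ω d q K) (s : ℕ) : u.stepSigma s ≤ mΩ :=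
  sup_le (sup_le (u.measurable_xi _).comap_le (u.measurable_zeta _).comap_le)
    (iSup_le fun k => sup_le (u.measurable_xiS _ k).comap_le (u.measurable_zetaS _ k).comap_le)

/-- The natural filtration generated by all random outcomes up to time `n`, namely
`F_n = σ{X_0, X̂_0^{(k)}, ξ_t, ζ_{t-1}, ξ_t^{(k)}, ζ_{t-1}^{(k)} : 1 ≤ t ≤ n, 1 ≤ k ≤ K}`. -/
def Input.filtration (u : Input Ω d q K) : Filtration ℕ mΩ where
  seq n := u.initSigma ⊔ ⨆ (s : ℕ) (_ : s < n), u.stepSigma s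
  mono' := fun _ _ h => sup_le_sup_left
    (iSup_le fun s => iSup_le fun hs =>
      le_iSup₂_of_le (f := fun (s : ℕ) (_ : s < _) => u.stepSigma s) s (hs.trans_le h) le_rfl) _
  le' := fun _ => sup_le u.initSigma_le (iSup_le fun s => iSup_le fun _ => u.stepSigma_le s)

/-- The probabilistic assumptions: Gaussian noises with the prescribed covariances, and mutual
independence of all noises and of the initial data. -/
structure Input.IsNoiseFor (u : Input Ω d q K) (m : Model d q) (P : Measure Ω) : Prop where
  law_xi : ∀ n, HasLaw (u.xi (n + 1)) (multivariateGaussian 0 (m.Sig n)) P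
  law_zeta : ∀ n, HasLaw (u.zeta n)
    (multivariateGaussian 0 (m.sigmaO ^ 2 • (1 : Matrix (Fin q) (Fin q) ℝ))) P
  law_xiS : ∀ n k, HasLaw (u.xiS (n + 1) k) (multivariateGaussian 0 (m.Sig n)) P
  law_zetaS : ∀ n k, HasLaw (u.zetaS n k)
    (multivariateGaussian 0 (m.sigmaO ^ 2 • (1 : Matrix (Fin q) (Fin q) ℝ))) P
  indep : iIndep u.sourceSigma P

/-- The signal `X_{n+1} = A_n X_n + b_n + ξ_{n+1}`. -/
def signal (m : Model d q) (u : Input Ω d q K) : ℕ → Ω → EuclideanSpace ℝ (Fin d)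
  | 0, ω => u.X0 ω
  | n + 1, ω => (m.A n).toEuclideanLin (signal m u n ω) + m.b n + u.xi (n + 1) ω

/-- The observation `Y_n = H X_n + ζ_n`. -/
def observation (m : Model d q) (u : Input Ω d q K) (n : ℕ) (ω : Ω) :
    EuclideanSpace ℝ (Fin q) :=
  m.H.toEuclideanLin (signal m u n ω) + u.zeta n ω

/-- The mean `K⁻¹ ∑ X^{(k)}` of an ensemble. -/
def ensembleMean (X : Fin K → EuclideanSpace ℝ (Fin d)) : EuclideanSpace ℝ (Fin d) :=
  (K : ℝ)⁻¹ • ∑ k, X k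

/-- The covariance `K⁻¹ ∑ ΔX^{(k)} ⊗ ΔX^{(k)}` of an ensemble spread. -/
def ensembleCov (D : Fin K → EuclideanSpace ℝ (Fin d)) : Matrix (Fin d) (Fin d) ℝ :=
  Matrix.of fun i j => (K : ℝ)⁻¹ * ∑ k, D k i * D k j

/-- One analysis step for the spread: `(I - K̂ H) ΔX̂^{(k)} + K̂ ζ^{(k)}`, the gain `K̂` being
computed from the ensemble covariance of the forecast spread `D`. -/
def analysisStep (m : Model d q) (D : Fin K → EuclideanSpace ℝ (Fin d))
    (z : Fin K → EuclideanSpace ℝ (Fin q)) (k : Fin K) : EuclideanSpace ℝ (Fin d) :=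
  (1 - m.gain (ensembleCov D) * m.H).toEuclideanLin (D k) +
    (m.gain (ensembleCov D)).toEuclideanLin (z k)

/-- The forecast spread `ΔX̂_n^{(k)}`, with
`ΔX̂_{n+1}^{(k)} = √r (A_n ΔX_n^{(k)} + ξ_{n+1}^{(k)})`. -/
def forecastSpread (m : Model d q) (u : Input Ω d q K) :
    ℕ → Ω → Fin K → EuclideanSpace ℝ (Fin d)
  | 0, ω, k => u.Xhat0 k ω - ensembleMean fun k' => u.Xhat0 k' ω
  | n + 1, ω, k => √m.r • ((m.A n).toEuclideanLin
      (analysisStep m (forecastSpread m u n ω) (fun k' => u.zetaS n k' ω) k) +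
        u.xiS (n + 1) k ω)

/-- The forecast ensemble covariance `Ĉ_n`. -/
def forecastCov (m : Model d q) (u : Input Ω d q K) (n : ℕ) (ω : Ω) :
    Matrix (Fin d) (Fin d) ℝ :=
  ensembleCov (forecastSpread m u n ω)

/-- The posterior spread `ΔX_n^{(k)}`. -/
def analysisSpread (m : Model d q) (u : Input Ω d q K) (n : ℕ) (ω : Ω) :
    Fin K → EuclideanSpace ℝ (Fin d) :=
  analysisStep m (forecastSpread m u n ω) fun k => u.zetaS n k ω

/-- The analysis step `(I - K̂_n H) x + K̂_n Y_n` for a forecast mean `x`. -/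
def meanStep (m : Model d q) (u : Input Ω d q K) (n : ℕ) (ω : Ω)
    (x : EuclideanSpace ℝ (Fin d)) : EuclideanSpace ℝ (Fin d) :=
  (1 - m.gain (forecastCov m u n ω) * m.H).toEuclideanLin x +
    (m.gain (forecastCov m u n ω)).toEuclideanLin (observation m u n ω)

/-- The forecast mean, which at time `n + 1` is `A_n X̄_n + b_n`. -/
def forecastMean (m : Model d q) (u : Input Ω d q K) : ℕ → Ω → EuclideanSpace ℝ (Fin d)
  | 0, ω => ensembleMean fun k => u.Xhat0 k ω
  | n + 1, ω => (m.A n).toEuclideanLin (meanStep m u n ω (forecastMean m u n ω)) + m.b n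

/-- The posterior mean `X̄_n`. -/
def analysisMean (m : Model d q) (u : Input Ω d q K) (n : ℕ) (ω : Ω) :
    EuclideanSpace ℝ (Fin d) :=
  meanStep m u n ω (forecastMean m u n ω)

end Dynamics

/-- The `ℓ₂` operator norm of a square matrix. -/
def opNorm {d : ℕ} (C : Matrix (Fin d) (Fin d) ℝ) : ℝ :=
  ‖Matrix.toEuclideanCLM (𝕜 := ℝ) C‖

/-- A matrix-valued random sequence `C` follows an `(M, Φ, L)`-localized structure, where `Φ` is
a decreasing function from `[0, ∞)` to `[0, 1]` with `Φ 0 = 1`. -/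
structure FollowsLocalizedStructure {Ω : Type*} {d : ℕ} (dist : Fin d → Fin d → ℝ)
    (C : ℕ → Ω → Matrix (Fin d) (Fin d) ℝ) (M : ℕ → Ω → ℝ) (Φ : ℝ → ℝ) (L : ℝ) : Prop where
  antitoneOn : AntitoneOn Φ (Set.Ici 0)
  mem_Icc : ∀ x, 0 ≤ x → Φ x ∈ Set.Icc (0 : ℝ) 1
  map_zero : Φ 0 = 1
  near : ∀ n ω i j, dist i j ≤ L → |C n ω i j| ≤ M n ω * Φ (dist i j)
  far : ∀ n ω i j, L < dist i j → |C n ω i j| ≤ M n ω * Φ L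

/-- The state of localization `max_{i,j} |C_{i,j}| lam ^ (-(d(i,j) ∧ L))` of a matrix. -/
def locMagnitude {d : ℕ} (dist : Fin d → Fin d → ℝ) (lam : ℝ) (L : ℕ)
    (C : Matrix (Fin d) (Fin d) ℝ) : ℝ :=
  ⨆ p : Fin d × Fin d, |C p.1 p.2| * lam ^ (-(min (dist p.1 p.2) (L : ℝ)))

/-- The weak local interaction condition
`max_i ∑_k |[A_n]_{i,k}| lam ^ (-d(i,k)) ≤ lam` for all `n`. -/
def WeakInteraction {d q : ℕ} (m : Model d q) (lam : ℝ) : Prop :=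
  ∀ n i, ∑ k, |m.A n i k| * lam ^ (-(m.dist i k)) ≤ lam

/-- The function `ψ` describing the update of the localized structure. -/
def psi (r sigmaO sigmaXi lam M δ : ℝ) : ℝ :=
  (r + δ) * max (lam * M * (1 + M / sigmaO ^ 2) ^ 2 + lam * (M ^ 2 / sigmaO ^ 2))
    (lam ^ 2 * M + sigmaXi ^ 2)

/-- The sample size threshold `Γ(x, d)`, depending on the constant `c`. -/
def Gam (c x : ℝ) (d : ℕ) : ℝ :=
  max (9 * x ^ 2) (max (24 * x / c) (18 * x ^ 2 / c * Real.log d))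

/-- The time window `n_* = 2 L + ⌈log (4 / δ) / log (1 / lam)⌉`. -/
def nStar (lam δ : ℝ) (L : ℕ) : ℕ :=
  2 * L + ⌈Real.log (4 / δ) / Real.log (1 / lam)⌉₊

end LEnKF

end

open MeasureTheory ProbabilityTheory
open scoped ENNReal Matrix

noncomputable section

namespace LEnKF

/-! ### Covariance algebra: the explicit gain and one step of the mean covariance. -/

section

variable {d q K : ℕ}

/-! Write λ, δ, M_* for `lam`, `δ`, `Ms`, V_n for the largest forecast variance and θ for a floor on
the localization weights.

Mean step. Observed coordinates are more than 2l apart, so each row of the localized gain has at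
most one nonzero entry, a scalar Kalman gain (`Model.gain_apply`). Two facts follow about `expCov`,
the mean of the next forecast covariance given the current spread. First, assimilation does not
increase variances, so the mean next variances are at most r(λ²V_n + σ_ξ²) (`abs_expCov_le`).
Second, the weights max(λ^d(i,j), θ) are submultiplicative along the metric, so a bound M · weight
on the entries becomes a bound of the same shape off the diagonal (`abs_expCov_le_weight`). The
condition on ψ then makes M_* stable, with one factor λ to spare.

Sampling error. The difference between the covariance and this mean is a centred Gaussian quadratic
form. Measured in units of r(λ²V_n + σ_ξ²), it has exponential moments bounded by 2d² exp(16t²/K)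
for 0 ≤ t ≤ K/8, uniformly in the past (`relFluct_exp_le`). The Γ condition makes its mean at most
2δ/r, which gives E_n V_{n+1} ≤ λV_n + (1-λ)M_*. The logarithmic condition makes the excess over
`fineTol` ~ δλ^L negligible in mean, and errors above `varTol` ~ δλ^(L/2) so rare that the crude
bound M ≤ λ^(-L) V is affordable when they occur.

One window of n_* steps. If λ^(2L) V_n is of order M_* or more, the crude bound and the decay of V
suffice. Otherwise choose k with λ^k V_n ~ M_*. The first k + n_* - 2L steps bring the variances
near M_*. Each of the remaining 2L - k steps multiplies the floor θ by √λ, while the other √λ of the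
spare factor absorbs the excess variance and the sampling error. At the end θ = λ^(L-k/2), and the
resulting loss M_* λ^(-k/2) is at most (7/16)V_n + M_* by the arithmetic-geometric mean inequality
(`locMagnitude_window_le`).

Integrating over events of F_n gives the conditional inequality, with V_n ≤ M_n on the right;
summing it over time gives the average bound. -/

lemma Model.Standing.dist_self {m : Model d q} (hm : m.Standing) (i : Fin d) : m.dist i i = 0 :=
  (hm.dist_eq_zero i i).2 rfl

lemma Model.Standing.dist_nonneg {m : Model d q} (hm : m.Standing) (i j : Fin d) :
    0 ≤ m.dist i j := by
  have h := hm.dist_triangle i j i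
  rw [hm.dist_self, hm.dist_symm j i] at h
  linarith

lemma ensembleCov_apply (D : Fin K → EuclideanSpace ℝ (Fin d)) (i j : Fin d) :
    ensembleCov D i j = (K : ℝ)⁻¹ * ∑ k, D k i * D k j := rfl

lemma ensembleCov_symm (D : Fin K → EuclideanSpace ℝ (Fin d)) (i j : Fin d) :
    ensembleCov D i j = ensembleCov D j i := by
  simp only [ensembleCov_apply, mul_comm]

lemma ensembleCov_self_nonneg (D : Fin K → EuclideanSpace ℝ (Fin d)) (i : Fin d) :
    0 ≤ ensembleCov D i i := by
  rw [ensembleCov_apply]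
  exact mul_nonneg (by positivity) (Finset.sum_nonneg fun k _ => mul_self_nonneg _)

lemma abs_ensembleCov_le (D : Fin K → EuclideanSpace ℝ (Fin d)) (i j : Fin d) :
    |ensembleCov D i j| ≤ (ensembleCov D i i + ensembleCov D j j) / 2 := by
  simp only [ensembleCov_apply]
  rw [← mul_add, ← Finset.sum_add_distrib, mul_div_assoc, Finset.sum_div, abs_mul,
    abs_of_nonneg (by positivity : (0 : ℝ) ≤ (K : ℝ)⁻¹)]
  gcongr
  refine (Finset.abs_sum_le_sum_abs _ _).trans (Finset.sum_le_sum fun k _ => ?_)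
  rw [abs_le]
  constructor <;> nlinarith [sq_nonneg (D k i + D k j), sq_nonneg (D k i - D k j)]

/-- Separated observations: the domain-localized gain is explicit. -/
lemma Model.gain_apply {m : Model d q} (hm : m.Standing)
    (hsep : ∀ i j, i ≠ j → 2 * m.l < m.dist (m.obs i) (m.obs j))
    {C : Matrix (Fin d) (Fin d) ℝ} (hC : ∀ i, 0 ≤ C i i) (i : Fin d) (k : Fin q) :
    m.gain C i k = if m.dist i (m.obs k) ≤ m.l then
      C i (m.obs k) / (m.sigmaO ^ 2 + C (m.obs k) (m.obs k)) else 0 := by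
  classical
  have hσ : 0 < m.sigmaO ^ 2 := pow_pos hm.sigmaO_pos 2
  have hloc : ∀ a b, m.localCov C i a b =
      (if m.dist i a ≤ m.l then 1 else 0) * C a b * (if m.dist i b ≤ m.l then 1 else 0) := by
    intro a b
    simp [Model.localCov, Model.proj, Matrix.diagonal_mul, Matrix.mul_diagonal]
  have hHt : ∀ (B : Matrix (Fin d) (Fin d) ℝ) a c, (B * m.Hᵀ) a c = B a (m.obs c) := by
    intro B a c
    simp [Matrix.mul_apply, Model.H]
  have hH : ∀ (B : Matrix (Fin d) (Fin q) ℝ) a c, (m.H * B) a c = B (m.obs a) c := by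
    intro B a c
    simp [Matrix.mul_apply, Model.H]
  have hS : m.sigmaO ^ 2 • (1 : Matrix (Fin q) (Fin q) ℝ) + m.H * m.localCov C i * m.Hᵀ =
      Matrix.diagonal fun c => m.sigmaO ^ 2 +
        (if m.dist i (m.obs c) ≤ m.l then C (m.obs c) (m.obs c) else 0) := by
    ext a c
    rw [Matrix.mul_assoc, Matrix.add_apply, hH, hHt, hloc]
    by_cases hac : a = c
    · subst hac
      by_cases h : m.dist i (m.obs a) ≤ m.l <;> simp [h]
    -- Two distinct observed coordinates cannot both lie within l of i, so the local innovation
    -- matrix is diagonal and is inverted entrywise.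
    · have h2 := hsep a c hac
      have h3 := hm.dist_triangle (m.obs a) i (m.obs c)
      rw [hm.dist_symm (m.obs a) i] at h3
      by_cases h4 : m.dist i (m.obs a) ≤ m.l
      · have h5 : ¬ m.dist i (m.obs c) ≤ m.l := by intro h5; linarith
        simp [h5, hac]
      · simp [h4, hac]
  have hii : m.dist i i ≤ m.l := by rw [hm.dist_self]; exact hm.l_nonneg
  have hne : ∀ c, m.sigmaO ^ 2 +
      (if m.dist i (m.obs c) ≤ m.l then C (m.obs c) (m.obs c) else 0) ≠ 0 := by
    intro c
    have := hC (m.obs c)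
    split_ifs <;> positivity
  have hinv : (Matrix.diagonal fun c => m.sigmaO ^ 2 +
        (if m.dist i (m.obs c) ≤ m.l then C (m.obs c) (m.obs c) else 0))⁻¹ =
      Matrix.diagonal fun c => (m.sigmaO ^ 2 +
        (if m.dist i (m.obs c) ≤ m.l then C (m.obs c) (m.obs c) else 0))⁻¹ := by
    apply Matrix.inv_eq_right_inv
    rw [Matrix.diagonal_mul_diagonal, ← Matrix.diagonal_one]
    congr 1
    funext c
    exact mul_inv_cancel₀ (hne c)
  change m.localGain C i i k = _
  rw [Model.localGain, hS, hinv, Matrix.mul_diagonal, hHt, hloc]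
  by_cases h : m.dist i (m.obs k) ≤ m.l <;> simp [h, hii, div_eq_mul_inv]

/-- The noise driving one step of the spread: an observation sample and a system sample for each
ensemble member. -/
abbrev Noise (d q K : ℕ) := Fin K → EuclideanSpace ℝ (Fin q) × EuclideanSpace ℝ (Fin d)

/-- One full step of the forecast spread. -/
def spreadStep (m : Model d q) (n : ℕ) (D : Fin K → EuclideanSpace ℝ (Fin d))
    (x : Noise d q K) (k : Fin K) : EuclideanSpace ℝ (Fin d) :=
  √m.r • ((m.A n).toEuclideanLin (analysisStep m D (fun k' => (x k').1) k) + (x k).2)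

/-- The noise-free part of the analysis spread. -/
def resid (m : Model d q) (D : Fin K → EuclideanSpace ℝ (Fin d)) (k : Fin K) (a : Fin d) : ℝ :=
  D k a - ∑ c, m.gain (ensembleCov D) a c * D k (m.obs c)

/-- The conditional expectation of the covariance of the analysis spread. -/
def postCov (m : Model d q) (D : Fin K → EuclideanSpace ℝ (Fin d)) (a b : Fin d) : ℝ :=
  (K : ℝ)⁻¹ * ∑ k, resid m D k a * resid m D k b +
    m.sigmaO ^ 2 * ∑ c, m.gain (ensembleCov D) a c * m.gain (ensembleCov D) b c

/-- The conditional expectation of the covariance of the next forecast spread. -/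
def expCov (m : Model d q) (n : ℕ) (sigmaXi : ℝ) (D : Fin K → EuclideanSpace ℝ (Fin d))
    (i j : Fin d) : ℝ :=
  m.r * ((∑ a, ∑ b, m.A n i a * m.A n j b * postCov m D a b) + if i = j then sigmaXi ^ 2 else 0)

lemma spreadStep_apply (m : Model d q) (n : ℕ) (D : Fin K → EuclideanSpace ℝ (Fin d))
    (x : Noise d q K) (k : Fin K) (i : Fin d) :
    spreadStep m n D x k i = √m.r * ((∑ a, m.A n i a * (resid m D k a +
      ∑ c, m.gain (ensembleCov D) a c * (x k).1 c)) + (x k).2 i) := by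
  have hH : ∀ (v : EuclideanSpace ℝ (Fin d)) c, (m.H *ᵥ v.ofLp) c = v (m.obs c) := by
    intro v c
    simp [Matrix.mulVec, dotProduct, Model.H]
  simp only [spreadStep, analysisStep, resid, PiLp.smul_apply, PiLp.add_apply, smul_eq_mul,
    Matrix.toLpLin_apply, Matrix.sub_mulVec, Matrix.one_mulVec, ← Matrix.mulVec_mulVec,
    WithLp.ofLp_add]
  congr 2
  simp only [Matrix.mulVec, dotProduct, Pi.add_apply, Pi.sub_apply]
  refine Finset.sum_congr rfl fun a _ => ?_
  congr 3
  refine Finset.sum_congr rfl fun c _ => ?_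
  congr 1
  exact hH (D k) c

section Bounds

variable {m : Model d q} (hm : m.Standing)
  (hsep : ∀ i j, i ≠ j → 2 * m.l < m.dist (m.obs i) (m.obs j))
include hm hsep

/-- At most one observed coordinate enters each row of the gain. -/
lemma gain_cases (D : Fin K → EuclideanSpace ℝ (Fin d)) (a : Fin d) :
    (∀ c, m.gain (ensembleCov D) a c = 0) ∨
      ∃ c, (∀ c', c' ≠ c → m.gain (ensembleCov D) a c' = 0) ∧
        m.gain (ensembleCov D) a c = ensembleCov D a (m.obs c) /
          (m.sigmaO ^ 2 + ensembleCov D (m.obs c) (m.obs c)) := by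
  have hg := fun k => Model.gain_apply hm hsep (ensembleCov_self_nonneg D) a k
  by_cases h : ∃ c, m.dist a (m.obs c) ≤ m.l
  · obtain ⟨c, hc⟩ := h
    refine Or.inr ⟨c, fun c' hc' => ?_, ?_⟩
    · rw [hg, if_neg]
      intro h1
      have h2 := hsep c' c hc'
      have h3 := hm.dist_triangle (m.obs c') a (m.obs c)
      rw [hm.dist_symm (m.obs c') a] at h3
      linarith
    · rw [hg, if_pos hc]
  · refine Or.inl fun c => ?_
    rw [hg, if_neg]
    exact fun h1 => h ⟨c, h1⟩

/-- With a single active observation o, the posterior variance is the quadratic C_aa - 2g C_ao +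
g²(σ_o² + C_oo) in the gain g. The scalar Kalman gain minimizes it, and g = 0 returns C_aa. -/
lemma postCov_self_le (D : Fin K → EuclideanSpace ℝ (Fin d)) (a : Fin d) :
    postCov m D a a ≤ ensembleCov D a a := by
  have hσ : 0 < m.sigmaO ^ 2 := pow_pos hm.sigmaO_pos 2
  rcases gain_cases hm hsep D a with h | ⟨c, h0, hc⟩
  · simp [postCov, resid, h, ensembleCov_apply]
  · have hs : ∀ f : Fin q → ℝ, ∑ c', m.gain (ensembleCov D) a c' * f c' =
        m.gain (ensembleCov D) a c * f c := fun f =>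
      Finset.sum_eq_single c (fun c' _ h' => by rw [h0 c' h', zero_mul]) (by simp)
    have hpos := ensembleCov_self_nonneg D (m.obs c)
    set g := m.gain (ensembleCov D) a c with hgdef
    have hexp : postCov m D a a = ensembleCov D a a - 2 * g * ensembleCov D a (m.obs c) +
        g ^ 2 * (m.sigmaO ^ 2 + ensembleCov D (m.obs c) (m.obs c)) := by
      simp only [postCov, resid, hs, ensembleCov_apply]
      have : ∀ k, (D k a - g * D k (m.obs c)) * (D k a - g * D k (m.obs c)) =
        D k a * D k a - 2 * g * (D k a * D k (m.obs c)) +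
          g ^ 2 * (D k (m.obs c) * D k (m.obs c)) := fun k => by ring
      simp only [this, Finset.sum_add_distrib, Finset.sum_sub_distrib, ← Finset.mul_sum]
      ring
    have hg2 : g * (m.sigmaO ^ 2 + ensembleCov D (m.obs c) (m.obs c)) =
        ensembleCov D a (m.obs c) := by
      rw [hc]; field_simp
    rw [hexp, ← hg2]
    nlinarith [mul_nonneg (sq_nonneg g) (add_nonneg hσ.le hpos)]

-- The posterior covariance is a sum of Gram forms with nonnegative coefficients, so its
-- off-diagonal entries are controlled by the diagonal ones.
omit hm hsep in
lemma abs_postCov_le_half (D : Fin K → EuclideanSpace ℝ (Fin d)) (a b : Fin d) :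
    |postCov m D a b| ≤ (postCov m D a a + postCov m D b b) / 2 := by
  have key : ∀ {ι : Type} (s : Finset ι) (f g : ι → ℝ),
      |∑ k ∈ s, f k * g k| ≤ ((∑ k ∈ s, f k * f k) + ∑ k ∈ s, g k * g k) / 2 := by
    intro ι s f g
    rw [← Finset.sum_add_distrib, Finset.sum_div]
    refine (Finset.abs_sum_le_sum_abs _ _).trans (Finset.sum_le_sum fun k _ => ?_)
    rw [abs_le]
    constructor <;> nlinarith [sq_nonneg (f k + g k), sq_nonneg (f k - g k)]
  have hK : (0 : ℝ) ≤ (K : ℝ)⁻¹ := by positivity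
  have h1 := key Finset.univ (fun k => resid m D k a) (fun k => resid m D k b)
  have h2 := key Finset.univ (fun c => m.gain (ensembleCov D) a c)
    (fun c => m.gain (ensembleCov D) b c)
  unfold postCov
  refine (abs_add_le _ _).trans ?_
  rw [abs_mul, abs_mul, abs_of_nonneg hK, abs_of_nonneg (sq_nonneg m.sigmaO)]
  nlinarith [mul_le_mul_of_nonneg_left h1 hK, mul_le_mul_of_nonneg_left h2 (sq_nonneg m.sigmaO)]

lemma abs_postCov_le (D : Fin K → EuclideanSpace ℝ (Fin d)) {B : ℝ}
    (hB : ∀ i, ensembleCov D i i ≤ B) (a b : Fin d) : |postCov m D a b| ≤ B := by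
  have h1 := abs_postCov_le_half (m := m) D a b
  have h2 := (postCov_self_le hm hsep D a).trans (hB a)
  have h3 := (postCov_self_le hm hsep D b).trans (hB b)
  linarith

omit hsep in
/-- The weights `max (lam ^ d(i,j)) θ` are submultiplicative along the metric. -/
lemma weight_mul_le {lam θ : ℝ} (hl : 0 < lam) (hl1 : lam ≤ 1) (hθ : 0 ≤ θ) (hθ1 : θ ≤ 1)
    (a b c : Fin d) :
    max (lam ^ m.dist a b) θ * max (lam ^ m.dist b c) θ ≤ max (lam ^ m.dist a c) θ := by
  have e1 : lam ^ m.dist a b ≤ 1 := Real.rpow_le_one hl.le hl1 (hm.dist_nonneg _ _)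
  have e2 : lam ^ m.dist b c ≤ 1 := Real.rpow_le_one hl.le hl1 (hm.dist_nonneg _ _)
  have e3 : lam ^ m.dist a b * lam ^ m.dist b c ≤ lam ^ m.dist a c := by
    rw [← Real.rpow_add hl]
    exact Real.rpow_le_rpow_of_exponent_ge hl hl1 (hm.dist_triangle a b c)
  have p1 : 0 < lam ^ m.dist a b := Real.rpow_pos_of_pos hl _
  have p2 : 0 < lam ^ m.dist b c := Real.rpow_pos_of_pos hl _
  -- If either factor equals θ the product is at most θ, since the other is at most 1; otherwise the
  -- triangle inequality decides.
  rcases le_total (lam ^ m.dist a b) θ with h1 | h1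
  · rw [max_eq_right h1]
    refine le_trans ?_ (le_max_right _ _)
    exact mul_le_of_le_one_right hθ (max_le e2 hθ1)
  · rw [max_eq_left h1]
    rcases le_total (lam ^ m.dist b c) θ with h2 | h2
    · rw [max_eq_right h2]
      exact (mul_le_of_le_one_left hθ e1).trans (le_max_right _ _)
    · rw [max_eq_left h2]
      exact e3.trans (le_max_left _ _)

/-- Expanding (I - KH)C(I - KH)ᵀ + σ_o²KKᵀ gives five terms. Relative to the weights, each row of
the gain has mass at most u = M/σ_o². Passing through an observed coordinate costs nothing by
submultiplicativity, so the terms add up to (M(1+u)² + σ_o²u²) times the weight. -/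
lemma abs_postCov_le_weight (D : Fin K → EuclideanSpace ℝ (Fin d)) {lam θ M : ℝ} (hl : 0 < lam)
    (hl1 : lam ≤ 1) (hθ : 0 ≤ θ) (hθ1 : θ ≤ 1) (hM : 0 ≤ M)
    (hC : ∀ i j, |ensembleCov D i j| ≤ M * max (lam ^ m.dist i j) θ) (a b : Fin d) :
    |postCov m D a b| ≤ (M * (1 + M / m.sigmaO ^ 2) ^ 2 + M ^ 2 / m.sigmaO ^ 2) *
      max (lam ^ m.dist a b) θ := by
  have hσ : 0 < m.sigmaO ^ 2 := pow_pos hm.sigmaO_pos 2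
  set w : Fin d → Fin d → ℝ := fun i j => max (lam ^ m.dist i j) θ with hw
  have hwpos : ∀ i j, 0 < w i j := fun i j =>
    lt_of_lt_of_le (Real.rpow_pos_of_pos hl _) (le_max_left _ _)
  have hwsymm : ∀ i j, w i j = w j i := fun i j => by simp only [hw, hm.dist_symm i j]
  have hwmul : ∀ i j k, w i j * w j k ≤ w i k := weight_mul_le hm hl hl1 hθ hθ1
  set G := fun i c => m.gain (ensembleCov D) i c with hG
  set u := M / m.sigmaO ^ 2 with hu
  have hu0 : 0 ≤ u := by positivity
  -- each row of the gain is localized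
  have hrow : ∀ i, ∃ s : Fin q → ℝ, (∀ c, 0 ≤ s c) ∧ (∀ c, |G i c| = s c * w i (m.obs c)) ∧
      ∑ c, s c ≤ u := by
    intro i
    refine ⟨fun c => |G i c| / w i (m.obs c), fun c => div_nonneg (abs_nonneg _) (hwpos _ _).le,
      fun c => (div_mul_cancel₀ _ (hwpos _ _).ne').symm, ?_⟩
    rcases gain_cases hm hsep D i with h | ⟨c, h0, hc⟩
    · simpa [hG, h] using hu0
    · rw [Finset.sum_eq_single c (fun c' _ h' => by simp [hG, h0 c' h']) (by simp)]
      rw [div_le_iff₀ (hwpos _ _)]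
      have hpos := ensembleCov_self_nonneg D (m.obs c)
      simp only [hG, hc]
      rw [abs_div, abs_of_pos (by positivity :
        0 < m.sigmaO ^ 2 + ensembleCov D (m.obs c) (m.obs c)), hu, div_mul_eq_mul_div]
      exact div_le_div₀ (mul_nonneg hM (hwpos _ _).le) (hC _ _) hσ (by linarith)
  obtain ⟨s, hs0, hsG, hsu⟩ := hrow a
  obtain ⟨t, ht0, htG, htu⟩ := hrow b
  have hexp : postCov m D a b = ensembleCov D a b - ∑ c, G a c * ensembleCov D (m.obs c) b -
      ∑ c, G b c * ensembleCov D a (m.obs c) +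
      ∑ c, ∑ c', G a c * G b c' * ensembleCov D (m.obs c) (m.obs c') +
      m.sigmaO ^ 2 * ∑ c, G a c * G b c := by
    have e : ∀ k, resid m D k a * resid m D k b = D k a * D k b -
        ∑ c, G a c * (D k (m.obs c) * D k b) - ∑ c, G b c * (D k a * D k (m.obs c)) +
        ∑ c, ∑ c', G a c * G b c' * (D k (m.obs c) * D k (m.obs c')) := by
      intro k
      simp only [resid]
      rw [sub_mul, mul_sub, mul_sub, Finset.sum_mul_sum, Finset.sum_mul, Finset.mul_sum]
      have e1 : ∀ c, G a c * D k (m.obs c) * D k b = G a c * (D k (m.obs c) * D k b) :=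
        fun c => by ring
      have e2 : ∀ c, D k a * (G b c * D k (m.obs c)) = G b c * (D k a * D k (m.obs c)) :=
        fun c => by ring
      have e3 : ∀ c c', G a c * D k (m.obs c) * (G b c' * D k (m.obs c')) =
        G a c * G b c' * (D k (m.obs c) * D k (m.obs c')) := fun c c' => by ring
      simp only [hG] at e1 e2 e3 ⊢
      simp only [e1, e2, e3]
      ring
    unfold postCov
    simp only [e, Finset.sum_add_distrib, Finset.sum_sub_distrib, ensembleCov_apply]
    have f1 : ∀ (g : Fin q → ℝ) (F : Fin K → Fin q → ℝ), ∑ k, ∑ c, g c * F k c =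
        ∑ c, g c * ∑ k, F k c := by
      intro g F
      rw [Finset.sum_comm]
      simp only [Finset.mul_sum]
    have f2 : ∑ k, ∑ c, ∑ c', G a c * G b c' * (D k (m.obs c) * D k (m.obs c')) =
        ∑ c, ∑ c', G a c * G b c' * ∑ k, D k (m.obs c) * D k (m.obs c') := by
      rw [Finset.sum_comm]
      refine Finset.sum_congr rfl fun c _ => ?_
      rw [Finset.sum_comm]
      simp only [Finset.mul_sum]
    have f3 : ∀ (g : Fin q → ℝ) (F : Fin q → ℝ), ∑ c, g c * ((K : ℝ)⁻¹ * F c) =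
        (K : ℝ)⁻¹ * ∑ c, g c * F c := by
      intro g F
      rw [Finset.mul_sum]
      exact Finset.sum_congr rfl fun c _ => by ring
    rw [f1, f1, f2, f3, f3]
    simp only [f3, ← Finset.mul_sum]
    ring
  have b1 : |∑ c, G a c * ensembleCov D (m.obs c) b| ≤ u * (M * w a b) := by
    refine (Finset.abs_sum_le_sum_abs _ _).trans ?_
    refine le_trans (Finset.sum_le_sum (g := fun c => s c * (M * w a b)) fun c _ => ?_) ?_
    · rw [abs_mul, hsG]
      have := mul_le_mul_of_nonneg_left (hC (m.obs c) b) (mul_nonneg (hs0 c) (hwpos a (m.obs c)).le)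
      refine this.trans ?_
      have h2 := mul_le_mul_of_nonneg_left (hwmul a (m.obs c) b) (mul_nonneg (hs0 c) hM)
      simp only [hw] at h2 ⊢
      nlinarith
    · rw [← Finset.sum_mul]
      exact mul_le_mul_of_nonneg_right hsu (mul_nonneg hM (hwpos _ _).le)
  have b2 : |∑ c, G b c * ensembleCov D a (m.obs c)| ≤ u * (M * w a b) := by
    refine (Finset.abs_sum_le_sum_abs _ _).trans ?_
    refine le_trans (Finset.sum_le_sum (g := fun c => t c * (M * w a b)) fun c _ => ?_) ?_
    · rw [abs_mul, htG]
      have := mul_le_mul_of_nonneg_left (hC a (m.obs c)) (mul_nonneg (ht0 c) (hwpos b (m.obs c)).le)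
      refine this.trans ?_
      have h2 := mul_le_mul_of_nonneg_left (hwmul a (m.obs c) b) (mul_nonneg (ht0 c) hM)
      rw [hwsymm b (m.obs c)]
      simp only [hw] at h2 ⊢
      nlinarith
    · rw [← Finset.sum_mul]
      exact mul_le_mul_of_nonneg_right htu (mul_nonneg hM (hwpos _ _).le)
  have hst : (∑ c, s c) * (∑ c, t c) ≤ u * u :=
    mul_le_mul hsu htu (Finset.sum_nonneg fun c _ => ht0 c) hu0
  have b3 : |∑ c, ∑ c', G a c * G b c' * ensembleCov D (m.obs c) (m.obs c')| ≤
      u * u * (M * w a b) := by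
    refine (Finset.abs_sum_le_sum_abs _ _).trans ?_
    refine le_trans (Finset.sum_le_sum (g := fun c => ∑ c', s c * t c' * (M * w a b))
      fun c _ => (Finset.abs_sum_le_sum_abs _ _).trans (Finset.sum_le_sum fun c' _ => ?_)) ?_
    · rw [abs_mul, abs_mul, hsG, htG]
      have := mul_le_mul_of_nonneg_left (hC (m.obs c) (m.obs c'))
        (mul_nonneg (mul_nonneg (hs0 c) (hwpos a (m.obs c)).le)
          (mul_nonneg (ht0 c') (hwpos b (m.obs c')).le))
      refine this.trans ?_
      have h1 := mul_le_mul_of_nonneg_right (hwmul a (m.obs c) (m.obs c'))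
        (hwpos (m.obs c') b).le
      have h2 := mul_le_mul_of_nonneg_left (h1.trans (hwmul a (m.obs c') b))
        (mul_nonneg (mul_nonneg (hs0 c) (ht0 c')) hM)
      rw [hwsymm b (m.obs c')]
      simp only [hw] at h2 ⊢
      nlinarith
    · simp only [← Finset.sum_mul, ← Finset.mul_sum]
      exact mul_le_mul_of_nonneg_right hst (mul_nonneg hM (hwpos _ _).le)
  have b4 : |∑ c, G a c * G b c| ≤ u * u * w a b := by
    refine (Finset.abs_sum_le_sum_abs _ _).trans ?_
    refine le_trans (Finset.sum_le_sum (g := fun c => ∑ c', s c * t c' * w a b)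
      fun c _ => ?_) ?_
    · rw [abs_mul, hsG, htG]
      -- The diagonal sum is enlarged to a double sum so that it factors into the two row masses.
      have h3 : s c * t c * w a b ≤ ∑ c', s c * t c' * w a b :=
        Finset.single_le_sum (f := fun c' => s c * t c' * w a b)
          (fun c' _ => mul_nonneg (mul_nonneg (hs0 c) (ht0 c')) (hwpos _ _).le)
          (Finset.mem_univ c)
      refine le_trans ?_ h3
      rw [hwsymm b (m.obs c)]
      have h2 := mul_le_mul_of_nonneg_left (hwmul a (m.obs c) b) (mul_nonneg (hs0 c) (ht0 c))
      nlinarith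
    · simp only [← Finset.sum_mul, ← Finset.mul_sum]
      exact mul_le_mul_of_nonneg_right hst (hwpos _ _).le
  have b0 := hC a b
  have hM2 : M ^ 2 / m.sigmaO ^ 2 = m.sigmaO ^ 2 * (u * u) := by
    rw [hu]; field_simp
  rw [hexp, hM2]
  have b4' := mul_le_mul_of_nonneg_left b4 hσ.le
  have hb4 : |m.sigmaO ^ 2 * ∑ c, G a c * G b c| ≤ m.sigmaO ^ 2 * (u * u * w a b) := by
    rw [abs_mul, abs_of_pos hσ]; exact b4'
  change |ensembleCov D a b| ≤ M * w a b at b0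
  change _ ≤ _ * w a b
  have e : (M * (1 + u) ^ 2 + m.sigmaO ^ 2 * (u * u)) * w a b = M * w a b + u * (M * w a b) +
    u * (M * w a b) + u * u * (M * w a b) + m.sigmaO ^ 2 * (u * u * w a b) := by ring
  rw [e]
  exact ((abs_add_le _ _).trans (add_le_add ((abs_add_le _ _).trans (add_le_add ((abs_sub _ _).trans
    (add_le_add ((abs_sub _ _).trans (add_le_add b0 b1)) b2)) b3)) hb4))

variable {lam : ℝ} (hl : 0 < lam) (hl1 : lam ≤ 1) (hA : WeakInteraction m lam)
include hl hl1 hA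

omit hsep in
lemma sum_abs_le (n : ℕ) (i : Fin d) : ∑ a, |m.A n i a| ≤ lam := by
  refine le_trans (Finset.sum_le_sum fun a _ => ?_) (hA n i)
  refine le_mul_of_one_le_right (abs_nonneg _) ?_
  exact Real.one_le_rpow_of_pos_of_le_one_of_nonpos hl hl1 (by
    have := hm.dist_nonneg i a; linarith)

lemma abs_expCov_le (n : ℕ) (sigmaXi : ℝ) (D : Fin K → EuclideanSpace ℝ (Fin d)) {B : ℝ}
    (hB0 : 0 ≤ B) (hB : ∀ i, ensembleCov D i i ≤ B) (i : Fin d) :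
    expCov m n sigmaXi D i i ≤ m.r * (lam ^ 2 * B + sigmaXi ^ 2) := by
  have hr : 0 ≤ m.r := by have := hm.one_lt_r; linarith
  unfold expCov
  rw [if_pos rfl]
  refine mul_le_mul_of_nonneg_left (add_le_add ?_ le_rfl) hr
  have h1 : ∑ a, ∑ b, m.A n i a * m.A n i b * postCov m D a b ≤
      ∑ a, ∑ b, |m.A n i a| * |m.A n i b| * B := by
    refine Finset.sum_le_sum fun a _ => Finset.sum_le_sum fun b _ => ?_
    refine (le_abs_self _).trans ?_
    rw [abs_mul, abs_mul]
    exact mul_le_mul_of_nonneg_left (abs_postCov_le hm hsep D hB a b) (by positivity)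
  refine h1.trans ?_
  simp only [← Finset.sum_mul, ← Finset.mul_sum]
  refine mul_le_mul_of_nonneg_right ?_ hB0
  have h2 := sum_abs_le hm hl hl1 hA n i
  rw [pow_two]
  exact mul_le_mul h2 h2 (Finset.sum_nonneg fun _ _ => abs_nonneg _) hl.le

/-- Off the diagonal the system noise is absent. Moving from (a,b) to (i,j) changes the weight by at
most λ^(-d(i,a)-d(j,b)), which the weighted row sums of A_n absorb; each row sum contributes a
factor λ. -/
lemma abs_expCov_le_weight (n : ℕ) (sigmaXi : ℝ) (D : Fin K → EuclideanSpace ℝ (Fin d)) {θ M : ℝ}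
    (hθ : 0 ≤ θ) (hθ1 : θ ≤ 1) (hM : 0 ≤ M)
    (hC : ∀ i j, |ensembleCov D i j| ≤ M * max (lam ^ m.dist i j) θ) {i j : Fin d} (hij : i ≠ j) :
    |expCov m n sigmaXi D i j| ≤ m.r * (lam ^ 2 *
      (M * (1 + M / m.sigmaO ^ 2) ^ 2 + M ^ 2 / m.sigmaO ^ 2)) * max (lam ^ m.dist i j) θ := by
  have hr : 0 ≤ m.r := by have := hm.one_lt_r; linarith
  set S := M * (1 + M / m.sigmaO ^ 2) ^ 2 + M ^ 2 / m.sigmaO ^ 2 with hS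
  have hS0 : 0 ≤ S := by positivity
  unfold expCov
  rw [if_neg hij, add_zero, abs_mul, abs_of_nonneg hr, mul_assoc]
  refine mul_le_mul_of_nonneg_left ?_ hr
  have hw0 : ∀ a b, 0 ≤ max (lam ^ m.dist a b) θ := fun a b => hθ.trans (le_max_right _ _)
  have hle : ∀ a b, lam ^ m.dist a b ≤ max (lam ^ m.dist a b) θ := fun a b => le_max_left _ _
  have hp : ∀ a b, 0 < lam ^ m.dist a b := fun a b => Real.rpow_pos_of_pos hl _
  have key : ∀ a b, |m.A n i a * m.A n j b * postCov m D a b| ≤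
      (|m.A n i a| * lam ^ (-(m.dist i a))) * (|m.A n j b| * lam ^ (-(m.dist j b))) *
        (S * max (lam ^ m.dist i j) θ) := by
    intro a b
    rw [abs_mul, abs_mul]
    have h1 := abs_postCov_le_weight hm hsep D hl hl1 hθ hθ1 hM hC a b
    have h2 : lam ^ m.dist i a * max (lam ^ m.dist a b) θ * lam ^ m.dist j b ≤
        max (lam ^ m.dist i j) θ := by
      refine le_trans ?_ (weight_mul_le hm hl hl1 hθ hθ1 i b j)
      rw [hm.dist_symm j b]
      refine mul_le_mul ?_ (hle b j) (hp _ _).le (hw0 _ _)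
      refine le_trans ?_ (weight_mul_le hm hl hl1 hθ hθ1 i a b)
      exact mul_le_mul_of_nonneg_right (hle i a) (hw0 _ _)
    have h3 : max (lam ^ m.dist a b) θ ≤ lam ^ (-(m.dist i a)) * lam ^ (-(m.dist j b)) *
        max (lam ^ m.dist i j) θ := by
      rw [Real.rpow_neg hl.le, Real.rpow_neg hl.le, ← mul_inv, ← div_eq_inv_mul,
        le_div_iff₀ (mul_pos (hp _ _) (hp _ _))]
      calc _ = _ := by ring
        _ ≤ _ := h2
    calc |m.A n i a| * |m.A n j b| * |postCov m D a b|
        ≤ |m.A n i a| * |m.A n j b| * (S * (lam ^ (-(m.dist i a)) * lam ^ (-(m.dist j b)) *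
          max (lam ^ m.dist i j) θ)) := by
          refine mul_le_mul_of_nonneg_left (h1.trans ?_) (by positivity)
          exact mul_le_mul_of_nonneg_left h3 hS0
      _ = _ := by ring
  refine (Finset.abs_sum_le_sum_abs _ _).trans ?_
  refine (Finset.sum_le_sum fun a _ => (Finset.abs_sum_le_sum_abs _ _).trans
    (Finset.sum_le_sum fun b _ => key a b)).trans ?_
  simp only [← Finset.sum_mul, ← Finset.mul_sum]
  rw [mul_assoc (lam ^ 2)]
  refine mul_le_mul_of_nonneg_right ?_ (mul_nonneg hS0 (hw0 _ _))
  rw [pow_two]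
  refine mul_le_mul (hA n i) (hA n j) (Finset.sum_nonneg fun b _ => ?_) hl.le
  exact mul_nonneg (abs_nonneg _) (Real.rpow_pos_of_pos hl _).le

end Bounds

end

/-! ### Exponential moments of Gaussian quadratic forms. -/

section

variable {K : ℕ}

open scoped NNReal in
/-- Exponential moment of the square of a real Gaussian variable. -/
lemma lintegral_exp_sq_gaussianReal_le (h α : ℝ) (v : ℝ≥0) (hu : |2 * h * v| ≤ 1 / 2) :
    ∫⁻ z, ENNReal.ofReal (Real.exp (h * (α + z) ^ 2)) ∂gaussianReal 0 v ≤
      ENNReal.ofReal (Real.exp (h * (α ^ 2 + v) + 4 * h ^ 2 * v ^ 2 + 4 * h ^ 2 * v * α ^ 2)) := by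
  by_cases hv : v = 0
  · subst hv
    simp [gaussianReal_zero_var]
  have hvpos : (0 : ℝ) < v := by positivity
  set u : ℝ := 2 * h * v with hudef
  have hu' := abs_le.1 hu
  have h1u : 0 < 1 - u := by linarith [hu'.2]
  have hwr : 0 < (v : ℝ) / (1 - u) := by positivity
  -- Completing the square, the tilted density is a multiple of a Gaussian density with variance w =
  -- v/(1-u) and mean 2hαw, which makes the integral explicit.
  set w : ℝ≥0 := ⟨(v : ℝ) / (1 - u), hwr.le⟩ with hw
  have hwc : (w : ℝ) = v / (1 - u) := rfl
  have hw0 : w ≠ 0 := NNReal.coe_ne_zero.1 hwr.ne'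
  set c : ℝ := √(1 - u)⁻¹ * Real.exp (2 * h ^ 2 * α ^ 2 * w + h * α ^ 2) with hc
  have hpt : ∀ z, gaussianPDFReal 0 v z * Real.exp (h * (α + z) ^ 2) =
      c * gaussianPDFReal (2 * h * α * w) w z := by
    intro z
    rw [gaussianPDFReal, gaussianPDFReal, hc]
    have e1 : (√(2 * Real.pi * v))⁻¹ = √(1 - u)⁻¹ * (√(2 * Real.pi * w))⁻¹ := by
      rw [← Real.sqrt_inv, ← Real.sqrt_inv, ← Real.sqrt_mul (by positivity), hwc]
      congr 1
      field_simp
    rw [e1]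
    have e2 : Real.exp (-(z - 0) ^ 2 / (2 * v)) * Real.exp (h * (α + z) ^ 2) =
        Real.exp (2 * h ^ 2 * α ^ 2 * w + h * α ^ 2) *
          Real.exp (-(z - 2 * h * α * w) ^ 2 / (2 * w)) := by
      rw [← Real.exp_add, ← Real.exp_add]
      congr 1
      have hh : h = u / (2 * v) := by rw [hudef]; field_simp
      rw [hwc, hh]
      field_simp
      ring
    linear_combination (√(1 - u)⁻¹ * (√(2 * Real.pi * w))⁻¹) * e2
  have hcnn : 0 ≤ c := by positivity
  have hint : ∫⁻ z, ENNReal.ofReal (Real.exp (h * (α + z) ^ 2)) ∂gaussianReal 0 v =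
      ENNReal.ofReal c := by
    rw [gaussianReal_of_var_ne_zero _ hv,
      lintegral_withDensity_eq_lintegral_mul _ (measurable_gaussianPDF _ _) (by fun_prop)]
    have : ∀ z, (gaussianPDF 0 v * fun z => ENNReal.ofReal (Real.exp (h * (α + z) ^ 2))) z =
        ENNReal.ofReal c * gaussianPDF (2 * h * α * w) w z := by
      intro z
      simp only [Pi.mul_apply, gaussianPDF]
      rw [← ENNReal.ofReal_mul (gaussianPDFReal_nonneg _ _ _), hpt, ENNReal.ofReal_mul hcnn]
    simp only [this]
    rw [lintegral_const_mul _ (measurable_gaussianPDF _ _), lintegral_gaussianPDF_eq_one _ hw0,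
      mul_one]
  rw [hint]
  refine ENNReal.ofReal_le_ofReal ?_
  have hlog : -Real.log (1 - u) ≤ u + 2 * u ^ 2 := by
    have h3 := Real.abs_log_sub_add_sum_range_le (x := u) (by
      have : |u| ≤ 1 / 2 := hu
      linarith) 1
    simp at h3
    have h4 : u ^ 2 / (1 - |u|) ≤ 2 * u ^ 2 := by
      have : |u| ≤ 1 / 2 := hu
      rw [div_le_iff₀ (by linarith)]
      nlinarith [sq_nonneg u]
    have := (abs_le.1 (h3.trans h4)).1
    linarith
  have hs : √(1 - u)⁻¹ ≤ Real.exp (u / 2 + u ^ 2) := by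
    rw [Real.sqrt_le_left (Real.exp_pos _).le, ← Real.exp_nat_mul]
    rw [← Real.exp_log h1u, ← Real.exp_neg]
    refine Real.exp_le_exp.2 ?_
    push_cast
    linarith
  have hw2 : (w : ℝ) ≤ 2 * v := by
    rw [hwc, div_le_iff₀ h1u]
    nlinarith [hu'.2]
  calc c ≤ Real.exp (u / 2 + u ^ 2) * Real.exp (2 * h ^ 2 * α ^ 2 * w + h * α ^ 2) :=
        mul_le_mul_of_nonneg_right hs (Real.exp_pos _).le
    _ = Real.exp (u / 2 + u ^ 2 + (2 * h ^ 2 * α ^ 2 * w + h * α ^ 2)) := (Real.exp_add _ _).symm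
    _ ≤ _ := by
      refine Real.exp_le_exp.2 ?_
      have := mul_le_mul_of_nonneg_left hw2 (by positivity : 0 ≤ 2 * h ^ 2 * α ^ 2)
      rw [hudef]
      nlinarith

/-- A linear functional of an isotropic Gaussian vector. -/
lemma map_dot_multivariateGaussian {q : ℕ} (s : ℝ) (p : Fin q → ℝ) :
    (multivariateGaussian 0 (s ^ 2 • (1 : Matrix (Fin q) (Fin q) ℝ))).map
      (fun x => ∑ c, p c * x c) = gaussianReal 0 (Real.toNNReal (s ^ 2 * ∑ c, p c ^ 2)) := by
  set μ := multivariateGaussian 0 (s ^ 2 • (1 : Matrix (Fin q) (Fin q) ℝ)) with hμ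
  have hS : (s ^ 2 • (1 : Matrix (Fin q) (Fin q) ℝ)).PosSemidef :=
    Matrix.PosSemidef.one.smul (sq_nonneg s)
  set y : EuclideanSpace ℝ (Fin q) := WithLp.toLp 2 p with hy
  have hL : (fun x : EuclideanSpace ℝ (Fin q) => ∑ c, p c * x c) = ⇑(innerSL ℝ y) := by
    ext x
    simp [PiLp.inner_apply, hy, mul_comm]
  rw [hL, IsGaussian.map_eq_gaussianReal, ContinuousLinearMap.integral_comp_id_comm]
  · congr 1
    · simp [hμ]
    · congr 1
      have h1 : Var[innerSL ℝ y; μ] = covarianceBilin μ y y := by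
        rw [covarianceBilin_self IsGaussian.memLp_two_id]
        rfl
      rw [h1, covarianceBilin_multivariateGaussian hS]
      simp [Matrix.smul_mulVec, dotProduct, hy, Finset.mul_sum, pow_two]
      exact Finset.sum_congr rfl fun c _ => by ring
  · exact IsGaussian.integrable_id

/-- The law of the noise of a single ensemble member. -/
def memberLaw (d q : ℕ) (sO sX : ℝ) :
    Measure (EuclideanSpace ℝ (Fin q) × EuclideanSpace ℝ (Fin d)) :=
  (multivariateGaussian 0 (sO ^ 2 • (1 : Matrix (Fin q) (Fin q) ℝ))).prod
    (multivariateGaussian 0 (sX ^ 2 • (1 : Matrix (Fin d) (Fin d) ℝ)))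

instance (d q : ℕ) (sO sX : ℝ) : IsProbabilityMeasure (memberLaw d q sO sX) := by
  unfold memberLaw; infer_instance

lemma map_dot_memberLaw {d q : ℕ} (sO sX : ℝ) (p : Fin q → ℝ) (v : Fin d → ℝ) :
    (memberLaw d q sO sX).map (fun x => (∑ c, p c * x.1 c) + ∑ i, v i * x.2 i) =
      gaussianReal 0 (Real.toNNReal (sO ^ 2 * ∑ c, p c ^ 2 + sX ^ 2 * ∑ i, v i ^ 2)) := by
  have m1 : Measurable fun x : EuclideanSpace ℝ (Fin q) => ∑ c, p c * x c := by fun_prop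
  have m2 : Measurable fun x : EuclideanSpace ℝ (Fin d) => ∑ c, v c * x c := by fun_prop
  have hind : IndepFun (fun x : EuclideanSpace ℝ (Fin q) × EuclideanSpace ℝ (Fin d) =>
      ∑ c, p c * x.1 c) (fun x => ∑ i, v i * x.2 i) (memberLaw d q sO sX) :=
    indepFun_prod m1 m2
  have h1 : (memberLaw d q sO sX).map (fun x => ∑ c, p c * x.1 c) =
      gaussianReal 0 (Real.toNNReal (sO ^ 2 * ∑ c, p c ^ 2)) := by
    rw [← map_dot_multivariateGaussian]
    change Measure.map ((fun x : EuclideanSpace ℝ (Fin q) => ∑ c, p c * x c) ∘ Prod.fst) _ = _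
    rw [← Measure.map_map m1 measurable_fst, memberLaw, Measure.map_fst_prod]
    simp
  have h2 : (memberLaw d q sO sX).map (fun x => ∑ i, v i * x.2 i) =
      gaussianReal 0 (Real.toNNReal (sX ^ 2 * ∑ c, v c ^ 2)) := by
    rw [← map_dot_multivariateGaussian]
    change Measure.map ((fun x : EuclideanSpace ℝ (Fin d) => ∑ c, v c * x c) ∘ Prod.snd) _ = _
    rw [← Measure.map_map m2 measurable_snd, memberLaw, Measure.map_snd_prod]
    simp
  have h3 := gaussianReal_add_gaussianReal_of_indepFun hind h1 h2
  rw [add_zero, ← Real.toNNReal_add (by positivity) (by positivity)] at h3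
  exact h3

/-- The law of the noise of a full step of the ensemble. -/
def stepLaw (d q K : ℕ) (sO sX : ℝ) : Measure (Noise d q K) :=
  Measure.pi fun _ => memberLaw d q sO sX

instance (d q K : ℕ) (sO sX : ℝ) : IsProbabilityMeasure (stepLaw d q K sO sX) := by
  unfold stepLaw; infer_instance

lemma lintegral_pi_prod {ι X : Type*} [Fintype ι] [MeasurableSpace X] (μ : Measure X)
    [IsProbabilityMeasure μ] {f : ι → X → ℝ≥0∞} (hf : ∀ k, Measurable (f k)) :
    ∫⁻ x, ∏ k, f k (x k) ∂Measure.pi (fun _ : ι => μ) = ∏ k, ∫⁻ y, f k y ∂μ := by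
  have hi : iIndepFun (fun k (x : ι → X) => f k (x k)) (Measure.pi fun _ : ι => μ) :=
    iIndepFun_pi (X := f) (fun k => (hf k).aemeasurable)
  rw [lintegral_prod_eq_prod_lintegral_of_indepFun _ _ hi
    (fun k => (hf k).comp (measurable_pi_apply k))]
  refine Finset.prod_congr rfl fun k _ => ?_
  exact (measurePreserving_eval (fun _ : ι => μ) k).lintegral_comp (hf k)

/-- Exponential moments of a sum of squares of shifted independent Gaussians. -/
lemma lintegral_exp_sum_sq_le {X : Type*} [MeasurableSpace X] (μ : Measure X)
    [IsProbabilityMeasure μ] {ℓ : X → ℝ} (mℓ : Measurable ℓ) {V : ℝ} (hV0 : 0 ≤ V)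
    (hlaw : μ.map ℓ = gaussianReal 0 (Real.toNNReal V)) (α : Fin K → ℝ) (h : ℝ)
    (hu : |2 * h * V| ≤ 1 / 2) :
    ∫⁻ x, ENNReal.ofReal (Real.exp (h * ∑ k, (α k + ℓ (x k)) ^ 2))
        ∂Measure.pi (fun _ : Fin K => μ) ≤
      ENNReal.ofReal (Real.exp (∑ k, (h * (α k ^ 2 + V) + 4 * h ^ 2 * V ^ 2 +
        4 * h ^ 2 * V * α k ^ 2))) := by
  have e1 : ∀ x : Fin K → X, ENNReal.ofReal (Real.exp (h * ∑ k, (α k + ℓ (x k)) ^ 2)) =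
      ∏ k, ENNReal.ofReal (Real.exp (h * (α k + ℓ (x k)) ^ 2)) := by
    intro x
    rw [Finset.mul_sum, Real.exp_sum, ENNReal.ofReal_prod_of_nonneg]
    exact fun _ _ => (Real.exp_pos _).le
  rw [lintegral_congr e1, lintegral_pi_prod μ
    (f := fun k y => ENNReal.ofReal (Real.exp (h * (α k + ℓ y) ^ 2))) (fun k => by fun_prop),
    Real.exp_sum, ENNReal.ofReal_prod_of_nonneg (fun _ _ => (Real.exp_pos _).le)]
  refine Finset.prod_le_prod' fun k _ => ?_
  have h1 := lintegral_exp_sq_gaussianReal_le h (α k) (Real.toNNReal V)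
    (by rwa [Real.coe_toNNReal _ hV0])
  rw [Real.coe_toNNReal _ hV0] at h1
  refine le_trans (le_of_eq ?_) h1
  rw [← hlaw, lintegral_map (by fun_prop) mℓ]

/-- Concentration of an empirical second moment around its expectation `Q`. -/
lemma lintegral_exp_centered_sum_sq_le {X : Type*} [MeasurableSpace X] (μ : Measure X)
    [IsProbabilityMeasure μ] {ℓ : X → ℝ} (mℓ : Measurable ℓ) {V : ℝ} (hV0 : 0 ≤ V)
    (hlaw : μ.map ℓ = gaussianReal 0 (Real.toNNReal V)) (hK : 0 < K) (α : Fin K → ℝ)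
    {t Q B : ℝ} (hQ : Q = (K : ℝ)⁻¹ * ∑ k, α k ^ 2 + V)
    (hB : 0 < B) (hQB : Q ≤ B) (ht : |t| ≤ K / 4) :
    ∫⁻ x, ENNReal.ofReal (Real.exp (t / B * ((K : ℝ)⁻¹ * ∑ k, (α k + ℓ (x k)) ^ 2 - Q)))
        ∂Measure.pi (fun _ : Fin K => μ) ≤
      ENNReal.ofReal (Real.exp (4 * t ^ 2 / K)) := by
  have hKr : (0 : ℝ) < K := by exact_mod_cast hK
  have hα : 0 ≤ (K : ℝ)⁻¹ * ∑ k, α k ^ 2 := by positivity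
  have hVQ : V ≤ Q := by linarith
  have hQ0 : 0 ≤ Q := by linarith
  -- This scaling turns t/B times the empirical mean into h times the plain sum of squares.
  obtain ⟨h, hh⟩ : ∃ h, h = t / (B * K) := ⟨_, rfl⟩
  have hu : |2 * h * V| ≤ 1 / 2 := by
    rw [hh, abs_mul, abs_of_nonneg hV0, abs_mul, abs_div, abs_of_pos (by positivity : 0 < B * K)]
    have : |t| * V ≤ (K / 4) * B := mul_le_mul ht (hVQ.trans hQB) hV0 (by positivity)
    rw [abs_of_pos (by norm_num : (0 : ℝ) < 2), mul_assoc, div_mul_eq_mul_div, ← mul_div_assoc,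
      div_le_iff₀ (by positivity)]
    linarith
  have h1 := lintegral_exp_sum_sq_le μ mℓ hV0 hlaw α h hu
  have e1 : ∀ x : Fin K → X, ENNReal.ofReal (Real.exp (t / B * ((K : ℝ)⁻¹ *
      ∑ k, (α k + ℓ (x k)) ^ 2 - Q))) =
      ENNReal.ofReal (Real.exp (-(t / B * Q))) * ENNReal.ofReal (Real.exp (h *
      ∑ k, (α k + ℓ (x k)) ^ 2)) := by
    intro x
    rw [← ENNReal.ofReal_mul (Real.exp_pos _).le, ← Real.exp_add, hh]
    congr 2
    field_simp
    ring
  rw [lintegral_congr e1, lintegral_const_mul _ (by fun_prop)]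
  refine (mul_le_mul_right h1 _).trans ?_
  rw [← ENNReal.ofReal_mul (Real.exp_pos _).le, ← Real.exp_add]
  refine ENNReal.ofReal_le_ofReal (Real.exp_le_exp.2 ?_)
  have hsum : ∑ k, α k ^ 2 = K * (Q - V) := by
    rw [hQ]; field_simp; ring
  -- The first-order part hKQ cancels exactly against the centring. The second-order part 4h²KVQ is
  -- at most 4t²/K because V ≤ Q ≤ B.
  have e2 : ∑ k, (h * (α k ^ 2 + V) + 4 * h ^ 2 * V ^ 2 + 4 * h ^ 2 * V * α k ^ 2) =
      h * K * Q + 4 * h ^ 2 * K * V * Q := by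
    simp only [Finset.sum_add_distrib, ← Finset.mul_sum, Finset.sum_const, Finset.card_univ,
      Fintype.card_fin, nsmul_eq_mul]
    rw [hsum]
    ring
  rw [e2]
  have e3 : h * K * Q = t / B * Q := by rw [hh]; field_simp
  have e4 : 4 * h ^ 2 * K * V * Q ≤ 4 * t ^ 2 / K := by
    have : V * Q ≤ B * B := mul_le_mul (hVQ.trans hQB) hQB hQ0 hB.le
    calc 4 * h ^ 2 * K * V * Q = 4 * h ^ 2 * K * (V * Q) := by ring
      _ ≤ 4 * h ^ 2 * K * (B * B) := mul_le_mul_of_nonneg_left this (by positivity)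
      _ = 4 * t ^ 2 / K := by rw [hh]; field_simp
  linarith

end

/-! ### The sampling error: measurability and concentration. -/

section

variable {d q K : ℕ}

/-- The largest forecast variance of an ensemble spread. -/
def maxVar (D : Fin K → EuclideanSpace ℝ (Fin d)) : ℝ := ⨆ i, ensembleCov D i i

lemma ensembleCov_self_le_maxVar (D : Fin K → EuclideanSpace ℝ (Fin d)) (i : Fin d) :
    ensembleCov D i i ≤ maxVar D :=
  le_ciSup (f := fun i => ensembleCov D i i) (Set.finite_range _).bddAbove i

lemma maxVar_nonneg (D : Fin K → EuclideanSpace ℝ (Fin d)) : 0 ≤ maxVar D :=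
  Real.iSup_nonneg fun i => ensembleCov_self_nonneg D i

lemma abs_ensembleCov_le_maxVar (D : Fin K → EuclideanSpace ℝ (Fin d)) (i j : Fin d) :
    |ensembleCov D i j| ≤ maxVar D := by
  have := abs_ensembleCov_le D i j
  have h1 := ensembleCov_self_le_maxVar D i
  have h2 := ensembleCov_self_le_maxVar D j
  linarith

/-- The scale of the fluctuations of the next forecast covariance. -/
def varScale (m : Model d q) (sX lam : ℝ) (D : Fin K → EuclideanSpace ℝ (Fin d)) : ℝ :=
  m.r * (lam ^ 2 * maxVar D + sX ^ 2)

lemma varScale_pos {m : Model d q} (hm : m.Standing) {sX lam : ℝ} (hX : 0 < sX)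
    (D : Fin K → EuclideanSpace ℝ (Fin d)) : 0 < varScale m sX lam D := by
  have := hm.one_lt_r
  have := maxVar_nonneg D
  exact mul_pos (by linarith) (by positivity)

/-- The sampling error of the next forecast covariance. -/
def fluct (m : Model d q) (n : ℕ) (sX : ℝ) (D : Fin K → EuclideanSpace ℝ (Fin d))
    (x : Noise d q K) (i j : Fin d) : ℝ :=
  ensembleCov (spreadStep m n D x) i j - expCov m n sX D i j

/-- The relative size of the sampling error. -/
def relFluct (m : Model d q) (n : ℕ) (sX lam : ℝ) (D : Fin K → EuclideanSpace ℝ (Fin d))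
    (x : Noise d q K) : ℝ :=
  ⨆ p : Fin d × Fin d, |fluct m n sX D x p.1 p.2| / varScale m sX lam D

lemma relFluct_nonneg {m : Model d q} (hm : m.Standing) (n : ℕ) {sX : ℝ} (hX : 0 < sX) (lam : ℝ)
    (D : Fin K → EuclideanSpace ℝ (Fin d)) (x : Noise d q K) : 0 ≤ relFluct m n sX lam D x :=
  Real.iSup_nonneg fun _ => div_nonneg (abs_nonneg _) (varScale_pos hm hX D).le

lemma abs_fluct_le {m : Model d q} (hm : m.Standing) (n : ℕ) {sX : ℝ} (hX : 0 < sX) (lam : ℝ)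
    (D : Fin K → EuclideanSpace ℝ (Fin d)) (x : Noise d q K) (i j : Fin d) :
    |fluct m n sX D x i j| ≤ relFluct m n sX lam D x * varScale m sX lam D := by
  rw [← div_le_iff₀ (varScale_pos hm hX D)]
  exact le_ciSup (f := fun p : Fin d × Fin d =>
    |fluct m n sX D x p.1 p.2| / varScale m sX lam D) (Set.finite_range _).bddAbove (i, j)

section Measurability

variable {m : Model d q}

lemma measurable_ensembleCov (i j : Fin d) :
    Measurable fun D : Fin K → EuclideanSpace ℝ (Fin d) => ensembleCov D i j := by
  simp only [ensembleCov_apply]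
  fun_prop

lemma measurable_maxVar : Measurable fun D : Fin K → EuclideanSpace ℝ (Fin d) => maxVar D :=
  Measurable.iSup fun i => measurable_ensembleCov i i

variable (hm : m.Standing) (hsep : ∀ i j, i ≠ j → 2 * m.l < m.dist (m.obs i) (m.obs j))
include hm hsep

lemma measurable_gain (a : Fin d) (c : Fin q) :
    Measurable fun D : Fin K → EuclideanSpace ℝ (Fin d) => m.gain (ensembleCov D) a c := by
  simp only [fun D : Fin K → EuclideanSpace ℝ (Fin d) =>
    Model.gain_apply hm hsep (ensembleCov_self_nonneg D) a c]
  split_ifs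
  · exact (measurable_ensembleCov _ _).div ((measurable_ensembleCov _ _).const_add _)
  · exact measurable_const

lemma measurable_resid (k : Fin K) (a : Fin d) :
    Measurable fun D : Fin K → EuclideanSpace ℝ (Fin d) => resid m D k a := by
  unfold resid
  have := fun c => measurable_gain (K := K) hm hsep a c
  fun_prop

lemma measurable_expCov (n : ℕ) (sX : ℝ) (i j : Fin d) :
    Measurable fun D : Fin K → EuclideanSpace ℝ (Fin d) => expCov m n sX D i j := by
  unfold expCov postCov
  have := fun a c => measurable_gain (K := K) hm hsep a c
  have := fun k a => measurable_resid (K := K) hm hsep k a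
  fun_prop

lemma measurable_spreadStep (n : ℕ) :
    Measurable fun p : (Fin K → EuclideanSpace ℝ (Fin d)) × Noise d q K =>
      spreadStep m n p.1 p.2 := by
  refine measurable_pi_lambda _ fun k => ?_
  have h : (fun p : (Fin K → EuclideanSpace ℝ (Fin d)) × Noise d q K =>
      spreadStep m n p.1 p.2 k) = fun p => WithLp.toLp 2 (fun i => √m.r * ((∑ a, m.A n i a *
        (resid m p.1 k a + ∑ c, m.gain (ensembleCov p.1) a c * (p.2 k).1 c)) + (p.2 k).2 i)) := by
    funext p
    ext i
    exact spreadStep_apply m n p.1 p.2 k i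
  rw [h]
  refine (WithLp.measurable_toLp 2 _).comp (measurable_pi_lambda _ fun i => ?_)
  have h1 : ∀ a c, Measurable fun p : (Fin K → EuclideanSpace ℝ (Fin d)) × Noise d q K =>
    m.gain (ensembleCov p.1) a c := fun a c => (measurable_gain hm hsep a c).comp measurable_fst
  have h2 : ∀ a, Measurable fun p : (Fin K → EuclideanSpace ℝ (Fin d)) × Noise d q K =>
    resid m p.1 k a := fun a => (measurable_resid hm hsep k a).comp measurable_fst
  fun_prop

lemma measurable_fluct (n : ℕ) (sX : ℝ) (i j : Fin d) :
    Measurable fun p : (Fin K → EuclideanSpace ℝ (Fin d)) × Noise d q K =>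
      fluct m n sX p.1 p.2 i j :=
  ((measurable_ensembleCov i j).comp (measurable_spreadStep hm hsep n)).sub
    ((measurable_expCov hm hsep n sX i j).comp measurable_fst)

lemma measurable_relFluct (n : ℕ) (sX lam : ℝ) :
    Measurable fun p : (Fin K → EuclideanSpace ℝ (Fin d)) × Noise d q K =>
      relFluct m n sX lam p.1 p.2 := by
  refine Measurable.iSup fun p => ?_
  have h1 := measurable_fluct (K := K) hm hsep n sX p.1 p.2
  have h2 : Measurable fun p : (Fin K → EuclideanSpace ℝ (Fin d)) × Noise d q K =>
      varScale m sX lam p.1 := by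
    unfold varScale
    have := measurable_maxVar.comp (measurable_fst :
      Measurable (Prod.fst : (Fin K → EuclideanSpace ℝ (Fin d)) × Noise d q K → _))
    fun_prop
  fun_prop

lemma measurable_relFluct_right (n : ℕ) (sX lam : ℝ) (D : Fin K → EuclideanSpace ℝ (Fin d)) :
    Measurable fun x : Noise d q K => relFluct m n sX lam D x := by
  have h := (measurable_relFluct (K := K) hm hsep n sX lam).comp (measurable_prodMk_left (x := D))
  exact h

end Measurability

section Concentration

variable {m : Model d q}

/-- The quadratic form of the conditional forecast covariance as a sum of squares. -/
lemma quad_expCov (hr : 0 ≤ m.r) (n : ℕ) (sX : ℝ) (D : Fin K → EuclideanSpace ℝ (Fin d))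
    (v : Fin d → ℝ) :
    ∑ i, ∑ j, v i * v j * expCov m n sX D i j =
      (K : ℝ)⁻¹ * ∑ k, (√m.r * ∑ a, (∑ i, v i * m.A n i a) * resid m D k a) ^ 2 +
      (m.sigmaO ^ 2 * ∑ c, (√m.r * ∑ a, (∑ i, v i * m.A n i a) *
        m.gain (ensembleCov D) a c) ^ 2 + sX ^ 2 * ∑ i, (√m.r * v i) ^ 2) := by
  have hsq : ∀ x : ℝ, (√m.r * x) ^ 2 = m.r * x ^ 2 := fun x => by rw [mul_pow, Real.sq_sqrt hr]
  -- The form is pulled back through A_n: v is replaced by A_nᵀ v acting on the posterior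
  -- covariance.
  set w : Fin d → ℝ := fun a => ∑ i, v i * m.A n i a with hw
  have h1 : ∑ i, ∑ j, v i * v j * (∑ a, ∑ b, m.A n i a * m.A n j b * postCov m D a b) =
      ∑ a, ∑ b, w a * w b * postCov m D a b := by
    have e : ∀ i j, v i * v j * (∑ a, ∑ b, m.A n i a * m.A n j b * postCov m D a b) =
        ∑ a, ∑ b, (v i * m.A n i a) * (v j * m.A n j b) * postCov m D a b := by
      intro i j
      simp only [Finset.mul_sum]
      exact Finset.sum_congr rfl fun a _ => Finset.sum_congr rfl fun b _ => by ring
    simp only [e]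
    have e2 : ∀ i, ∑ j, ∑ a, ∑ b, (v i * m.A n i a) * (v j * m.A n j b) * postCov m D a b =
        ∑ a, ∑ b, (v i * m.A n i a) * w b * postCov m D a b := by
      intro i
      rw [Finset.sum_comm]
      refine Finset.sum_congr rfl fun a _ => ?_
      rw [Finset.sum_comm]
      refine Finset.sum_congr rfl fun b _ => ?_
      rw [← Finset.sum_mul, ← Finset.mul_sum]
    simp only [e2]
    rw [Finset.sum_comm]
    refine Finset.sum_congr rfl fun a _ => ?_
    rw [Finset.sum_comm]
    refine Finset.sum_congr rfl fun b _ => ?_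
    rw [← Finset.sum_mul, ← Finset.sum_mul]
  have h2 : ∀ f : Fin d → ℝ, (∑ a, w a * f a) ^ 2 = ∑ a, ∑ b, w a * w b * (f a * f b) := by
    intro f
    rw [pow_two, Finset.sum_mul_sum]
    exact Finset.sum_congr rfl fun a _ => Finset.sum_congr rfl fun b _ => by ring
  have h3 : ∑ a, ∑ b, w a * w b * postCov m D a b =
      (K : ℝ)⁻¹ * ∑ k, (∑ a, w a * resid m D k a) ^ 2 +
        m.sigmaO ^ 2 * ∑ c, (∑ a, w a * m.gain (ensembleCov D) a c) ^ 2 := by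
    have h4 : ∀ {ι : Type} (s : Finset ι) (f : ι → Fin d → ℝ),
        ∑ a, ∑ b, w a * w b * ∑ k ∈ s, f k a * f k b = ∑ k ∈ s, (∑ a, w a * f k a) ^ 2 := by
      intro ι s f
      simp only [h2]
      refine Eq.symm (Finset.sum_comm.trans (Finset.sum_congr rfl fun a _ => ?_))
      refine Finset.sum_comm.trans (Finset.sum_congr rfl fun b _ => ?_)
      exact (Finset.mul_sum _ _ _).symm
    rw [← h4 Finset.univ fun k a => resid m D k a,
      ← h4 Finset.univ fun c a => m.gain (ensembleCov D) a c, Finset.mul_sum, Finset.mul_sum,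
      ← Finset.sum_add_distrib]
    refine Finset.sum_congr rfl fun a _ => ?_
    rw [Finset.mul_sum, Finset.mul_sum, ← Finset.sum_add_distrib]
    refine Finset.sum_congr rfl fun b _ => ?_
    unfold postCov
    ring
  simp only [expCov, hsq, ← Finset.mul_sum]
  have h4 : ∀ i j, v i * v j * (m.r * ((∑ a, ∑ b, m.A n i a * m.A n j b * postCov m D a b) +
      if i = j then sX ^ 2 else 0)) =
      m.r * (v i * v j * (∑ a, ∑ b, m.A n i a * m.A n j b * postCov m D a b)) +
        m.r * (if i = j then v i * v j * sX ^ 2 else 0) := by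
    intro i j
    split_ifs <;> ring
  simp only [h4, Finset.sum_add_distrib, ← Finset.mul_sum, h1, h3, Finset.sum_ite_eq,
    Finset.mem_univ, if_true]
  have h5 : ∑ i, v i * v i * sX ^ 2 = sX ^ 2 * ∑ i, v i ^ 2 := by
    rw [Finset.mul_sum]
    exact Finset.sum_congr rfl fun i _ => by ring
  rw [h5]
  ring

lemma quad_ensembleCov (D : Fin K → EuclideanSpace ℝ (Fin d)) (v : Fin d → ℝ) :
    ∑ i, ∑ j, v i * v j * ensembleCov D i j = (K : ℝ)⁻¹ * ∑ k, (∑ i, v i * D k i) ^ 2 := by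
  have h1 : ∀ i j, v i * v j * ensembleCov D i j =
      (K : ℝ)⁻¹ * ∑ k, (v i * D k i) * (v j * D k j) := by
    intro i j
    rw [ensembleCov_apply, Finset.mul_sum, Finset.mul_sum, Finset.mul_sum]
    exact Finset.sum_congr rfl fun k _ => by ring
  simp only [h1, ← Finset.mul_sum]
  congr 1
  have h2 : ∀ i, ∑ j, ∑ k, v i * D k i * (v j * D k j) =
      ∑ k, ∑ j, v i * D k i * (v j * D k j) := fun i => Finset.sum_comm
  simp only [h2]
  rw [Finset.sum_comm]
  refine Finset.sum_congr rfl fun k _ => ?_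
  rw [pow_two, Finset.sum_mul_sum]

lemma dot_spreadStep (n : ℕ) (D : Fin K → EuclideanSpace ℝ (Fin d))
    (x : Noise d q K) (k : Fin K) (v : Fin d → ℝ) :
    ∑ i, v i * spreadStep m n D x k i =
      √m.r * (∑ a, (∑ i, v i * m.A n i a) * resid m D k a) +
      ((∑ c, (√m.r * ∑ a, (∑ i, v i * m.A n i a) * m.gain (ensembleCov D) a c) * (x k).1 c) +
        ∑ i, (√m.r * v i) * (x k).2 i) := by
  have h0 : ∀ i, v i * spreadStep m n D x k i = √m.r * (∑ a, v i * m.A n i a * resid m D k a) +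
      (√m.r * (∑ a, v i * m.A n i a * ∑ c, m.gain (ensembleCov D) a c * (x k).1 c) +
        (√m.r * v i) * (x k).2 i) := by
    intro i
    rw [spreadStep_apply]
    simp only [mul_add, Finset.sum_add_distrib, Finset.mul_sum, mul_assoc]
    have : ∀ y : ℝ, v i * (√m.r * y) = √m.r * (v i * y) := fun y => by ring
    simp only [this]
    ring
  have h1 : ∀ f : Fin d → ℝ, ∑ i, ∑ a, v i * m.A n i a * f a =
      ∑ a, (∑ i, v i * m.A n i a) * f a := by
    intro f
    rw [Finset.sum_comm]
    simp only [Finset.sum_mul]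
  simp only [h0, Finset.sum_add_distrib, ← Finset.mul_sum, h1]
  congr 2
  have h2 : ∀ c, (√m.r * ∑ a, (∑ i, v i * m.A n i a) * m.gain (ensembleCov D) a c) * (x k).1 c =
      √m.r * ∑ a, (∑ i, v i * m.A n i a) * (m.gain (ensembleCov D) a c * (x k).1 c) := by
    intro c
    rw [mul_assoc, Finset.sum_mul]
    simp only [mul_assoc]
  simp only [h2, ← Finset.mul_sum]
  congr 1
  rw [Finset.sum_comm]
  simp only [Finset.mul_sum]

/-- Tested against v, the new members are deterministic shifts, coming from the residuals, plus
i.i.d. centred Gaussians. By `quad_expCov` the mean of their empirical second moment is the form of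
`expCov`, so the scalar concentration bound applies. -/
lemma quad_fluct_exp_le (hr : 0 ≤ m.r) (hK : 0 < K) (n : ℕ) (sX : ℝ)
    (D : Fin K → EuclideanSpace ℝ (Fin d)) (v : Fin d → ℝ) {t B : ℝ} (hB : 0 < B)
    (hQB : ∑ i, ∑ j, v i * v j * expCov m n sX D i j ≤ B) (ht : |t| ≤ K / 4) :
    ∫⁻ x, ENNReal.ofReal (Real.exp (t / B * ∑ i, ∑ j, v i * v j * fluct m n sX D x i j))
      ∂stepLaw d q K m.sigmaO sX ≤ ENNReal.ofReal (Real.exp (4 * t ^ 2 / K)) := by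
  have h := lintegral_exp_centered_sum_sq_le (memberLaw d q m.sigmaO sX)
    (ℓ := fun x => (∑ c, (√m.r * ∑ a, (∑ i, v i * m.A n i a) * m.gain (ensembleCov D) a c) *
      x.1 c) + ∑ i, (√m.r * v i) * x.2 i) (by fun_prop)
    (V := m.sigmaO ^ 2 * ∑ c, (√m.r * ∑ a, (∑ i, v i * m.A n i a) *
        m.gain (ensembleCov D) a c) ^ 2 + sX ^ 2 * ∑ i, (√m.r * v i) ^ 2) (by positivity)
    (map_dot_memberLaw _ _ _ _) hK
    (fun k => √m.r * ∑ a, (∑ i, v i * m.A n i a) * resid m D k a) (quad_expCov hr n sX D v)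
    hB hQB ht
  refine le_trans (le_of_eq (lintegral_congr fun x => ?_)) h
  have e : ∑ i, ∑ j, v i * v j * fluct m n sX D x i j =
      (∑ i, ∑ j, v i * v j * ensembleCov (spreadStep m n D x) i j) -
        ∑ i, ∑ j, v i * v j * expCov m n sX D i j := by
    simp only [fluct, mul_sub, Finset.sum_sub_distrib]
  rw [e, quad_ensembleCov]
  simp only [dot_spreadStep]

/-- The quadratic forms of the sampling error at `e_i ± e_j`. -/
lemma quad_single (F : Fin d → Fin d → ℝ) (i j : Fin d) (s : ℝ) :
    ∑ a, ∑ b, ((if a = i then 1 else 0) + s * (if a = j then 1 else 0)) *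
      ((if b = i then 1 else 0) + s * (if b = j then 1 else 0)) * F a b =
      F i i + s * (F i j + F j i) + s ^ 2 * F j j := by
  have h : ∀ g : Fin d → ℝ, ∑ b, ((if b = i then (1 : ℝ) else 0) + s * (if b = j then 1 else 0)) *
      g b = g i + s * g j := by
    intro g
    simp [add_mul, Finset.sum_add_distrib]
  simp only [mul_assoc, ← Finset.mul_sum, h]
  ring

lemma expCov_symm (n : ℕ) (sX : ℝ) (D : Fin K → EuclideanSpace ℝ (Fin d)) (i j : Fin d) :
    expCov m n sX D i j = expCov m n sX D j i := by
  unfold expCov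
  rw [Finset.sum_comm]
  congr 2
  · refine Finset.sum_congr rfl fun a _ => Finset.sum_congr rfl fun b _ => ?_
    rw [mul_comm (m.A n i b)]
    congr 1
    unfold postCov
    simp only [mul_comm]
  · simp only [eq_comm]

lemma fluct_symm (n : ℕ) (sX : ℝ) (D : Fin K → EuclideanSpace ℝ (Fin d)) (x : Noise d q K)
    (i j : Fin d) : fluct m n sX D x i j = fluct m n sX D x j i := by
  unfold fluct
  rw [ensembleCov_symm, expCov_symm]

/-- Polarization: four times the entry is the difference of the forms at e_i + e_j and e_i - e_j. By
the parallelogram identity and positivity both mean forms are at most 4B. Convexity of exp separates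
the two forms at the price of replacing t by 2t, hence the range K/8 and the constant 16. -/
lemma fluct_exp_le (hr : 0 ≤ m.r) (hK : 0 < K) (n : ℕ) (sX : ℝ)
    (D : Fin K → EuclideanSpace ℝ (Fin d)) {t B : ℝ} (hB : 0 < B)
    (hR : ∀ i, expCov m n sX D i i ≤ B) (ht : |t| ≤ K / 8) (i j : Fin d) :
    ∫⁻ x, ENNReal.ofReal (Real.exp (t * (fluct m n sX D x i j / B)))
      ∂stepLaw d q K m.sigmaO sX ≤ ENNReal.ofReal (Real.exp (16 * t ^ 2 / K)) := by
  set v : ℝ → Fin d → ℝ := fun s a => (if a = i then 1 else 0) + s * (if a = j then 1 else 0)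
    with hv
  have hq : ∀ (s : ℝ) (F : Fin d → Fin d → ℝ), ∑ a, ∑ b, v s a * v s b * F a b =
      F i i + s * (F i j + F j i) + s ^ 2 * F j j := fun s F => quad_single F i j s
  have hQ0 : ∀ s, 0 ≤ ∑ a, ∑ b, v s a * v s b * expCov m n sX D a b := by
    intro s
    rw [quad_expCov hr]
    positivity
  have hp := hQ0 1
  have hn := hQ0 (-1)
  have hQp : ∑ a, ∑ b, v 1 a * v 1 b * expCov m n sX D a b ≤ 4 * B := by
    rw [hq] at hn ⊢
    have := hR i
    have := hR j
    linarith
  have hQn : ∑ a, ∑ b, v (-1) a * v (-1) b * expCov m n sX D a b ≤ 4 * B := by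
    rw [hq] at hp ⊢
    have := hR i
    have := hR j
    linarith
  have ht2 : |2 * t| ≤ K / 4 := by
    rw [abs_mul, abs_of_pos (by norm_num : (0 : ℝ) < 2)]; linarith
  have ht3 : |-(2 * t)| ≤ K / 4 := by rwa [abs_neg]
  have h1 := quad_fluct_exp_le hr hK n sX D (v 1) (by positivity) hQp ht2
  have h2 := quad_fluct_exp_le hr hK n sX D (v (-1)) (by positivity) hQn ht3
  have hpt : ∀ x, ENNReal.ofReal (Real.exp (t * (fluct m n sX D x i j / B))) ≤
      ENNReal.ofReal (1 / 2) * ENNReal.ofReal (Real.exp (2 * t / (4 * B) *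
        ∑ a, ∑ b, v 1 a * v 1 b * fluct m n sX D x a b)) +
      ENNReal.ofReal (1 / 2) * ENNReal.ofReal (Real.exp (-(2 * t) / (4 * B) *
        ∑ a, ∑ b, v (-1) a * v (-1) b * fluct m n sX D x a b)) := by
    intro x
    rw [← ENNReal.ofReal_mul (by norm_num), ← ENNReal.ofReal_mul (by norm_num),
      ← ENNReal.ofReal_add (by positivity) (by positivity)]
    refine ENNReal.ofReal_le_ofReal ?_
    set a := 2 * t / (4 * B) * ∑ a, ∑ b, v 1 a * v 1 b * fluct m n sX D x a b with ha
    set b := -(2 * t) / (4 * B) * ∑ a, ∑ b, v (-1) a * v (-1) b * fluct m n sX D x a b with hb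
    have e : t * (fluct m n sX D x i j / B) = a / 2 + b / 2 := by
      rw [ha, hb, hq, hq, fluct_symm n sX D x j i]
      field_simp
      ring
    rw [e, Real.exp_add]
    have ea : Real.exp a = Real.exp (a / 2) * Real.exp (a / 2) := by
      rw [← Real.exp_add]; ring_nf
    have eb : Real.exp b = Real.exp (b / 2) * Real.exp (b / 2) := by
      rw [← Real.exp_add]; ring_nf
    rw [ea, eb]
    nlinarith [sq_nonneg (Real.exp (a / 2) - Real.exp (b / 2))]
  have hmeas : ∀ (s c : ℝ), AEMeasurable (fun x => ENNReal.ofReal (Real.exp (c *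
      ∑ a, ∑ b, v s a * v s b * fluct m n sX D x a b))) (stepLaw d q K m.sigmaO sX) := by
    intro s c
    have e : ∀ x, ∑ a, ∑ b, v s a * v s b * fluct m n sX D x a b =
        (∑ a, ∑ b, v s a * v s b * ensembleCov (spreadStep m n D x) a b) -
        ∑ a, ∑ b, v s a * v s b * expCov m n sX D a b := by
      intro x
      simp only [fluct, mul_sub, Finset.sum_sub_distrib]
    simp only [e, quad_ensembleCov, dot_spreadStep]
    fun_prop
  have hsum : ENNReal.ofReal (1 / 2) + ENNReal.ofReal (1 / 2) = 1 := by
    rw [← ENNReal.ofReal_add (by norm_num) (by norm_num)]; norm_num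
  refine (lintegral_mono hpt).trans ?_
  rw [lintegral_add_left' ((hmeas _ _).const_mul _), lintegral_const_mul'' _ (hmeas _ _),
    lintegral_const_mul'' _ (hmeas _ _)]
  have e1 : 4 * (2 * t) ^ 2 / (K : ℝ) = 16 * t ^ 2 / K := by ring
  have e2 : 4 * (-(2 * t)) ^ 2 / (K : ℝ) = 16 * t ^ 2 / K := by ring
  rw [e1] at h1
  rw [e2] at h2
  calc _ ≤ ENNReal.ofReal (1 / 2) * ENNReal.ofReal (Real.exp (16 * t ^ 2 / K)) +
        ENNReal.ofReal (1 / 2) * ENNReal.ofReal (Real.exp (16 * t ^ 2 / K)) := by gcongr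
    _ = _ := by rw [← add_mul, hsum, one_mul]

/-- Exponential moments of the relative sampling error. -/
lemma relFluct_exp_le (hm : m.Standing)
    (hsep : ∀ i j, i ≠ j → 2 * m.l < m.dist (m.obs i) (m.obs j)) {lam : ℝ} (hl : 0 < lam)
    (hl1 : lam ≤ 1) (hA : WeakInteraction m lam) (hd : 0 < d) (hK : 0 < K) (n : ℕ) {sX : ℝ}
    (hX : 0 < sX) (D : Fin K → EuclideanSpace ℝ (Fin d)) {t : ℝ} (ht0 : 0 ≤ t)
    (ht : t ≤ K / 8) :
    ∫⁻ x, ENNReal.ofReal (Real.exp (t * relFluct m n sX lam D x))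
      ∂stepLaw d q K m.sigmaO sX ≤
        ENNReal.ofReal (2 * (d : ℝ) ^ 2 * Real.exp (16 * t ^ 2 / K)) := by
  have hr : 0 ≤ m.r := by have := hm.one_lt_r; linarith
  have : Nonempty (Fin d) := ⟨⟨0, hd⟩⟩
  set B := varScale m sX lam D with hBdef
  have hB : 0 < B := varScale_pos hm hX D
  have hR : ∀ i, expCov m n sX D i i ≤ B := fun i =>
    abs_expCov_le hm hsep hl hl1 hA n sX D (maxVar_nonneg D) (ensembleCov_self_le_maxVar D) i
  have hpt : ∀ x, ENNReal.ofReal (Real.exp (t * relFluct m n sX lam D x)) ≤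
      ∑ p : Fin d × Fin d, (ENNReal.ofReal (Real.exp (t * (fluct m n sX D x p.1 p.2 / B))) +
        ENNReal.ofReal (Real.exp (-t * (fluct m n sX D x p.1 p.2 / B)))) := by
    intro x
    -- The maximum is attained at some pair with some sign; summing over all pairs and both signs
    -- gives the factor 2d².
    obtain ⟨p, hp⟩ := exists_eq_ciSup_of_finite
      (f := fun p : Fin d × Fin d => |fluct m n sX D x p.1 p.2| / varScale m sX lam D)
    have hp' : relFluct m n sX lam D x = |fluct m n sX D x p.1 p.2| / B := hp.symm
    refine le_trans ?_ (Finset.single_le_sum (f := fun p : Fin d × Fin d =>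
      ENNReal.ofReal (Real.exp (t * (fluct m n sX D x p.1 p.2 / B))) +
        ENNReal.ofReal (Real.exp (-t * (fluct m n sX D x p.1 p.2 / B))))
      (fun _ _ => zero_le) (Finset.mem_univ p))
    rw [hp']
    rcases abs_choice (fluct m n sX D x p.1 p.2) with h | h
    · rw [h]; exact le_self_add
    · rw [h]
      refine le_trans (le_of_eq ?_) le_add_self
      congr 2
      ring
  have hmeas : ∀ (c : ℝ) (p : Fin d × Fin d), Measurable fun x : Noise d q K =>
      ENNReal.ofReal (Real.exp (c * (fluct m n sX D x p.1 p.2 / B))) := by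
    intro c p
    have := (measurable_fluct (K := K) hm hsep n sX p.1 p.2).comp
      (measurable_prodMk_left (x := D))
    have h2 : Measurable fun x : Noise d q K => fluct m n sX D x p.1 p.2 := this
    fun_prop
  refine (lintegral_mono hpt).trans ?_
  have hmeas2 : ∀ p : Fin d × Fin d, Measurable fun x : Noise d q K =>
      ENNReal.ofReal (Real.exp (t * (fluct m n sX D x p.1 p.2 / B))) +
        ENNReal.ofReal (Real.exp (-t * (fluct m n sX D x p.1 p.2 / B))) :=
    fun p => (hmeas t p).add (hmeas (-t) p)
  rw [lintegral_finsetSum _ fun p _ => hmeas2 p]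
  have hterm : ∀ p : Fin d × Fin d,
      ∫⁻ x, (ENNReal.ofReal (Real.exp (t * (fluct m n sX D x p.1 p.2 / B))) +
        ENNReal.ofReal (Real.exp (-t * (fluct m n sX D x p.1 p.2 / B))))
          ∂stepLaw d q K m.sigmaO sX ≤ ENNReal.ofReal (2 * Real.exp (16 * t ^ 2 / K)) := by
    intro p
    rw [lintegral_add_left (hmeas t p)]
    have h1 := fluct_exp_le hr hK n sX D hB hR (by rwa [abs_of_nonneg ht0]) p.1 p.2
    have h2 := fluct_exp_le hr hK n sX D hB hR (t := -t)
      (by rwa [abs_neg, abs_of_nonneg ht0]) p.1 p.2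
    rw [neg_sq] at h2
    refine (add_le_add h1 h2).trans (le_of_eq ?_)
    rw [← ENNReal.ofReal_add (by positivity) (by positivity), two_mul]
  refine (Finset.sum_le_sum fun p _ => hterm p).trans (le_of_eq ?_)
  rw [Finset.sum_const, Finset.card_univ, Fintype.card_prod, Fintype.card_fin, nsmul_eq_mul,
    ← ENNReal.ofReal_natCast, ← ENNReal.ofReal_mul (by positivity)]
  congr 1
  push_cast
  ring

end Concentration

end

/-! ### Adaptedness, independence and conditioning on the past. -/

section

variable {Ω : Type*} [mΩ : MeasurableSpace Ω] {P : Measure Ω} {d q K : ℕ}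

lemma measurable_pi_of {α ι : Type*} {m₀ : MeasurableSpace α} {X : ι → Type*}
    [∀ i, MeasurableSpace (X i)] {f : α → ∀ i, X i} (h : ∀ i, Measurable fun a => f a i) :
    Measurable f :=
  measurable_pi_lambda f h

lemma measurable_one_indicator {α : Type*} {m₀ : MeasurableSpace α} {A : Set α}
    (hA : MeasurableSet A) : Measurable (A.indicator (1 : α → ℝ≥0∞)) :=
  measurable_one.indicator hA

/-- The noise entering the ensemble between the times `n` and `n + 1`. -/
def Input.stepNoise (u : Input Ω d q K) (n : ℕ) (ω : Ω) : Noise d q K :=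
  fun k => (u.zetaS n k ω, u.xiS (n + 1) k ω)

lemma forecastSpread_succ (m : Model d q) (u : Input Ω d q K) (n : ℕ) (ω : Ω) :
    forecastSpread m u (n + 1) ω = spreadStep m n (forecastSpread m u n ω) (u.stepNoise n ω) :=
  rfl

lemma Input.measurable_stepNoise (u : Input Ω d q K) (n : ℕ) : Measurable (u.stepNoise n) :=
  measurable_pi_lambda _ fun k => (u.measurable_zetaS n k).prodMk (u.measurable_xiS (n + 1) k)

lemma Input.measurable_stepNoise_stepSigma (u : Input Ω d q K) (n : ℕ) :
    Measurable[u.stepSigma n] (u.stepNoise n) := by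
  refine measurable_pi_of fun k => ?_
  have h1 : MeasurableSpace.comap (u.zetaS n k) inferInstance ≤ u.stepSigma n :=
    le_sup_of_le_right (le_iSup_of_le k le_sup_right)
  have h2 : MeasurableSpace.comap (u.xiS (n + 1) k) inferInstance ≤ u.stepSigma n :=
    le_sup_of_le_right (le_iSup_of_le k le_sup_left)
  exact Measurable.prodMk ((comap_measurable _).mono h1 le_rfl)
    ((comap_measurable _).mono h2 le_rfl)

lemma Input.stepSigma_le_filtration (u : Input Ω d q K) (n : ℕ) :
    u.stepSigma n ≤ u.filtration (n + 1) :=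
  le_sup_of_le_right (le_iSup₂_of_le n (Nat.lt_succ_self n) le_rfl)

lemma Input.initSigma_le_filtration (u : Input Ω d q K) (n : ℕ) :
    u.initSigma ≤ u.filtration n := le_sup_left

section

variable {m : Model d q} (hm : m.Standing)
  (hsep : ∀ i j, i ≠ j → 2 * m.l < m.dist (m.obs i) (m.obs j))
include hm hsep

/-- The forecast spread is adapted. -/
lemma measurable_forecastSpread (u : Input Ω d q K) (n : ℕ) :
    Measurable[u.filtration n] (forecastSpread m u n) := by
  induction n with
  | zero =>
    have h : ∀ k, Measurable[u.filtration 0] (u.Xhat0 k) := by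
      intro k
      have h1 : MeasurableSpace.comap (u.Xhat0 k) inferInstance ≤ u.filtration 0 :=
        le_trans (le_sup_of_le_right (le_iSup_of_le k le_rfl)) (u.initSigma_le_filtration 0)
      exact (comap_measurable _).mono h1 le_rfl
    have hΦ : Measurable fun X : Fin K → EuclideanSpace ℝ (Fin d) =>
        fun k => X k - ensembleMean X := by
      unfold ensembleMean
      fun_prop
    have hX : Measurable[u.filtration 0] fun ω k => u.Xhat0 k ω := measurable_pi_of h
    exact hΦ.comp hX
  | succ n ih =>
    have h1 : Measurable[u.filtration (n + 1)] (forecastSpread m u n) :=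
      ih.mono (u.filtration.mono n.le_succ) le_rfl
    have h2 : Measurable[u.filtration (n + 1)] (u.stepNoise n) :=
      (u.measurable_stepNoise_stepSigma n).mono (u.stepSigma_le_filtration n) le_rfl
    have h3 : Measurable[u.filtration (n + 1)]
        fun ω => (forecastSpread m u n ω, u.stepNoise n ω) := Measurable.prodMk h1 h2
    have h4 := Measurable.comp (measurable_spreadStep hm hsep n) h3
    exact h4

end

lemma Input.sourceSigma_le (u : Input Ω d q K) (s : Source K) : u.sourceSigma s ≤ mΩ := by
  cases s with
  | init => exact u.initSigma_le
  | xi n => exact (u.measurable_xi _).comap_le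
  | zeta n => exact (u.measurable_zeta _).comap_le
  | xiS n k => exact (u.measurable_xiS _ _).comap_le
  | zetaS n k => exact (u.measurable_zetaS _ _).comap_le

/-- The noise of a step is independent of the past. -/
lemma Input.indep_filtration_stepNoise (u : Input Ω d q K) (hu : iIndep u.sourceSigma P) (n : ℕ) :
    Indep (u.filtration n) (MeasurableSpace.comap (u.stepNoise n) inferInstance) P := by
  -- The labels of `xi` and `xiS` are shifted by one: label k stands for the noise acting at time k
  -- + 1. Hence F_n consists of exactly the labels k < n for all four kinds of noise, and the step
  -- noise carries label n.
  set S : Set (Source K) := {s | match s with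
    | .init => True
    | .xi k => k < n
    | .zeta k => k < n
    | .xiS k _ => k < n
    | .zetaS k _ => k < n} with hS
  have hdis : Disjoint S Sᶜ := disjoint_compl_right
  have h := indep_iSup_of_disjoint u.sourceSigma_le hu hdis
  have hle : ∀ (T : Set (Source K)) (s : Source K), s ∈ T →
      u.sourceSigma s ≤ ⨆ i ∈ T, u.sourceSigma i := fun T s hs =>
    le_iSup₂_of_le (f := fun (i : Source K) (_ : i ∈ T) => u.sourceSigma i) s hs le_rfl
  refine indep_of_indep_of_le h ?_ ?_
  · refine sup_le (hle S .init trivial) (iSup₂_le fun s hs => ?_)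
    refine sup_le (sup_le (hle S (.xi s) hs) (hle S (.zeta s) hs)) (iSup_le fun k => ?_)
    exact sup_le (hle S (.xiS s k) hs) (hle S (.zetaS s k) hs)
  · refine Measurable.comap_le ?_
    refine measurable_pi_of fun k => ?_
    have h1 : (Source.zetaS n k : Source K) ∈ Sᶜ := fun h => lt_irrefl n h
    have h2 : (Source.xiS n k : Source K) ∈ Sᶜ := fun h => lt_irrefl n h
    exact Measurable.prodMk ((comap_measurable _).mono (hle _ _ h1) le_rfl)
      ((comap_measurable _).mono (hle _ _ h2) le_rfl)

/-- The law of the noise of a step. -/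
lemma Input.map_stepNoise (u : Input Ω d q K) {m : Model d q} (hu : u.IsNoiseFor m P) {sX : ℝ}
    (hSig : ∀ n, m.Sig n = sX ^ 2 • (1 : Matrix (Fin d) (Fin d) ℝ)) (n : ℕ) :
    P.map (u.stepNoise n) = stepLaw d q K m.sigmaO sX := by
  have hprob : IsProbabilityMeasure P := hu.indep.isProbabilityMeasure
  have h1 : iIndepFun (fun k => u.zetaS n k) P :=
    hu.indep.precomp (g := fun k => Source.zetaS n k) (fun a b h => by simpa using h)
  have h2 : iIndepFun (fun k => u.xiS (n + 1) k) P :=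
    hu.indep.precomp (g := fun k => Source.xiS n k) (fun a b h => by simpa using h)
  have m1 := h1.map_fun_eq_pi_map fun k => (u.measurable_zetaS n k).aemeasurable
  have m2 := h2.map_fun_eq_pi_map fun k => (u.measurable_xiS (n + 1) k).aemeasurable
  simp only [(hu.law_zetaS n _).map_eq] at m1
  simp only [(hu.law_xiS n _).map_eq, hSig] at m2
  have hind : IndepFun (fun ω k => u.zetaS n k ω) (fun ω k => u.xiS (n + 1) k ω) P := by
    have hdis : Disjoint (Set.range fun k : Fin K => Source.zetaS n k)
        (Set.range fun k : Fin K => Source.xiS n k) := by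
      rw [Set.disjoint_left]
      rintro _ ⟨k, rfl⟩ ⟨k', h⟩
      simp at h
    have h := indep_iSup_of_disjoint u.sourceSigma_le hu.indep hdis
    refine indep_of_indep_of_le h (Measurable.comap_le ?_) (Measurable.comap_le ?_)
    · refine measurable_pi_of fun k => (comap_measurable _).mono ?_ le_rfl
      exact le_iSup₂_of_le (f := fun (i : Source K) (_ : i ∈ _) => u.sourceSigma i)
        (Source.zetaS n k) ⟨k, rfl⟩ le_rfl
    · refine measurable_pi_of fun k => (comap_measurable _).mono ?_ le_rfl
      exact le_iSup₂_of_le (f := fun (i : Source K) (_ : i ∈ _) => u.sourceSigma i)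
        (Source.xiS n k) ⟨k, rfl⟩ le_rfl
  have mz : Measurable fun ω k => u.zetaS n k ω :=
    measurable_pi_lambda _ fun k => u.measurable_zetaS n k
  have mx : Measurable fun ω k => u.xiS (n + 1) k ω :=
    measurable_pi_lambda _ fun k => u.measurable_xiS (n + 1) k
  have hprod := hind.map_prod_eq_prod_map_map mz.aemeasurable mx.aemeasurable
  rw [m1, m2] at hprod
  -- Independence yields a pair of families of noises, whereas `stepLaw` is the law of a family of
  -- pairs; the two product measures are identified.
  have hmp := measurePreserving_arrowProdEquivProdArrow (EuclideanSpace ℝ (Fin q))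
    (EuclideanSpace ℝ (Fin d)) (Fin K)
    (fun _ => multivariateGaussian 0 (m.sigmaO ^ 2 • (1 : Matrix (Fin q) (Fin q) ℝ)))
    (fun _ => multivariateGaussian 0 (sX ^ 2 • (1 : Matrix (Fin d) (Fin d) ℝ)))
  have hsymm := (hmp.symm _).map_eq
  rw [stepLaw]
  unfold memberLaw
  rw [← hsymm, ← hprod, Measure.map_map (MeasurableEquiv.measurable _) (mz.prodMk mx)]
  rfl

/-- Conditioning on the past: integrals over past events of functions of the current state and of
the next noise. -/
lemma setLIntegral_step [IsProbabilityMeasure P] {m : Model d q} (hm : m.Standing)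
    (hsep : ∀ i j, i ≠ j → 2 * m.l < m.dist (m.obs i) (m.obs j)) (u : Input Ω d q K)
    (hu : u.IsNoiseFor m P) {sX : ℝ}
    (hSig : ∀ n, m.Sig n = sX ^ 2 • (1 : Matrix (Fin d) (Fin d) ℝ)) (n : ℕ)
    {g : (Fin K → EuclideanSpace ℝ (Fin d)) → Noise d q K → ℝ≥0∞}
    (hg : Measurable (Function.uncurry g)) {A : Set Ω} (hA : MeasurableSet[u.filtration n] A) :
    ∫⁻ ω in A, g (forecastSpread m u n ω) (u.stepNoise n ω) ∂P =
      ∫⁻ ω in A, ∫⁻ x, g (forecastSpread m u n ω) x ∂stepLaw d q K m.sigmaO sX ∂P := by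
  -- The indicator of A is carried as an extra coordinate of the past, so that independence of Z and
  -- the noise followed by Tonelli treats the event together with the state.
  set Z : Ω → (Fin K → EuclideanSpace ℝ (Fin d)) × ℝ≥0∞ :=
    fun ω => (forecastSpread m u n ω, A.indicator 1 ω) with hZ
  have hZm : Measurable[u.filtration n] Z :=
    (measurable_forecastSpread hm hsep u n).prodMk (measurable_one_indicator hA)
  have hle : u.filtration n ≤ mΩ := u.filtration.le n
  have hZm' : Measurable Z := hZm.mono hle le_rfl
  have hNm := u.measurable_stepNoise n
  have hind : IndepFun Z (u.stepNoise n) P :=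
    indep_of_indep_of_le_left (u.indep_filtration_stepNoise hu.indep n) hZm.comap_le
  have hmap := hind.map_prod_eq_prod_map_map hZm'.aemeasurable hNm.aemeasurable
  rw [u.map_stepNoise hu hSig] at hmap
  have hA' : MeasurableSet A := hle _ hA
  have hG : Measurable fun p : ((Fin K → EuclideanSpace ℝ (Fin d)) × ℝ≥0∞) × Noise d q K =>
      p.1.2 * g p.1.1 p.2 := by
    have : Measurable fun p : ((Fin K → EuclideanSpace ℝ (Fin d)) × ℝ≥0∞) × Noise d q K =>
        g p.1.1 p.2 := hg.comp ((measurable_fst.comp measurable_fst).prodMk measurable_snd)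
    exact (measurable_snd.comp measurable_fst).mul this
  have hind1 : ∀ (f : Ω → ℝ≥0∞), ∫⁻ ω in A, f ω ∂P = ∫⁻ ω, A.indicator 1 ω * f ω ∂P := by
    intro f
    rw [← lintegral_indicator hA']
    refine lintegral_congr fun ω => ?_
    by_cases h : ω ∈ A <;> simp [h]
  rw [hind1, hind1]
  calc ∫⁻ ω, A.indicator 1 ω * g (forecastSpread m u n ω) (u.stepNoise n ω) ∂P
      = ∫⁻ p, p.1.2 * g p.1.1 p.2 ∂(P.map fun ω => (Z ω, u.stepNoise n ω)) := by
        rw [lintegral_map hG (hZm'.prodMk hNm)]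
    _ = ∫⁻ z, ∫⁻ x, z.2 * g z.1 x ∂stepLaw d q K m.sigmaO sX ∂(P.map Z) := by
        rw [hmap, lintegral_prod _ hG.aemeasurable]
    _ = ∫⁻ ω, ∫⁻ x, (Z ω).2 * g (Z ω).1 x ∂stepLaw d q K m.sigmaO sX ∂P := by
        rw [lintegral_map hG.lintegral_prod_right' hZm']
    _ = _ := by
        refine lintegral_congr fun ω => ?_
        rw [lintegral_const_mul]
        exact hg.comp measurable_prodMk_left

end

/-! ### Tail bounds from exponential moments, and the parameter regime. -/

section

section Tails

variable {X : Type*} [MeasurableSpace X] {ν : Measure X} [IsProbabilityMeasure ν] {y : X → ℝ}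
  {κ D₀ : ℝ}

/-- The tangent of exp at log B, where B bounds the exponential moment, gives ty + 1 ≤ log B +
exp(ty)/B. Integrating yields E y ≤ (log B)/t without Jensen's inequality. -/
lemma lintegral_le_of_exp_le (hy : Measurable y) (hy0 : ∀ x, 0 ≤ y x) (hD : 1 ≤ D₀)
    (hκ : 0 < κ) {t : ℝ} (ht : 0 < t)
    (h : ∫⁻ x, ENNReal.ofReal (Real.exp (t * y x)) ∂ν ≤
      ENNReal.ofReal (D₀ * Real.exp (16 * t ^ 2 / κ))) :
    ∫⁻ x, ENNReal.ofReal (y x) ∂ν ≤ ENNReal.ofReal (Real.log D₀ / t + 16 * t / κ) := by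
  set B := D₀ * Real.exp (16 * t ^ 2 / κ) with hB
  have hB0 : 0 < B := by positivity
  have hlogB : Real.log B = Real.log D₀ + 16 * t ^ 2 / κ := by
    rw [hB, Real.log_mul (by positivity) (Real.exp_pos _).ne', Real.log_exp]
  have hlog0 : 0 ≤ Real.log B := by
    rw [hlogB]
    have := Real.log_nonneg hD
    positivity
  have hpt : ∀ x, ENNReal.ofReal (t * y x) + 1 ≤
      ENNReal.ofReal (Real.log B) + ENNReal.ofReal B⁻¹ * ENNReal.ofReal (Real.exp (t * y x)) := by
    intro x
    have h1 := Real.add_one_le_exp (t * y x - Real.log B)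
    rw [Real.exp_sub, Real.exp_log hB0] at h1
    rw [← ENNReal.ofReal_one, ← ENNReal.ofReal_add (mul_nonneg ht.le (hy0 x)) zero_le_one,
      ← ENNReal.ofReal_mul (by positivity), ← ENNReal.ofReal_add hlog0 (by positivity)]
    refine ENNReal.ofReal_le_ofReal ?_
    rw [inv_mul_eq_div]
    linarith
  have h2 := lintegral_mono (μ := ν) hpt
  rw [lintegral_add_right _ measurable_const, lintegral_add_left measurable_const,
    lintegral_const_mul _ (by fun_prop)] at h2
  simp only [lintegral_const, measure_univ, mul_one] at h2
  have h3 : ENNReal.ofReal B⁻¹ * ∫⁻ x, ENNReal.ofReal (Real.exp (t * y x)) ∂ν ≤ 1 := by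
    refine (mul_le_mul_right h _).trans ?_
    rw [← ENNReal.ofReal_mul (by positivity), inv_mul_cancel₀ hB0.ne', ENNReal.ofReal_one]
  have h4 : ∫⁻ x, ENNReal.ofReal (t * y x) ∂ν ≤ ENNReal.ofReal (Real.log B) :=
    (ENNReal.add_le_add_iff_right ENNReal.one_ne_top).1 (h2.trans (add_le_add_right h3 _))
  have h5 : ∫⁻ x, ENNReal.ofReal (y x) ∂ν =
      ENNReal.ofReal t⁻¹ * ∫⁻ x, ENNReal.ofReal (t * y x) ∂ν := by
    rw [← lintegral_const_mul _ (by fun_prop)]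
    refine lintegral_congr fun x => ?_
    rw [← ENNReal.ofReal_mul (by positivity), ← mul_assoc, inv_mul_cancel₀ ht.ne', one_mul]
  rw [h5]
  refine (mul_le_mul_right h4 _).trans (le_of_eq ?_)
  rw [← ENNReal.ofReal_mul (by positivity), hlogB]
  congr 1
  field_simp

-- The exponent t = κε/32 minimizes 16t²/κ - tε, with value -κε²/64; the positive part of t(y - ε)
-- is bounded by exp(t(y - ε)).
omit [IsProbabilityMeasure ν] in
lemma lintegral_excess_le (hκ : 0 < κ) {ε : ℝ} (hε : 0 < ε)
    (h : ∫⁻ x, ENNReal.ofReal (Real.exp (κ * ε / 32 * y x)) ∂ν ≤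
      ENNReal.ofReal (D₀ * Real.exp (16 * (κ * ε / 32) ^ 2 / κ))) (hy : Measurable y) :
    ∫⁻ x, ENNReal.ofReal (y x / ε - 1) ∂ν ≤
      ENNReal.ofReal (32 / (κ * ε ^ 2) * (D₀ * Real.exp (-(κ * ε ^ 2 / 64)))) := by
  set t := κ * ε / 32 with ht
  have htpos : 0 < t := by positivity
  have hpt : ∀ x, ENNReal.ofReal (y x / ε - 1) ≤
      ENNReal.ofReal (32 / (κ * ε ^ 2) * Real.exp (-(t * ε))) *
        ENNReal.ofReal (Real.exp (t * y x)) := by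
    intro x
    rw [← ENNReal.ofReal_mul (by positivity), mul_assoc, ← Real.exp_add]
    refine ENNReal.ofReal_le_ofReal ?_
    have h1 := Real.add_one_le_exp (-(t * ε) + t * y x)
    have e : y x / ε - 1 = 32 / (κ * ε ^ 2) * (-(t * ε) + t * y x) := by
      rw [ht]; field_simp; ring
    rw [e]
    exact mul_le_mul_of_nonneg_left (by linarith) (by positivity)
  refine (lintegral_mono hpt).trans ?_
  rw [lintegral_const_mul _ (by fun_prop)]
  refine (mul_le_mul_right h _).trans (le_of_eq ?_)
  rw [← ENNReal.ofReal_mul (by positivity)]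
  congr 1
  have e : Real.exp (-(κ * ε ^ 2 / 64)) =
      Real.exp (-(t * ε)) * Real.exp (16 * t ^ 2 / κ) := by
    rw [← Real.exp_add]
    congr 1
    rw [ht]; field_simp; ring
  rw [e]
  ring

-- The factor 1 + y ≤ exp y uses up one unit of the exponent; on y > τ the remaining t - 1 ≥ 0 gives
-- the Chernoff decay, and exp τ ≤ 3 is lost.
omit [IsProbabilityMeasure ν] in
lemma lintegral_indicator_le (hD : 0 ≤ D₀) {τ : ℝ} (hτ : 0 < τ) (hτ1 : τ ≤ 1)
    (hκτ : 32 ≤ κ * τ)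
    (h : ∫⁻ x, ENNReal.ofReal (Real.exp (κ * τ / 32 * y x)) ∂ν ≤
      ENNReal.ofReal (D₀ * Real.exp (16 * (κ * τ / 32) ^ 2 / κ))) (hy : Measurable y) :
    ∫⁻ x, (if τ < y x then ENNReal.ofReal (1 + y x) else 0) ∂ν ≤
      ENNReal.ofReal (3 * (D₀ * Real.exp (-(κ * τ ^ 2 / 64)))) := by
  set t := κ * τ / 32 with ht
  have ht1 : 1 ≤ t := by rw [ht]; linarith
  have hpt : ∀ x, (if τ < y x then ENNReal.ofReal (1 + y x) else 0) ≤
      ENNReal.ofReal (Real.exp (-((t - 1) * τ))) * ENNReal.ofReal (Real.exp (t * y x)) := by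
    intro x
    split_ifs with hx
    · rw [← ENNReal.ofReal_mul (by positivity), ← Real.exp_add]
      refine ENNReal.ofReal_le_ofReal ?_
      have h1 := Real.add_one_le_exp (y x)
      refine (by linarith : 1 + y x ≤ Real.exp (y x)).trans (Real.exp_le_exp.2 ?_)
      nlinarith
    · exact zero_le
  refine (lintegral_mono hpt).trans ?_
  rw [lintegral_const_mul _ (by fun_prop)]
  refine (mul_le_mul_right h _).trans ?_
  rw [← ENNReal.ofReal_mul (by positivity)]
  refine ENNReal.ofReal_le_ofReal ?_
  have e : Real.exp (-((t - 1) * τ)) * Real.exp (16 * t ^ 2 / κ) =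
      Real.exp τ * Real.exp (-(κ * τ ^ 2 / 64)) := by
    rw [← Real.exp_add, ← Real.exp_add]
    congr 1
    rw [ht]; field_simp; ring
  have h3 : Real.exp τ ≤ 3 := by
    have := Real.exp_le_exp.2 hτ1
    have := Real.exp_one_lt_d9
    linarith
  calc _ = Real.exp τ * (D₀ * Real.exp (-(κ * τ ^ 2 / 64))) := by
        rw [← mul_assoc, mul_comm _ D₀, mul_assoc, e]; ring
    _ ≤ _ := mul_le_mul_of_nonneg_right h3 (by positivity)

end Tails

/-- The assumptions of the theorem on the deterministic parameters. -/
structure Regime {d q : ℕ} (m : Model d q) (sX lam δ Ms c : ℝ) (L K : ℕ) : Prop where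
  hd : 0 < d
  std : m.Standing
  hX : 0 < sX
  sep : ∀ i j, i ≠ j → 2 * m.l < m.dist (m.obs i) (m.obs j)
  hl : 0 < lam
  hlr : lam < m.r⁻¹
  weak : WeakInteraction m lam
  hδ : 0 < δ
  hδ' : δ < min (1 / 4) (1 / 2 * (lam⁻¹ - m.r))
  hM : (m.r + 2 * δ) * sX ^ 2 / (1 - lam) ≤ Ms
  hpsi : psi m.r m.sigmaO sX lam Ms δ ≤ Ms
  hK : max (1 / (c * δ ^ 2 * lam ^ (2 * L)) *
      Real.log (16 * (d : ℝ) ^ 2 * (nStar lam δ L : ℝ) / δ ^ 2))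
      (Gam c (2 * m.r / δ) d) < (K : ℝ)

namespace Regime

variable {d q : ℕ} {m : Model d q} {sX lam δ Ms c : ℝ} {L K : ℕ}
  (h : Regime m sX lam δ Ms c L K)
include h

lemma one_lt_r : 1 < m.r := h.std.one_lt_r

lemma lam_lt_one : lam < 1 := h.hlr.trans (inv_lt_one_of_one_lt₀ h.one_lt_r)

lemma delta_lt : δ < 1 / 4 := h.hδ'.trans_le (min_le_left _ _)

lemma r_add_lt : (m.r + 2 * δ) * lam < 1 := by
  have h1 : δ < 1 / 2 * (lam⁻¹ - m.r) := h.hδ'.trans_le (min_le_right _ _)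
  have h2 : m.r + 2 * δ < lam⁻¹ := by linarith
  have := mul_lt_mul_of_pos_right h2 h.hl
  rwa [inv_mul_cancel₀ h.hl.ne'] at this

lemma Ms_pos : 0 < Ms := by
  refine lt_of_lt_of_le ?_ h.hM
  have := h.one_lt_r
  have := h.hδ
  have := h.lam_lt_one
  have := h.hX
  exact div_pos (by positivity) (by linarith)

lemma noise_le : (m.r + 2 * δ) * sX ^ 2 ≤ (1 - lam) * Ms := by
  have := h.hM
  rw [div_le_iff₀ (by linarith [h.lam_lt_one])] at this
  linarith

lemma log_pos : 0 < Real.log (1 / lam) := by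
  refine Real.log_pos ?_
  rw [lt_div_iff₀ h.hl, one_mul]
  exact h.lam_lt_one

lemma one_le_steps : 1 ≤ ⌈Real.log (4 / δ) / Real.log (1 / lam)⌉₊ := by
  rw [Nat.one_le_ceil_iff]
  refine div_pos (Real.log_pos ?_) h.log_pos
  rw [lt_div_iff₀ h.hδ]
  linarith [h.delta_lt]

lemma pow_steps_le : lam ^ ⌈Real.log (4 / δ) / Real.log (1 / lam)⌉₊ ≤ δ / 4 := by
  have h1 := Nat.le_ceil (Real.log (4 / δ) / Real.log (1 / lam))
  rw [div_le_iff₀ h.log_pos] at h1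
  have h2 : 4 / δ ≤ (1 / lam) ^ ⌈Real.log (4 / δ) / Real.log (1 / lam)⌉₊ := by
    rw [← Real.log_le_log_iff (div_pos (by norm_num) h.hδ)
      (pow_pos (one_div_pos.2 h.hl) _), Real.log_pow]
    exact h1
  rw [one_div_pow] at h2
  have h3 := one_div_le_one_div_of_le (div_pos (by norm_num) h.hδ) h2
  rwa [one_div_one_div, one_div_div] at h3

lemma one_le_nStar : 1 ≤ nStar lam δ L := by
  have := h.one_le_steps
  unfold nStar
  omega

/-- The quantity inside the logarithm of the sample size condition. -/
lemma two_hundred_le : 256 ≤ 16 * (d : ℝ) ^ 2 * (nStar lam δ L : ℝ) / δ ^ 2 := by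
  have hδ := h.hδ
  rw [le_div_iff₀ (by positivity)]
  have h1 : (1 : ℝ) ≤ nStar lam δ L := by exact_mod_cast h.one_le_nStar
  have h2 : (1 : ℝ) ≤ d := by exact_mod_cast h.hd
  have h3 : (1 : ℝ) ≤ (d : ℝ) ^ 2 := one_le_pow₀ h2
  have h4 : 1 ≤ (d : ℝ) ^ 2 * (nStar lam δ L : ℝ) := one_le_mul_of_one_le_of_one_le h3 h1
  have h5 : δ ^ 2 ≤ (1 / 4) ^ 2 := pow_le_pow_left₀ hδ.le h.delta_lt.le 2
  linarith

lemma K_pos : 0 < K := by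
  have h1 := (le_max_left _ _).trans_lt ((le_max_right _ _).trans_lt h.hK)
  have : (0 : ℝ) < K := lt_of_le_of_lt (by positivity) h1
  exact_mod_cast this

lemma exp_le (n : ℕ) (D : Fin K → EuclideanSpace ℝ (Fin d)) {t : ℝ} (ht0 : 0 ≤ t)
    (ht : t ≤ K / 8) :
    ∫⁻ x, ENNReal.ofReal (Real.exp (t * relFluct m n sX lam D x))
      ∂stepLaw d q K m.sigmaO sX ≤
        ENNReal.ofReal (2 * (d : ℝ) ^ 2 * Real.exp (16 * t ^ 2 / K)) :=
  relFluct_exp_le h.std h.sep h.hl h.lam_lt_one.le h.weak h.hd h.K_pos n h.hX D ht0 ht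

lemma measurable_relFluct_right (n : ℕ) (D : Fin K → EuclideanSpace ℝ (Fin d)) :
    Measurable fun x : Noise d q K => relFluct m n sX lam D x :=
  LEnKF.measurable_relFluct_right h.std h.sep n sX lam D

/-- The expected relative sampling error. -/
lemma lintegral_relFluct_le (hc : 0 < c) (hc1 : c ≤ 1) (n : ℕ)
    (D : Fin K → EuclideanSpace ℝ (Fin d)) :
    ∫⁻ x, ENNReal.ofReal (relFluct m n sX lam D x) ∂stepLaw d q K m.sigmaO sX ≤
      ENNReal.ofReal (2 * δ / m.r) := by
  have hδ := h.hδ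
  have hδ4 := h.delta_lt
  have hr := h.one_lt_r
  have hd1 : (1 : ℝ) ≤ d := by exact_mod_cast h.hd
  have hlogd : 0 ≤ Real.log d := Real.log_nonneg hd1
  have hKpos : (0 : ℝ) < K := by exact_mod_cast h.K_pos
  have hG := (le_max_right _ _).trans_lt h.hK
  have hG1 := (le_max_left _ _).trans_lt hG
  have hG2 := (le_max_right _ _).trans_lt ((le_max_right _ _).trans_lt hG)
  set ρ := m.r / δ with hρ
  have hρ4 : 4 ≤ ρ := by rw [hρ, le_div_iff₀ hδ]; nlinarith
  have hx : 2 * m.r / δ = 2 * ρ := by rw [hρ]; ring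
  rw [hx] at hG1 hG2
  have hK1 : 36 * ρ ^ 2 ≤ K := by nlinarith
  have hK2 : 72 * ρ ^ 2 * Real.log d ≤ K := by
    refine le_trans ?_ hG2.le
    refine mul_le_mul_of_nonneg_right ?_ hlogd
    rw [le_div_iff₀ hc]
    nlinarith [mul_le_mul_of_nonneg_left hc1 (by positivity : 0 ≤ 72 * ρ ^ 2)]
  -- Since log(2d²) ≤ 1 + 2 log d, this t makes the first term of the moment bound at most 1/ρ =
  -- δ/r. The bounds K ≥ 36ρ² and K ≥ 72ρ² log d do the same for 16t/K.
  set t := ρ * (1 + 2 * Real.log d) with ht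
  have htpos : 0 < t := by positivity
  have htK : t ≤ K / 8 := by
    rw [ht]
    nlinarith [mul_nonneg hlogd (by positivity : 0 ≤ ρ)]
  have h1 := lintegral_le_of_exp_le (ν := stepLaw d q K m.sigmaO sX)
    (h.measurable_relFluct_right n D) (fun x => relFluct_nonneg h.std n h.hX lam D x)
    (D₀ := 2 * (d : ℝ) ^ 2) (by nlinarith) hKpos htpos (h.exp_le n D htpos.le htK)
  refine h1.trans (ENNReal.ofReal_le_ofReal ?_)
  have hlog : Real.log (2 * (d : ℝ) ^ 2) ≤ 1 + 2 * Real.log d := by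
    rw [Real.log_mul (by norm_num) (by positivity), Real.log_pow]
    have := Real.log_two_lt_d9
    push_cast
    linarith
  have e : 2 * δ / m.r = 1 / ρ + 1 / ρ := by rw [hρ]; field_simp; ring
  rw [e]
  refine add_le_add ?_ ?_
  · rw [ht, div_le_div_iff₀ (by positivity) (by positivity)]
    nlinarith
  · rw [ht, div_le_div_iff₀ hKpos (by positivity)]
    nlinarith

end Regime

end

/-! ### The two tolerances and the probabilities of exceeding them. -/

section

/-- The absolute constant of the theorem. -/
def absConst : ℝ := (1 / 1000) ^ 2 / 256

/-- The fluctuation size allowed at the finest localization level. -/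
def fineTol (lam δ : ℝ) (L : ℕ) : ℝ := 1 / 1000 * δ * lam ^ L

/-- The fluctuation size allowed for the variances. -/
def varTol (lam δ : ℝ) (L : ℕ) : ℝ := 1 / 1000 * δ * √lam ^ L

namespace Regime

variable {d q : ℕ} {m : Model d q} {sX lam δ Ms : ℝ} {L K : ℕ}
  (h : Regime m sX lam δ Ms absConst L K)
include h

lemma log_size_pos :
    1 ≤ Real.log (16 * (d : ℝ) ^ 2 * (nStar lam δ L : ℝ) / δ ^ 2) := by
  rw [Real.le_log_iff_exp_le (by linarith [h.two_hundred_le])]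
  have := Real.exp_one_lt_d9
  linarith [h.two_hundred_le]

/-- The absolute constant is chosen so that the logarithmic part of the sample size condition reads
K · `fineTol`² > 256 log N, with N = 16d²n_*/δ². -/
lemma sample_size_fine :
    256 * Real.log (16 * (d : ℝ) ^ 2 * (nStar lam δ L : ℝ) / δ ^ 2) ≤
      K * fineTol lam δ L ^ 2 := by
  have h1 := ((le_max_left _ _).trans_lt h.hK).le
  have hδ := h.hδ
  have hl := h.hl
  have hp : 0 < lam ^ L := pow_pos hl L
  have e : lam ^ (2 * L) = (lam ^ L) ^ 2 := by rw [mul_comm, pow_mul]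
  rw [e, one_div_mul_eq_div, div_le_iff₀ (by unfold absConst; positivity)] at h1
  unfold fineTol
  unfold absConst at h1
  nlinarith

/-- The square of `varTol` exceeds that of `fineTol` by λ^(-L). This gain in the Chernoff exponent
is what makes errors above `varTol` rare even compared with λ^L. -/
lemma sample_size_var :
    256 * (lam ^ L)⁻¹ * Real.log (16 * (d : ℝ) ^ 2 * (nStar lam δ L : ℝ) / δ ^ 2) ≤
      K * varTol lam δ L ^ 2 := by
  have h1 := h.sample_size_fine
  have hl := h.hl
  have hp : 0 < lam ^ L := pow_pos hl L
  have e : varTol lam δ L ^ 2 = fineTol lam δ L ^ 2 * (lam ^ L)⁻¹ := by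
    unfold varTol fineTol
    have : (√lam ^ L) ^ 2 = lam ^ L := by
      rw [← pow_mul, mul_comm, pow_mul, Real.sq_sqrt hl.le]
    rw [mul_pow, this]
    field_simp
  rw [e, ← mul_assoc, mul_right_comm]
  exact mul_le_mul_of_nonneg_right h1 (inv_nonneg.2 hp.le)

lemma fineTol_pos : 0 < fineTol lam δ L := by
  have := h.hδ
  have := pow_pos h.hl L
  unfold fineTol
  positivity

lemma varTol_pos : 0 < varTol lam δ L := by
  have := h.hδ
  have := pow_pos (Real.sqrt_pos.2 h.hl) L
  unfold varTol
  positivity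

lemma fineTol_le : fineTol lam δ L ≤ 1 / 1000 * δ := by
  have h1 : lam ^ L ≤ 1 := pow_le_one₀ h.hl.le h.lam_lt_one.le
  have := h.hδ
  unfold fineTol
  exact mul_le_of_le_one_right (by positivity) h1

lemma varTol_le : varTol lam δ L ≤ 1 / 1000 * δ := by
  have h1 : √lam ^ L ≤ 1 :=
    pow_le_one₀ (Real.sqrt_nonneg _) (Real.sqrt_le_one.2 h.lam_lt_one.le)
  have := h.hδ
  unfold varTol
  exact mul_le_of_le_one_right (by positivity) h1

/-- Rare large fluctuations contribute little, relatively to the finest tolerance. -/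
lemma lintegral_relFluct_excess_le (n : ℕ) (D : Fin K → EuclideanSpace ℝ (Fin d)) :
    ∫⁻ x, ENNReal.ofReal (relFluct m n sX lam D x / fineTol lam δ L - 1)
      ∂stepLaw d q K m.sigmaO sX ≤ ENNReal.ofReal (δ / (8 * nStar lam δ L)) := by
  have hδ := h.hδ
  have hδ4 := h.delta_lt
  have hK : (0 : ℝ) < K := by exact_mod_cast h.K_pos
  have hε := h.fineTol_pos
  have hε1 : fineTol lam δ L ≤ 1 := by linarith [h.fineTol_le]
  have hd1 : (1 : ℝ) ≤ d := by exact_mod_cast h.hd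
  have hn : (1 : ℝ) ≤ nStar lam δ L := by exact_mod_cast h.one_le_nStar
  have hlog := h.log_size_pos
  have hsz := h.sample_size_fine
  have hN := h.two_hundred_le
  set N := 16 * (d : ℝ) ^ 2 * (nStar lam δ L : ℝ) / δ ^ 2 with hNdef
  set κ := (K : ℝ) with hκ
  set ε := fineTol lam δ L with hεdef
  have h1 := lintegral_excess_le (ν := stepLaw d q K m.sigmaO sX) hK hε
    (h.exp_le n D (by positivity) (by nlinarith)) (h.measurable_relFluct_right n D)
  refine h1.trans (ENNReal.ofReal_le_ofReal ?_)
  have e1 : 32 / (κ * ε ^ 2) ≤ 1 / 8 := by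
    rw [div_le_div_iff₀ (by positivity) (by norm_num)]
    linarith
  -- The exponent is at least 4 log N. One power of N suffices: it cancels the union factor d² and
  -- leaves δ²/n_*.
  have e2 : Real.exp (-(κ * ε ^ 2 / 64)) ≤ N⁻¹ := by
    rw [← Real.exp_log (by linarith : 0 < N), ← Real.exp_neg]
    exact Real.exp_le_exp.2 (by linarith)
  calc 32 / (κ * ε ^ 2) * (2 * (d : ℝ) ^ 2 * Real.exp (-(κ * ε ^ 2 / 64)))
      ≤ 1 / 8 * (2 * (d : ℝ) ^ 2 * N⁻¹) := by gcongr
    _ = δ ^ 2 / (64 * nStar lam δ L) := by rw [hNdef]; field_simp; ring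
    _ ≤ δ / (8 * nStar lam δ L) := by
        rw [div_le_div_iff₀ (by positivity) (by positivity)]
        nlinarith [mul_pos hδ (by linarith : (0 : ℝ) < nStar lam δ L)]

/-- Large relative errors of the variances are extremely rare. -/
lemma lintegral_relFluct_tail_le (n : ℕ) (D : Fin K → EuclideanSpace ℝ (Fin d)) :
    ∫⁻ x, (if varTol lam δ L < relFluct m n sX lam D x then
        ENNReal.ofReal (1 + relFluct m n sX lam D x) else 0)
      ∂stepLaw d q K m.sigmaO sX ≤ ENNReal.ofReal (δ * lam ^ L / (64 * nStar lam δ L)) := by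
  have hδ := h.hδ
  have hδ4 := h.delta_lt
  have hK : (0 : ℝ) < K := by exact_mod_cast h.K_pos
  have hτ := h.varTol_pos
  have hτ1 : varTol lam δ L ≤ 1 := by linarith [h.varTol_le]
  have hd1 : (1 : ℝ) ≤ d := by exact_mod_cast h.hd
  have hn : (1 : ℝ) ≤ nStar lam δ L := by exact_mod_cast h.one_le_nStar
  have hlog := h.log_size_pos
  have hsz := h.sample_size_var
  have hN := h.two_hundred_le
  have hp : 0 < lam ^ L := pow_pos h.hl L
  have hl1 : 1 ≤ (lam ^ L)⁻¹ := (one_le_inv₀ hp).2 (pow_le_one₀ h.hl.le h.lam_lt_one.le)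
  set N := 16 * (d : ℝ) ^ 2 * (nStar lam δ L : ℝ) / δ ^ 2 with hNdef
  set κ := (K : ℝ) with hκ
  set τ := varTol lam δ L with hτdef
  set ℓ := (lam ^ L)⁻¹ with hℓ
  have hprod : 1 ≤ ℓ * Real.log N := one_le_mul_of_one_le_of_one_le hl1 hlog
  have hκτ : 32 ≤ κ * τ := by
    have : κ * τ ^ 2 ≤ κ * τ := by
      have := mul_le_mul_of_nonneg_left hτ1 (mul_pos hK hτ).le
      nlinarith
    nlinarith
  have h1 := lintegral_indicator_le (ν := stepLaw d q K m.sigmaO sX)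
    (by positivity : 0 ≤ 2 * (d : ℝ) ^ 2) hτ hτ1 hκτ
    (h.exp_le n D (by positivity) (by nlinarith)) (h.measurable_relFluct_right n D)
  refine h1.trans (ENNReal.ofReal_le_ofReal ?_)
  -- The exponent is at least 4ℓ log N ≥ 2 log N + ℓ, as ℓ and log N are at least 1, and exp(-ℓ) ≤
  -- 1/ℓ = λ^L.
  have e2 : Real.exp (-(κ * τ ^ 2 / 64)) ≤ N⁻¹ * N⁻¹ * lam ^ L := by
    have hNpos : 0 < N := by linarith
    have e3 : Real.exp (-ℓ) ≤ lam ^ L := by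
      rw [Real.exp_neg, ← inv_inv (lam ^ L), ← hℓ]
      refine inv_anti₀ (by linarith) ?_
      linarith [Real.add_one_le_exp ℓ]
    have e4 : Real.exp (-Real.log N) = N⁻¹ := by rw [Real.exp_neg, Real.exp_log hNpos]
    calc Real.exp (-(κ * τ ^ 2 / 64))
        ≤ Real.exp (-Real.log N + -Real.log N + -ℓ) := by
          refine Real.exp_le_exp.2 ?_
          nlinarith
      _ = N⁻¹ * N⁻¹ * Real.exp (-ℓ) := by rw [Real.exp_add, Real.exp_add, e4]
      _ ≤ N⁻¹ * N⁻¹ * lam ^ L := by gcongr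
  have e5 : N⁻¹ ≤ 1 / 256 := by
    rw [one_div]
    exact inv_anti₀ (by norm_num) hN
  calc 3 * (2 * (d : ℝ) ^ 2 * Real.exp (-(κ * τ ^ 2 / 64)))
      ≤ 3 * (2 * (d : ℝ) ^ 2 * (N⁻¹ * (1 / 256) * lam ^ L)) := by
        have : N⁻¹ * N⁻¹ * lam ^ L ≤ N⁻¹ * (1 / 256) * lam ^ L := by gcongr
        have := e2.trans this
        gcongr
    _ = 6 * δ ^ 2 * lam ^ L / (4096 * nStar lam δ L) := by rw [hNdef]; field_simp; ring
    _ ≤ δ * lam ^ L / (64 * nStar lam δ L) := by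
        rw [div_le_div_iff₀ (by positivity) (by positivity)]
        have : 6 * δ ^ 2 ≤ 64 * δ := by nlinarith
        have := mul_le_mul_of_nonneg_right this
          (mul_pos hp (by linarith : (0 : ℝ) < nStar lam δ L)).le
        nlinarith

end Regime

end

/-! ### The largest variance in conditional expectation, with and without large errors. -/

section

section

variable {Ω : Type*} [mΩ : MeasurableSpace Ω] {P : Measure Ω} {d q K L : ℕ} {m : Model d q}
  {sX lam δ Ms : ℝ}

/-- The largest forecast variance at time `n`. -/
def varAt (m : Model d q) (u : Input Ω d q K) (n : ℕ) (ω : Ω) : ℝ :=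
  maxVar (forecastSpread m u n ω)

/-- The relative sampling error of the step from time `n` to time `n + 1`. -/
def errAt (m : Model d q) (u : Input Ω d q K) (sX lam : ℝ) (n : ℕ) (ω : Ω) : ℝ :=
  relFluct m n sX lam (forecastSpread m u n ω) (u.stepNoise n ω)

lemma varAt_nonneg (u : Input Ω d q K) (n : ℕ) (ω : Ω) : 0 ≤ varAt m u n ω := maxVar_nonneg _

namespace Regime

variable (h : Regime m sX lam δ Ms absConst L K)
include h

lemma measurable_spread (u : Input Ω d q K) (n : ℕ) : Measurable (forecastSpread m u n) :=
  (measurable_forecastSpread h.std h.sep u n).mono (u.filtration.le n) le_rfl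

lemma measurable_varAt (u : Input Ω d q K) (n : ℕ) : Measurable (varAt m u n) :=
  measurable_maxVar.comp (h.measurable_spread u n)

lemma measurable_varAt_filtration (u : Input Ω d q K) (n : ℕ) :
    Measurable[u.filtration n] (varAt m u n) :=
  Measurable.comp measurable_maxVar (measurable_forecastSpread h.std h.sep u n)

lemma measurable_errAt_filtration (u : Input Ω d q K) (n : ℕ) :
    Measurable[u.filtration (n + 1)] (errAt m u sX lam n) := by
  have h1 : Measurable[u.filtration (n + 1)] (forecastSpread m u n) :=
    (measurable_forecastSpread h.std h.sep u n).mono (u.filtration.mono n.le_succ) le_rfl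
  have h2 : Measurable[u.filtration (n + 1)] (u.stepNoise n) :=
    (u.measurable_stepNoise_stepSigma n).mono (u.stepSigma_le_filtration n) le_rfl
  have h3 : Measurable[u.filtration (n + 1)]
      fun ω => (forecastSpread m u n ω, u.stepNoise n ω) := Measurable.prodMk h1 h2
  have h4 := Measurable.comp (measurable_relFluct (K := K) h.std h.sep n sX lam) h3
  exact h4

lemma measurable_errAt (u : Input Ω d q K) (n : ℕ) : Measurable (errAt m u sX lam n) :=
  (h.measurable_errAt_filtration u n).mono (u.filtration.le _) le_rfl

lemma errAt_nonneg (u : Input Ω d q K) (n : ℕ) (ω : Ω) : 0 ≤ errAt m u sX lam n ω :=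
  relFluct_nonneg h.std n h.hX lam _ _

lemma nonempty_fin : Nonempty (Fin d) := ⟨⟨0, h.hd⟩⟩

lemma maxVar_spreadStep_le (n : ℕ) (D : Fin K → EuclideanSpace ℝ (Fin d)) (x : Noise d q K) :
    maxVar (spreadStep m n D x) ≤ (1 + relFluct m n sX lam D x) * varScale m sX lam D := by
  have := h.nonempty_fin
  refine ciSup_le fun i => ?_
  have h1 := abs_fluct_le h.std n h.hX lam D x i i
  have h2 := abs_expCov_le h.std h.sep h.hl h.lam_lt_one.le h.weak n sX D (maxVar_nonneg D)
    (ensembleCov_self_le_maxVar D) i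
  have h3 := (le_abs_self _).trans h1
  unfold fluct at h3
  unfold varScale at h3 ⊢
  linarith

lemma varAt_succ_le (u : Input Ω d q K) (n : ℕ) (ω : Ω) :
    varAt m u (n + 1) ω ≤ (1 + errAt m u sX lam n ω) *
      varScale m sX lam (forecastSpread m u n ω) := by
  have h1 := h.maxVar_spreadStep_le n (forecastSpread m u n ω) (u.stepNoise n ω)
  unfold varAt errAt
  rw [forecastSpread_succ]
  exact h1

/-- The condition (r + 2δ)λ < 1 trades the inflation for one of the two factors λ, and the lower
bound on M_* covers the noise. Hence a relative error of mean at most 2δ/r still leaves contraction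
by λ towards M_*. -/
lemma inflated_varScale_le (D : Fin K → EuclideanSpace ℝ (Fin d)) :
    (1 + 2 * δ / m.r) * varScale m sX lam D ≤ lam * maxVar D + (1 - lam) * Ms := by
  have hr : 0 < m.r := by linarith [h.one_lt_r]
  have e : (1 + 2 * δ / m.r) * varScale m sX lam D =
      ((m.r + 2 * δ) * lam) * (lam * maxVar D) + (m.r + 2 * δ) * sX ^ 2 := by
    unfold varScale; field_simp
  rw [e]
  have h1 := mul_le_mul_of_nonneg_right h.r_add_lt.le (mul_nonneg h.hl.le (maxVar_nonneg D))
  linarith [h.noise_le]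

lemma varScale_le (D : Fin K → EuclideanSpace ℝ (Fin d)) :
    varScale m sX lam D ≤ lam * maxVar D + (1 - lam) * Ms := by
  have hr : 0 < m.r := by linarith [h.one_lt_r]
  refine le_trans ?_ (h.inflated_varScale_le D)
  have h1 := (varScale_pos (lam := lam) h.std h.hX D).le
  have h2 : 0 ≤ 2 * δ / m.r := div_nonneg (by linarith [h.hδ]) hr.le
  nlinarith

lemma setLIntegral_affine (u : Input Ω d q K) (n : ℕ) {a b : ℝ} (ha : 0 ≤ a) (hb : 0 ≤ b)
    (A : Set Ω) :
    ∫⁻ ω in A, ENNReal.ofReal (a * varAt m u n ω + b) ∂P =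
      ENNReal.ofReal a * ∫⁻ ω in A, ENNReal.ofReal (varAt m u n ω) ∂P + ENNReal.ofReal b * P A := by
  have e : ∀ ω, ENNReal.ofReal (a * varAt m u n ω + b) =
      ENNReal.ofReal a * ENNReal.ofReal (varAt m u n ω) + ENNReal.ofReal b := by
    intro ω
    rw [ENNReal.ofReal_add (mul_nonneg ha (varAt_nonneg _ _ _)) hb, ENNReal.ofReal_mul ha]
  rw [lintegral_congr e, lintegral_add_right _ measurable_const, lintegral_const_mul]
  · simp
  · exact (h.measurable_varAt u n).ennreal_ofReal

variable [IsProbabilityMeasure P] {u : Input Ω d q K} (hu : u.IsNoiseFor m P)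
  (hSig : ∀ n, m.Sig n = sX ^ 2 • (1 : Matrix (Fin d) (Fin d) ℝ))
include hu hSig

/-- One step of the variances in conditional expectation. -/
lemma setLIntegral_varAt_succ_le (n : ℕ) {A : Set Ω} (hA : MeasurableSet[u.filtration n] A) :
    ∫⁻ ω in A, ENNReal.ofReal (varAt m u (n + 1) ω) ∂P ≤
      ENNReal.ofReal lam * ∫⁻ ω in A, ENNReal.ofReal (varAt m u n ω) ∂P +
        ENNReal.ofReal ((1 - lam) * Ms) * P A := by
  have hg : Measurable (Function.uncurry fun (D : Fin K → EuclideanSpace ℝ (Fin d))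
      (x : Noise d q K) => ENNReal.ofReal (maxVar (spreadStep m n D x))) :=
    (measurable_maxVar.comp (measurable_spreadStep h.std h.sep n)).ennreal_ofReal
  have h1 := setLIntegral_step h.std h.sep u hu hSig n hg hA
  change ∫⁻ ω in A, ENNReal.ofReal (maxVar (spreadStep m n (forecastSpread m u n ω)
    (u.stepNoise n ω))) ∂P ≤ _
  rw [h1, ← h.setLIntegral_affine u n h.hl.le
    (mul_nonneg (sub_nonneg.2 h.lam_lt_one.le) h.Ms_pos.le) A]
  refine lintegral_mono fun ω => ?_
  set D := forecastSpread m u n ω with hD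
  have hΛ := (varScale_pos (lam := lam) h.std h.hX D).le
  have hr : 0 < m.r := by linarith [h.one_lt_r]
  have h2 : ∀ x, ENNReal.ofReal (maxVar (spreadStep m n D x)) ≤
      (1 + ENNReal.ofReal (relFluct m n sX lam D x)) * ENNReal.ofReal (varScale m sX lam D) := by
    intro x
    have hy := relFluct_nonneg h.std n h.hX lam D x
    rw [← ENNReal.ofReal_one, ← ENNReal.ofReal_add zero_le_one hy,
      ← ENNReal.ofReal_mul (by linarith)]
    exact ENNReal.ofReal_le_ofReal (h.maxVar_spreadStep_le n D x)
  have hm := (h.measurable_relFluct_right n D).ennreal_ofReal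
  have hm2 : Measurable fun x : Noise d q K =>
      (1 : ℝ≥0∞) + ENNReal.ofReal (relFluct m n sX lam D x) := measurable_const.add hm
  refine (lintegral_mono h2).trans ?_
  rw [lintegral_mul_const _ hm2, lintegral_add_left measurable_const]
  simp only [lintegral_const, measure_univ, mul_one]
  have h3 := h.lintegral_relFluct_le (by unfold absConst; norm_num) (by unfold absConst; norm_num)
    n D
  have h4 : 0 ≤ 2 * δ / m.r := div_nonneg (by linarith [h.hδ]) hr.le
  calc _ ≤ (1 + ENNReal.ofReal (2 * δ / m.r)) * ENNReal.ofReal (varScale m sX lam D) := by gcongr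
    _ = ENNReal.ofReal ((1 + 2 * δ / m.r) * varScale m sX lam D) := by
        rw [ENNReal.ofReal_mul (by linarith), ENNReal.ofReal_add zero_le_one h4,
          ENNReal.ofReal_one]
    _ ≤ _ := ENNReal.ofReal_le_ofReal (h.inflated_varScale_le D)

/-- Several steps of the variances in conditional expectation. -/
lemma setLIntegral_varAt_add_le (n k : ℕ) {A : Set Ω} (hA : MeasurableSet[u.filtration n] A) :
    ∫⁻ ω in A, ENNReal.ofReal (varAt m u (n + k) ω) ∂P ≤
      ENNReal.ofReal (lam ^ k) * ∫⁻ ω in A, ENNReal.ofReal (varAt m u n ω) ∂P +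
        ENNReal.ofReal ((1 - lam ^ k) * Ms) * P A := by
  have hl := h.hl
  have hl1 := h.lam_lt_one
  have hMs := h.Ms_pos
  induction k with
  | zero => simp
  | succ k ih =>
    have hA' : MeasurableSet[u.filtration (n + k)] A :=
      u.filtration.mono (Nat.le_add_right n k) _ hA
    have h1 := h.setLIntegral_varAt_succ_le hu hSig (n + k) hA'
    have hp : lam ^ k ≤ 1 := pow_le_one₀ hl.le hl1.le
    have e1 : ENNReal.ofReal (lam ^ (k + 1)) = ENNReal.ofReal lam * ENNReal.ofReal (lam ^ k) := by
      rw [← ENNReal.ofReal_mul hl.le, pow_succ']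
    have e2 : ENNReal.ofReal ((1 - lam ^ (k + 1)) * Ms) =
        ENNReal.ofReal lam * ENNReal.ofReal ((1 - lam ^ k) * Ms) +
          ENNReal.ofReal ((1 - lam) * Ms) := by
      have p1 : 0 ≤ (1 - lam ^ k) * Ms := mul_nonneg (by linarith) hMs.le
      have p2 : 0 ≤ (1 - lam) * Ms := mul_nonneg (by linarith) hMs.le
      rw [← ENNReal.ofReal_mul hl.le, ← ENNReal.ofReal_add (mul_nonneg hl.le p1) p2]
      congr 1
      ring
    calc _ ≤ _ := h1
      _ ≤ ENNReal.ofReal lam * (ENNReal.ofReal (lam ^ k) *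
            ∫⁻ ω in A, ENNReal.ofReal (varAt m u n ω) ∂P +
            ENNReal.ofReal ((1 - lam ^ k) * Ms) * P A) +
            ENNReal.ofReal ((1 - lam) * Ms) * P A := by gcongr
      _ = _ := by rw [e1, e2]; ring

lemma setLIntegral_varAt_add_le' (n k : ℕ) {A : Set Ω} (hA : MeasurableSet[u.filtration n] A) :
    ∫⁻ ω in A, ENNReal.ofReal (varAt m u (n + k) ω) ∂P ≤
      ∫⁻ ω in A, ENNReal.ofReal (varAt m u n ω) ∂P + ENNReal.ofReal Ms * P A := by
  have hp : lam ^ k ≤ 1 := pow_le_one₀ h.hl.le h.lam_lt_one.le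
  have hp0 : 0 ≤ lam ^ k := pow_nonneg h.hl.le k
  refine (h.setLIntegral_varAt_add_le hu hSig n k hA).trans (add_le_add ?_ ?_)
  · exact mul_le_of_le_one_left zero_le (by rw [← ENNReal.ofReal_one]; gcongr)
  · gcongr
    nlinarith [h.Ms_pos]

lemma setLIntegral_errAt_excess_le (n : ℕ) {A : Set Ω} (hA : MeasurableSet[u.filtration n] A) :
    ∫⁻ ω in A, ENNReal.ofReal (errAt m u sX lam n ω / fineTol lam δ L - 1) ∂P ≤
      ENNReal.ofReal (δ / (8 * nStar lam δ L)) * P A := by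
  have hg : Measurable (Function.uncurry fun (D : Fin K → EuclideanSpace ℝ (Fin d))
      (x : Noise d q K) => ENNReal.ofReal (relFluct m n sX lam D x / fineTol lam δ L - 1)) :=
    (((measurable_relFluct h.std h.sep n sX lam).div_const _).sub_const _).ennreal_ofReal
  have h1 := setLIntegral_step h.std h.sep u hu hSig n hg hA
  change ∫⁻ ω in A, ENNReal.ofReal (relFluct m n sX lam (forecastSpread m u n ω)
    (u.stepNoise n ω) / fineTol lam δ L - 1) ∂P ≤ _
  rw [h1]
  refine (lintegral_mono fun ω => h.lintegral_relFluct_excess_le n _).trans ?_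
  simp

omit hu hSig in
/-- The event that the step from time `n` makes a large relative error. -/
lemma measurableSet_large (n : ℕ) :
    MeasurableSet[u.filtration (n + 1)] {ω | varTol lam δ L < errAt m u sX lam n ω} :=
  (h.measurable_errAt_filtration u n) measurableSet_Ioi

lemma measure_large_le (n : ℕ) {A : Set Ω} (hA : MeasurableSet[u.filtration n] A) :
    P (A ∩ {ω | varTol lam δ L < errAt m u sX lam n ω}) ≤
      ENNReal.ofReal (δ * lam ^ L / (64 * nStar lam δ L)) * P A := by
  have hE := u.filtration.le _ _ (h.measurableSet_large (u := u) n)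
  have hg : Measurable (Function.uncurry fun (D : Fin K → EuclideanSpace ℝ (Fin d))
      (x : Noise d q K) => if varTol lam δ L < relFluct m n sX lam D x then (1 : ℝ≥0∞) else 0) :=
    Measurable.ite (measurableSet_lt measurable_const (measurable_relFluct h.std h.sep n sX lam))
      measurable_const measurable_const
  have h1 := setLIntegral_step h.std h.sep u hu hSig n hg hA
  have e : ∫⁻ ω in A, (if varTol lam δ L < relFluct m n sX lam (forecastSpread m u n ω)
      (u.stepNoise n ω) then (1 : ℝ≥0∞) else 0) ∂P =
      P (A ∩ {ω | varTol lam δ L < errAt m u sX lam n ω}) := by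
    have e2 : (fun ω => if varTol lam δ L < relFluct m n sX lam (forecastSpread m u n ω)
        (u.stepNoise n ω) then (1 : ℝ≥0∞) else 0) =
        {ω | varTol lam δ L < errAt m u sX lam n ω}.indicator 1 := by
      ext ω
      simp only [Set.indicator, Set.mem_ofPred_eq, errAt, Pi.one_apply]
      congr
    rw [e2, lintegral_indicator_one hE, Measure.restrict_apply hE, Set.inter_comm]
  rw [← e, h1]
  refine (lintegral_mono fun ω => ?_).trans (by rw [setLIntegral_const])
  refine (lintegral_mono fun x => ?_).trans (h.lintegral_relFluct_tail_le n (forecastSpread m u n ω))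
  split_ifs
  · rw [ENNReal.one_le_ofReal]
    linarith [relFluct_nonneg h.std n h.hX lam (forecastSpread m u n ω) x]
  · exact le_rfl

/-- Given the past, the next largest variance is at most (1 + y)(λV + (1-λ)M_*) with y the relative
error, so the restriction to y > `varTol` is governed by the tail moment of 1 + y. -/
lemma setLIntegral_varAt_succ_large_le (n : ℕ) {A : Set Ω}
    (hA : MeasurableSet[u.filtration n] A) :
    ∫⁻ ω in A ∩ {ω | varTol lam δ L < errAt m u sX lam n ω},
        ENNReal.ofReal (varAt m u (n + 1) ω) ∂P ≤
      ENNReal.ofReal (δ * lam ^ L / (64 * nStar lam δ L)) *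
        (ENNReal.ofReal lam * ∫⁻ ω in A, ENNReal.ofReal (varAt m u n ω) ∂P +
          ENNReal.ofReal ((1 - lam) * Ms) * P A) := by
  have hE := u.filtration.le _ _ (h.measurableSet_large (u := u) n)
  have hm0 : Measurable (Function.uncurry fun (D : Fin K → EuclideanSpace ℝ (Fin d))
      (x : Noise d q K) => maxVar (spreadStep m n D x)) :=
    measurable_maxVar.comp (measurable_spreadStep h.std h.sep n)
  have hg : Measurable (Function.uncurry fun (D : Fin K → EuclideanSpace ℝ (Fin d))
      (x : Noise d q K) => if varTol lam δ L < relFluct m n sX lam D x then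
        ENNReal.ofReal (maxVar (spreadStep m n D x)) else 0) :=
    Measurable.ite (measurableSet_lt measurable_const (measurable_relFluct h.std h.sep n sX lam))
      hm0.ennreal_ofReal measurable_const
  have h1 := setLIntegral_step h.std h.sep u hu hSig n hg hA
  have e : ∫⁻ ω in A ∩ {ω | varTol lam δ L < errAt m u sX lam n ω},
        ENNReal.ofReal (varAt m u (n + 1) ω) ∂P =
      ∫⁻ ω in A, (if varTol lam δ L < relFluct m n sX lam (forecastSpread m u n ω)
        (u.stepNoise n ω) then ENNReal.ofReal (maxVar (spreadStep m n (forecastSpread m u n ω)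
          (u.stepNoise n ω))) else 0) ∂P := by
    rw [Set.inter_comm, ← Measure.restrict_restrict hE, ← lintegral_indicator hE]
    refine lintegral_congr fun ω => ?_
    simp only [Set.indicator, Set.mem_ofPred_eq, errAt, varAt, forecastSpread_succ]
    congr
  rw [e, h1, ← h.setLIntegral_affine u n h.hl.le
    (mul_nonneg (sub_nonneg.2 h.lam_lt_one.le) h.Ms_pos.le) A, ← lintegral_const_mul _
    ((((h.measurable_varAt u n).const_mul lam).add_const _).ennreal_ofReal)]
  refine lintegral_mono fun ω => ?_
  set D := forecastSpread m u n ω with hD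
  have h2 : ∀ x, (if varTol lam δ L < relFluct m n sX lam D x then
        ENNReal.ofReal (maxVar (spreadStep m n D x)) else 0) ≤
      (if varTol lam δ L < relFluct m n sX lam D x then
        ENNReal.ofReal (1 + relFluct m n sX lam D x) else 0) *
          ENNReal.ofReal (lam * varAt m u n ω + (1 - lam) * Ms) := by
    intro x
    have hy := relFluct_nonneg h.std n h.hX lam D x
    split_ifs
    · rw [← ENNReal.ofReal_mul (by linarith)]
      refine ENNReal.ofReal_le_ofReal ((h.maxVar_spreadStep_le n D x).trans ?_)
      exact mul_le_mul_of_nonneg_left (h.varScale_le D) (by linarith)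
    · simp
  have hm : Measurable fun x : Noise d q K => if varTol lam δ L < relFluct m n sX lam D x then
        ENNReal.ofReal (1 + relFluct m n sX lam D x) else 0 :=
    Measurable.ite (measurableSet_lt measurable_const (h.measurable_relFluct_right n D))
      ((h.measurable_relFluct_right n D).const_add 1).ennreal_ofReal measurable_const
  refine (lintegral_mono h2).trans ?_
  rw [lintegral_mul_const _ hm]
  gcongr
  exact h.lintegral_relFluct_tail_le n D

/-- A large error at time `n + j` contributes little to the variances at a later time. -/
lemma setLIntegral_varAt_large_le (n : ℕ) {j k : ℕ} (hjk : j < k) {A : Set Ω}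
    (hA : MeasurableSet[u.filtration n] A) :
    ∫⁻ ω in A ∩ {ω | varTol lam δ L < errAt m u sX lam (n + j) ω},
        ENNReal.ofReal (varAt m u (n + k) ω) ∂P ≤
      ENNReal.ofReal (δ * lam ^ L / (64 * nStar lam δ L)) *
        (∫⁻ ω in A, ENNReal.ofReal (varAt m u n ω) ∂P + 3 * ENNReal.ofReal Ms * P A) := by
  have hl := h.hl
  have hl1 := h.lam_lt_one
  have hMs := h.Ms_pos
  have hA' : MeasurableSet[u.filtration (n + j)] A :=
    u.filtration.mono (Nat.le_add_right n j) _ hA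
  have hAE : MeasurableSet[u.filtration (n + j + 1)]
      (A ∩ {ω | varTol lam δ L < errAt m u sX lam (n + j) ω}) :=
    MeasurableSet.inter (u.filtration.mono (Nat.le_add_right n (j + 1)) _ hA)
      (h.measurableSet_large (n + j))
  -- The event is decided at time n + j + 1: conditioning there handles the later steps, the tail
  -- bound handles step n + j, and the variance bound from time n handles the earlier ones.
  have h1 := h.setLIntegral_varAt_add_le' hu hSig (n + j + 1) (k - j - 1) hAE
  rw [show n + j + 1 + (k - j - 1) = n + k by omega] at h1
  have h2 := h.setLIntegral_varAt_succ_large_le hu hSig (n + j) hA'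
  have h3 := h.measure_large_le hu hSig (n + j) hA'
  have h4 := h.setLIntegral_varAt_add_le' hu hSig n j hA
  set Q := ENNReal.ofReal (δ * lam ^ L / (64 * nStar lam δ L)) with hQ
  have h5 : ENNReal.ofReal lam * ∫⁻ ω in A, ENNReal.ofReal (varAt m u (n + j) ω) ∂P ≤
      ∫⁻ ω in A, ENNReal.ofReal (varAt m u n ω) ∂P + ENNReal.ofReal Ms * P A :=
    (mul_le_of_le_one_left zero_le (ENNReal.ofReal_le_one.2 hl1.le)).trans h4
  have h6 : ENNReal.ofReal ((1 - lam) * Ms) ≤ ENNReal.ofReal Ms :=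
    ENNReal.ofReal_le_ofReal (by nlinarith)
  calc _ ≤ _ := h1
    _ ≤ Q * ((∫⁻ ω in A, ENNReal.ofReal (varAt m u n ω) ∂P + ENNReal.ofReal Ms * P A) +
          ENNReal.ofReal Ms * P A) + ENNReal.ofReal Ms * (Q * P A) := by
        refine add_le_add (h2.trans ?_) (by gcongr)
        gcongr
    _ = _ := by ring

end Regime

end

end

/-! ### Pathwise analysis of a window without large errors. -/

section

/-- The margin by which the localization weights contract once the variances are near their
equilibrium. -/
lemma contraction_margin {lam w δ : ℝ} (hl : 0 < lam) (hl1 : lam < 1) (hw0 : 0 ≤ w)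
    (hw : w ≤ lam ∨ w ≤ 1 ∧ lam ≤ 1 / 16) (hwδ : lam * w ≤ δ / 4) (hδ4 : δ ≤ 1 / 4)
    (hδl : 2 * δ * lam ≤ 1 - lam) :
    (1 + 4 / 7 * w) ^ 3 * √lam ≤ 1 - 1 / 500 * δ := by
  have hs0 := Real.sqrt_nonneg lam
  -- As δ ≤ 1/4, the target is at least 1999/2000; for λ away from 1 it is enough to check numerical
  -- bounds a on w and b on √λ.
  have key : ∀ a b : ℝ, 0 ≤ b → w ≤ a → √lam ≤ b → (1 + 4 / 7 * a) ^ 3 * b ≤ 1999 / 2000 →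
      (1 + 4 / 7 * w) ^ 3 * √lam ≤ 1 - 1 / 500 * δ := by
    intro a b hb ha hsb hab
    have ha0 : 0 ≤ a := hw0.trans ha
    have h1 : (1 + 4 / 7 * w) ^ 3 ≤ (1 + 4 / 7 * a) ^ 3 := by gcongr
    have h2 := mul_le_mul h1 hsb hs0 (by positivity)
    linarith
  have sq : ∀ b : ℝ, 0 ≤ b → lam ≤ b ^ 2 → √lam ≤ b := fun b hb h => Real.sqrt_le_iff.2 ⟨hb, h⟩
  have quot : ∀ a : ℝ, 0 < a → a ≤ lam → w ≤ 1 / (16 * a) := by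
    intro a ha hal
    rw [le_div_iff₀ (by positivity)]
    nlinarith
  rcases hw with hw | ⟨hw, hl16⟩
  · by_cases h1 : lam ≤ 4 / 9
    · refine key (1 / 4) (2 / 3) (by norm_num) ?_ (sq _ (by norm_num) (by linarith)) (by norm_num)
      by_cases h2 : lam ≤ 1 / 4
      · linarith
      · exact (quot (1 / 4) (by norm_num) (by linarith)).trans (by norm_num)
    by_cases h2 : lam ≤ 9 / 16
    · exact key (9 / 64) (3 / 4) (by norm_num) ((quot (4 / 9) (by norm_num) (by linarith)).trans
        (by norm_num)) (sq _ (by norm_num) (by linarith)) (by norm_num)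
    by_cases h3 : lam ≤ 2 / 3
    · exact key (1 / 9) (41 / 50) (by norm_num) ((quot (9 / 16) (by norm_num) (by linarith)).trans
        (by norm_num)) (sq _ (by norm_num) (by linarith)) (by norm_num)
    push Not at h1 h2 h3
    -- Near λ = 1 the margin must be linear in t = 1 - λ. The hypotheses force δ ≤ 3t/4 and w ≤
    -- 9t/32, so the cube grows by about 27t/56, less than the gain t/2 from √λ.
    obtain ⟨t, rfl⟩ : ∃ t, lam = 1 - t := ⟨1 - lam, by ring⟩
    have ht0 : 0 < t := by linarith
    have ht3 : t < 1 / 3 := by linarith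
    have hδt : δ ≤ 3 / 4 * t := by nlinarith
    have hwt : w ≤ 9 / 32 * t := by
      have : (1 - t) ^ 2 * w ≤ t / 8 := by nlinarith
      nlinarith
    have hst : √(1 - t) ≤ 1 - t / 2 := sq _ (by linarith) (by nlinarith)
    have h4 : (1 + 4 / 7 * w) ^ 3 ≤ (1 + 9 / 56 * t) ^ 3 := by
      gcongr ?_ ^ 3
      linarith
    have h5 := mul_le_mul h4 hst hs0 (by positivity)
    have h6 : (1 + 9 / 56 * t) ^ 3 * (1 - t / 2) ≤ 1 - 3 / 2000 * t := by
      have e : (1 + 9 / 56 * t) ^ 3 * (1 - t / 2) = 1 - 1 / 56 * t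
          - (27 / 112 - 243 / 3136) * t ^ 2 - (243 / 6272 - 729 / 175616) * t ^ 3
          - 729 / 351232 * t ^ 4 := by ring
      rw [e]
      have := pow_pos ht0 2
      have := pow_pos ht0 3
      have := pow_pos ht0 4
      linarith
    linarith
  · exact key 1 (1 / 4) (by norm_num) hw (sq _ (by norm_num) (by linarith)) (by norm_num)

/-- By the arithmetic-geometric mean inequality, (7/16 v + M)² ≥ 7/4 vM, so M² ≤ ((7/16 v + M)a)².
It converts a loss M/a into a fraction of the initial variance v plus M. -/
lemma le_add_mul_of_le_mul_sq {M v a : ℝ} (hM : 0 < M) (hv : 0 ≤ v) (ha : 0 ≤ a)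
    (h : M ≤ 7 / 4 * v * a ^ 2) : M ≤ (7 / 16 * v + M) * a := by
  by_contra! hcon
  have h1 := pow_lt_pow_left₀ hcon (by positivity) two_ne_zero
  have h2 := mul_le_mul_of_nonneg_right h hM.le
  have h3 := mul_nonneg (sq_nonneg (7 / 16 * v - M)) (sq_nonneg a)
  linarith

lemma locMagnitude_le {d L : ℕ} [Nonempty (Fin d)] {dist : Fin d → Fin d → ℝ} {lam B : ℝ}
    {C : Matrix (Fin d) (Fin d) ℝ}
    (h : ∀ i j, |C i j| * lam ^ (-(min (dist i j) (L : ℝ))) ≤ B) :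
    locMagnitude dist lam L C ≤ B :=
  ciSup_le fun p => h p.1 p.2

lemma le_locMagnitude {d L : ℕ} (dist : Fin d → Fin d → ℝ) (lam : ℝ)
    (C : Matrix (Fin d) (Fin d) ℝ) (i j : Fin d) :
    |C i j| * lam ^ (-(min (dist i j) (L : ℝ))) ≤ locMagnitude dist lam L C :=
  le_ciSup (f := fun p : Fin d × Fin d =>
    |C p.1 p.2| * lam ^ (-(min (dist p.1 p.2) (L : ℝ)))) (Set.finite_range _).bddAbove (i, j)

lemma rpow_neg_min_le {lam : ℝ} (hl : 0 < lam) (hl1 : lam ≤ 1) (x : ℝ) (L : ℕ) :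
    lam ^ (-(min x (L : ℝ))) ≤ (lam ^ L)⁻¹ := by
  rw [← Real.rpow_natCast, ← Real.rpow_neg hl.le]
  exact Real.rpow_le_rpow_of_exponent_ge hl hl1 (neg_le_neg (min_le_right _ _))

lemma max_rpow_mul_rpow_neg_min_le {lam θ : ℝ} (hl : 0 < lam) (hl1 : lam ≤ 1) (hθ : 0 ≤ θ)
    (x : ℝ) (L : ℕ) :
    max (lam ^ x) θ * lam ^ (-(min x (L : ℝ))) ≤ max 1 (θ * (lam ^ L)⁻¹) := by
  have hp : 0 ≤ lam ^ (-(min x (L : ℝ))) := Real.rpow_nonneg hl.le _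
  rw [max_mul_of_nonneg _ _ hp]
  refine max_le_max ?_ (mul_le_mul_of_nonneg_left (rpow_neg_min_le hl hl1 x L) hθ)
  rw [← Real.rpow_add hl]
  exact Real.rpow_le_one hl.le hl1 (by linarith [min_le_left x (L : ℝ)])

section

variable {Ω : Type*} [mΩ : MeasurableSpace Ω] {d q K L : ℕ} {m : Model d q}
  {sX lam δ Ms : ℝ}

namespace Regime

variable (h : Regime m sX lam δ Ms absConst L K)
include h

lemma locMagnitude_forecastCov_le (u : Input Ω d q K) (n : ℕ) (ω : Ω) :
    locMagnitude m.dist lam L (forecastCov m u n ω) ≤ (lam ^ L)⁻¹ * varAt m u n ω := by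
  have := h.nonempty_fin
  refine locMagnitude_le fun i j => ?_
  rw [mul_comm]
  exact mul_le_mul (rpow_neg_min_le h.hl h.lam_lt_one.le _ L)
    (abs_ensembleCov_le_maxVar (forecastSpread m u n ω) i j) (abs_nonneg _)
    (inv_nonneg.2 (pow_pos h.hl L).le)

lemma varAt_le_locMagnitude (u : Input Ω d q K) (n : ℕ) (ω : Ω) :
    varAt m u n ω ≤ locMagnitude m.dist lam L (forecastCov m u n ω) := by
  have := h.nonempty_fin
  refine ciSup_le fun i => ?_
  have h1 := le_locMagnitude (L := L) m.dist lam (forecastCov m u n ω) i i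
  rw [h.std.dist_self, min_eq_left (Nat.cast_nonneg L), neg_zero, Real.rpow_zero, mul_one] at h1
  exact (le_abs_self _).trans h1

/-- The inflation `1 + e` of the variances caused by errors of size `varTol` beyond the margin
offered by `δ`; it matters only if `lam` is tiny. -/
lemma exists_inflation (hL : 1 ≤ L) : ∃ e : ℝ, 0 ≤ e ∧ e ≤ varTol lam δ L ∧
    1 + varTol lam δ L ≤ (1 + e) * (1 + 2 * δ / m.r) ∧
    (e = 0 ∨ L = 1 ∧ lam ≤ 1 / 1000 ∧ √lam ≤ 1 / 1000 ∧ e ≤ 1 / 1000) := by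
  have hτ := h.varTol_pos
  have hr := h.one_lt_r
  have hδ := h.hδ
  have hl := h.hl
  have hτδ := h.varTol_le
  by_cases hc : varTol lam δ L ≤ 2 * δ / m.r
  · exact ⟨0, le_rfl, hτ.le, by linarith, Or.inl rfl⟩
  · push Not at hc
    refine ⟨varTol lam δ L, hτ.le, le_rfl, ?_, Or.inr ?_⟩
    · exact le_mul_of_one_le_right (by linarith)
        (by linarith [div_nonneg (by linarith : 0 ≤ 2 * δ) (by linarith : 0 ≤ m.r)])
    have hs : 0 < √lam := Real.sqrt_pos.2 hl
    have hs1 : √lam ≤ 1 := Real.sqrt_le_one.2 h.lam_lt_one.le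
    have hss : √lam * √lam = lam := Real.mul_self_sqrt hl.le
    rw [div_lt_iff₀ (by linarith)] at hc
    have h1 : m.r * lam < 1 := by nlinarith [h.r_add_lt]
    have h2 : 2000 * lam < √lam ^ L := by
      unfold varTol at hc
      have h3 : 2 < 1 / 1000 * √lam ^ L * m.r := by
        by_contra! hcon
        nlinarith
      have := mul_lt_mul_of_pos_right h3 hl
      have : 1 / 1000 * √lam ^ L * m.r * lam ≤ 1 / 1000 * √lam ^ L := by
        have : 0 ≤ 1 / 1000 * √lam ^ L := by positivity
        nlinarith
      linarith
    have hL1 : L = 1 := by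
      by_contra hne
      have h2L : 2 ≤ L := by omega
      have := pow_le_pow_of_le_one hs.le hs1 h2L
      rw [pow_two, hss] at this
      linarith
    have h3 : √lam ≤ 1 / 1000 := by
      rw [hL1, pow_one] at h2
      nlinarith
    exact ⟨hL1, by nlinarith, h3, by linarith [h.delta_lt]⟩

/-- Each step is the affine map V ↦ (1+e)(λV + (1-λ)M_*). The level (1+2e)M_* lies above its fixed
point because the difference is e(1 - 2(1+e)λ)M_* ≥ 0, whence the alternative on e. -/
lemma varAt_add_le {e : ℝ} (he0 : 0 ≤ e)
    (he : 1 + varTol lam δ L ≤ (1 + e) * (1 + 2 * δ / m.r))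
    (he' : e = 0 ∨ 2 * ((1 + e) * lam) ≤ 1) (u : Input Ω d q K) (ω : Ω) (n N : ℕ)
    (hy : ∀ j < N, errAt m u sX lam (n + j) ω ≤ varTol lam δ L) :
    varAt m u (n + N) ω ≤ ((1 + e) * lam) ^ N * varAt m u n ω + (1 + 2 * e) * Ms := by
  have hl := h.hl
  have hl1 := h.lam_lt_one
  have hMs := h.Ms_pos
  induction N with
  | zero =>
    simp only [pow_zero, one_mul, add_zero]
    nlinarith [mul_nonneg he0 hMs.le]
  | succ N ih =>
    have ih := ih fun j hj => hy j (by omega)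
    have h1 := h.varAt_succ_le u (n + N) ω
    have h2 := hy N (by omega)
    have hΛ := varScale_pos (lam := lam) h.std h.hX (forecastSpread m u (n + N) ω)
    have h3 := h.inflated_varScale_le (forecastSpread m u (n + N) ω)
    change _ ≤ lam * varAt m u (n + N) ω + _ at h3
    set Λ := varScale m sX lam (forecastSpread m u (n + N) ω)
    have h4 : varAt m u (n + N + 1) ω ≤ (1 + e) * (lam * varAt m u (n + N) ω + (1 - lam) * Ms) :=
      calc _ ≤ _ := h1
        _ ≤ ((1 + e) * (1 + 2 * δ / m.r)) * Λ := by gcongr; linarith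
        _ = (1 + e) * ((1 + 2 * δ / m.r) * Λ) := by ring
        _ ≤ _ := by gcongr
    have hp : 0 ≤ (1 + e) * lam := by positivity
    have h5 := mul_le_mul_of_nonneg_left ih hp
    have h6 : (1 + e) * lam * ((1 + 2 * e) * Ms) + (1 + e) * (1 - lam) * Ms ≤ (1 + 2 * e) * Ms := by
      have e1 : (1 + 2 * e) * Ms - ((1 + e) * lam * ((1 + 2 * e) * Ms) +
          (1 + e) * (1 - lam) * Ms) = e * (1 - 2 * ((1 + e) * lam)) * Ms := by ring
      rcases he' with rfl | he'
      · linarith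
      · have := mul_nonneg (mul_nonneg he0 (sub_nonneg.2 he')) hMs.le
        linarith
    rw [← add_assoc, pow_succ']
    linarith

/-- One step of the off-diagonal covariances. -/
lemma abs_forecastCov_succ_le (u : Input Ω d q K) (ω : Ω) (n : ℕ) {x θ Y : ℝ} (hx0 : 0 ≤ x)
    (hx1 : x ≤ 1) (hx : (1 + x) ^ 3 * √lam ≤ 1 - 1 / 500 * δ) (hθ0 : 0 ≤ θ) (hθ1 : θ ≤ 1)
    (hv : varAt m u n ω ≤ (1 + x) * Ms)
    (hC : ∀ i j, |forecastCov m u n ω i j| ≤ (1 + x) * Ms * max (lam ^ m.dist i j) θ)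
    (hy : errAt m u sX lam n ω ≤ Y) {i j : Fin d} (hij : i ≠ j) :
    |forecastCov m u (n + 1) ω i j| ≤
      Ms * max (lam ^ m.dist i j) (max (√lam * θ) (Y / (1 / 1000 * δ))) := by
  have hl := h.hl
  have hl1 := h.lam_lt_one
  have hMs := h.Ms_pos
  have hδ := h.hδ
  have hr := h.one_lt_r
  have hσ := h.std.sigmaO_pos
  have hy0 := h.errAt_nonneg u n ω
  have h1 := abs_expCov_le_weight h.std h.sep h.hl hl1.le h.weak n sX (forecastSpread m u n ω)
    hθ0 hθ1 (by positivity) hC hij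
  have h2 := abs_fluct_le h.std n h.hX lam (forecastSpread m u n ω) (u.stepNoise n ω) i j
  have h3 := h.varScale_le (forecastSpread m u n ω)
  change _ ≤ lam * varAt m u n ω + _ at h3
  have hΛ : varScale m sX lam (forecastSpread m u n ω) ≤ 2 * Ms := by
    have : lam * varAt m u n ω ≤ lam * ((1 + x) * Ms) := by gcongr
    have : lam * (x * Ms) ≤ 1 * (1 * Ms) := by gcongr
    nlinarith
  -- The posterior bound is at most cubic in M, so inflating M_* by 1 + x costs (1+x)³. The ψ
  -- condition uses one of the two factors λ and the other remains.
  have hα : m.r * (lam ^ 2 * ((1 + x) * Ms * (1 + (1 + x) * Ms / m.sigmaO ^ 2) ^ 2 +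
      ((1 + x) * Ms) ^ 2 / m.sigmaO ^ 2)) ≤ lam * ((1 + x) ^ 3 * Ms) := by
    have hpsi := h.hpsi
    unfold psi at hpsi
    have hp1 : (m.r + δ) * (lam * Ms * (1 + Ms / m.sigmaO ^ 2) ^ 2 +
        lam * (Ms ^ 2 / m.sigmaO ^ 2)) ≤ Ms :=
      le_trans (mul_le_mul_of_nonneg_left (le_max_left _ _) (by linarith)) hpsi
    have hp2 : 0 ≤ lam * Ms * (1 + Ms / m.sigmaO ^ 2) ^ 2 + lam * (Ms ^ 2 / m.sigmaO ^ 2) := by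
      positivity
    have hp3 : m.r * (lam * Ms * (1 + Ms / m.sigmaO ^ 2) ^ 2 + lam * (Ms ^ 2 / m.sigmaO ^ 2)) ≤
        Ms := by nlinarith
    have g1 : 1 + (1 + x) * Ms / m.sigmaO ^ 2 ≤ (1 + x) * (1 + Ms / m.sigmaO ^ 2) := by
      have : (1 + x) * Ms / m.sigmaO ^ 2 = (1 + x) * (Ms / m.sigmaO ^ 2) := by ring
      rw [this]
      linarith
    have g2 : (1 + (1 + x) * Ms / m.sigmaO ^ 2) ^ 2 ≤
        ((1 + x) * (1 + Ms / m.sigmaO ^ 2)) ^ 2 := by gcongr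
    have g3 : (1 + x) ^ 2 ≤ (1 + x) ^ 3 := pow_le_pow_right₀ (by linarith) (by norm_num)
    calc _ ≤ m.r * (lam ^ 2 * ((1 + x) * Ms * ((1 + x) * (1 + Ms / m.sigmaO ^ 2)) ^ 2 +
          (1 + x) ^ 3 * (Ms ^ 2 / m.sigmaO ^ 2))) := by
          have : ((1 + x) * Ms) ^ 2 / m.sigmaO ^ 2 ≤ (1 + x) ^ 3 * (Ms ^ 2 / m.sigmaO ^ 2) := by
            rw [mul_pow, mul_div_assoc]
            gcongr
          gcongr
      _ = lam * ((1 + x) ^ 3 * (m.r * (lam * Ms * (1 + Ms / m.sigmaO ^ 2) ^ 2 +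
          lam * (Ms ^ 2 / m.sigmaO ^ 2)))) := by ring
      _ ≤ _ := by gcongr
  have hs0 : 0 ≤ √lam := Real.sqrt_nonneg _
  have hs1 : √lam ≤ 1 := Real.sqrt_le_one.2 hl1.le
  have hss : √lam * √lam = lam := Real.mul_self_sqrt hl.le
  set w := lam ^ m.dist i j with hw
  have hw0 : 0 ≤ w := Real.rpow_nonneg hl.le _
  set φ := max w (max (√lam * θ) (Y / (1 / 1000 * δ))) with hφ
  have hφ0 : 0 ≤ φ := hw0.trans (le_max_left _ _)
  have h4 : √lam * max w θ ≤ φ := by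
    rw [mul_max_of_nonneg _ _ hs0]
    refine max_le ((mul_le_of_le_one_left hw0 hs1).trans (le_max_left _ _)) ?_
    exact (le_max_left _ _).trans (le_max_right _ _)
  have h5 : Y ≤ 1 / 1000 * δ * φ := by
    have : Y / (1 / 1000 * δ) ≤ φ := (le_max_right _ _).trans (le_max_right _ _)
    rwa [div_le_iff₀ (by positivity), mul_comm] at this
  have hm0 : 0 ≤ max w θ := hw0.trans (le_max_left _ _)
  -- The remaining factor is split as √λ · √λ: one lowers the floor θ, the other beats (1+x)³ and
  -- leaves the margin δ/500.
  have h6 : |expCov m n sX (forecastSpread m u n ω) i j| ≤ (1 - 1 / 500 * δ) * (Ms * φ) :=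
    calc _ ≤ _ := h1
      _ ≤ lam * ((1 + x) ^ 3 * Ms) * max w θ := by gcongr
      _ = ((1 + x) ^ 3 * √lam) * (Ms * (√lam * max w θ)) := by
          nth_rewrite 1 [← hss]; ring
      _ ≤ (1 - 1 / 500 * δ) * (Ms * φ) := by
          have : 0 ≤ 1 - 1 / 500 * δ := by linarith [h.delta_lt]
          gcongr
  -- The sampling error fits into that margin: a relative error of at most δφ/1000 times a scale of
  -- at most 2M_*.
  have h7 : |fluct m n sX (forecastSpread m u n ω) (u.stepNoise n ω) i j| ≤
      1 / 500 * δ * (Ms * φ) :=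
    calc _ ≤ _ := h2
      _ ≤ (1 / 1000 * δ * φ) * (2 * Ms) := by
          have h8 : errAt m u sX lam n ω ≤ 1 / 1000 * δ * φ := hy.trans h5
          have h9 := (varScale_pos (lam := lam) h.std h.hX (forecastSpread m u n ω)).le
          exact mul_le_mul h8 hΛ h9 (by positivity)
      _ = _ := by ring
  have h8 : forecastCov m u (n + 1) ω i j =
      expCov m n sX (forecastSpread m u n ω) i j +
        fluct m n sX (forecastSpread m u n ω) (u.stepNoise n ω) i j := by
    unfold fluct forecastCov
    rw [forecastSpread_succ]
    ring
  rw [h8]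
  refine (abs_add_le _ _).trans ?_
  linarith

/-- Several steps of the covariances, the localization improving by half a level each time. -/
lemma abs_forecastCov_add_le (u : Input Ω d q K) (ω : Ω) (n S : ℕ) {x Y : ℝ} (hx0 : 0 ≤ x)
    (hx1 : x ≤ 1) (hx : (1 + x) ^ 3 * √lam ≤ 1 - 1 / 500 * δ) (hY1 : Y ≤ 1 / 1000 * δ)
    (hv : ∀ s ≤ S, varAt m u (n + s) ω ≤ (1 + x) * Ms)
    (hy : ∀ s < S, errAt m u sX lam (n + s) ω ≤ Y) :
    (∀ i j, |forecastCov m u (n + S) ω i j| ≤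
      (1 + x) * Ms * max (lam ^ m.dist i j) (max (√lam ^ S) (Y / (1 / 1000 * δ)))) ∧
    (1 ≤ S → ∀ i j, i ≠ j → |forecastCov m u (n + S) ω i j| ≤
      Ms * max (lam ^ m.dist i j) (max (√lam ^ S) (Y / (1 / 1000 * δ)))) := by
  have hl := h.hl
  have hMs := h.Ms_pos
  have hδ := h.hδ
  have hs0 : 0 ≤ √lam := Real.sqrt_nonneg _
  have hs1 : √lam ≤ 1 := Real.sqrt_le_one.2 h.lam_lt_one.le
  have hYδ : Y / (1 / 1000 * δ) ≤ 1 := div_le_one_of_le₀ hY1 (by positivity)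
  induction S with
  | zero =>
    refine ⟨fun i j => ?_, fun h0 => absurd h0 (by norm_num)⟩
    have h1 : 1 ≤ max (lam ^ m.dist i j) (max (√lam ^ 0) (Y / (1 / 1000 * δ))) := by
      rw [pow_zero]
      exact (le_max_left _ _).trans (le_max_right _ _)
    have h2 : |forecastCov m u (n + 0) ω i j| ≤ varAt m u (n + 0) ω :=
      abs_ensembleCov_le_maxVar _ i j
    exact (h2.trans (hv 0 le_rfl)).trans (le_mul_of_one_le_right (by positivity) h1)
  | succ S ih =>
    -- Diagonal entries may reach (1+x)M_*, so only the weaker bound is inductive; every step from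
    -- it restores M_* off the diagonal.
    obtain ⟨ih, -⟩ := ih (fun s hs => hv s (by omega)) fun s hs => hy s (by omega)
    have h1 : ∀ i j, i ≠ j → |forecastCov m u (n + (S + 1)) ω i j| ≤
        Ms * max (lam ^ m.dist i j) (max (√lam ^ (S + 1)) (Y / (1 / 1000 * δ))) := by
      intro i j hij
      refine (h.abs_forecastCov_succ_le u ω (n + S) hx0 hx1 hx
        ((pow_nonneg hs0 S).trans (le_max_left _ _)) (max_le (pow_le_one₀ hs0 hs1) hYδ)
        (hv S (by omega)) ih (hy S (by omega)) hij).trans ?_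
      refine mul_le_mul_of_nonneg_left (max_le_max le_rfl ?_) hMs.le
      refine max_le ?_ (le_max_right _ _)
      rw [mul_max_of_nonneg _ _ hs0, ← pow_succ']
      refine max_le_max le_rfl ?_
      by_cases hY0 : 0 ≤ Y
      · exact mul_le_of_le_one_left (by positivity) hs1
      · exact absurd ((h.errAt_nonneg u (n + S) ω).trans (hy S (by omega))) hY0
    refine ⟨fun i j => ?_, fun _ => h1⟩
    by_cases hij : i = j
    · subst hij
      have h2 : |forecastCov m u (n + (S + 1)) ω i i| ≤ varAt m u (n + (S + 1)) ω :=
        abs_ensembleCov_le_maxVar _ i i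
      have h3 : 1 ≤ max (lam ^ m.dist i i) (max (√lam ^ (S + 1)) (Y / (1 / 1000 * δ))) := by
        rw [h.std.dist_self, Real.rpow_zero]
        exact le_max_left _ _
      exact (h2.trans (hv _ le_rfl)).trans (le_mul_of_one_le_right (by positivity) h3)
    · refine (h1 i j hij).trans ?_
      have : 0 ≤ max (lam ^ m.dist i j) (max (√lam ^ (S + 1)) (Y / (1 / 1000 * δ))) :=
        (Real.rpow_nonneg hl.le _).trans (le_max_left _ _)
      gcongr
      nlinarith

/-- Control of the variances over a window without large errors: `k` half levels of localization
are lost because of the size of the initial variances. -/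
lemma exists_excess (hL : 1 ≤ L) (u : Input Ω d q K) (ω : Ω) (n : ℕ)
    (hy : ∀ j < nStar lam δ L, errAt m u sX lam (n + j) ω ≤ varTol lam δ L) {k : ℕ}
    (hk : k + 1 ≤ 2 * L) (hkv : 7 / 4 * varAt m u n ω * lam ^ (k + 1) ≤ Ms) :
    ∃ x, 0 ≤ x ∧ x ≤ 1 ∧ (1 + x) ^ 3 * √lam ≤ 1 - 1 / 500 * δ ∧
      (∀ N, k + (nStar lam δ L - 2 * L) ≤ N → N ≤ nStar lam δ L →
        varAt m u (n + N) ω ≤ (1 + x) * Ms) ∧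
      varAt m u (n + nStar lam δ L) ω ≤
        7 / 16 * varAt m u n ω + (1 + 2 * varTol lam δ L) * Ms := by
  have hl := h.hl
  have hl1 := h.lam_lt_one
  have hMs := h.Ms_pos
  have hδ := h.hδ
  have hδ4 := h.delta_lt
  have hv0 := varAt_nonneg (m := m) u n ω
  have hδl : 2 * δ * lam ≤ 1 - lam := by nlinarith [h.r_add_lt, h.one_lt_r]
  obtain ⟨e, he0, heτ, he, hcase⟩ := h.exists_inflation hL
  have he' : e = 0 ∨ 2 * ((1 + e) * lam) ≤ 1 := by
    rcases hcase with h0 | ⟨-, h1, -, h2⟩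
    · exact Or.inl h0
    · right
      nlinarith
  have hpath : ∀ N ≤ nStar lam δ L, varAt m u (n + N) ω ≤
      ((1 + e) * lam) ^ N * varAt m u n ω + (1 + 2 * e) * Ms := fun N hN =>
    h.varAt_add_le he0 he he' u ω n N fun j hj => hy j (hj.trans_le hN)
  have hend := hpath _ le_rfl
  have hend' : (1 + 2 * e) * Ms ≤ (1 + 2 * varTol lam δ L) * Ms := by gcongr
  obtain ⟨n1, hn1⟩ : ∃ n1, n1 = ⌈Real.log (4 / δ) / Real.log (1 / lam)⌉₊ := ⟨_, rfl⟩
  have hn1p : 1 ≤ n1 := hn1 ▸ h.one_le_steps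
  have hpow : lam ^ n1 ≤ δ / 4 := hn1 ▸ h.pow_steps_le
  have hnS : nStar lam δ L = 2 * L + n1 := by unfold nStar; rw [hn1]
  rcases hcase with rfl | ⟨hL1, hl3, hs3, he3⟩
  · simp only [add_zero, one_mul, mul_zero] at hpath hend
    -- After N ≥ k + n1 steps the initial variance has decayed to at most λ^(n1-1) · λ^(k+1)V, and
    -- λ^(k+1)V ≤ 4/7 M_*.
    refine ⟨4 / 7 * lam ^ (n1 - 1), by positivity, ?_, ?_, ?_, ?_⟩
    · have : lam ^ (n1 - 1) ≤ 1 := pow_le_one₀ hl.le hl1.le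
      linarith
    · have hw : lam * lam ^ (n1 - 1) ≤ δ / 4 := by
        rwa [← pow_succ', Nat.sub_add_cancel hn1p]
      refine contraction_margin hl hl1 (by positivity) ?_ hw hδ4.le hδl
      -- If n1 = 1 the excess has no decay (w = 1), but then λ ≤ δ/4 ≤ 1/16; otherwise w ≤ λ.
      by_cases h2 : n1 = 1
      · right
        subst h2
        refine ⟨by simp, ?_⟩
        rw [pow_one] at hpow
        linarith
      · left
        have := pow_le_pow_of_le_one hl.le hl1.le (show 1 ≤ n1 - 1 by omega)
        rwa [pow_one] at this
    · intro N hN hN'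
      refine (hpath N hN').trans ?_
      have h1 : lam ^ N ≤ lam ^ (n1 - 1) * lam ^ (k + 1) := by
        rw [← pow_add]
        exact pow_le_pow_of_le_one hl.le hl1.le (by omega)
      have h3 : varAt m u n ω * lam ^ (k + 1) ≤ 4 / 7 * Ms := by linarith
      have h2 : lam ^ N * varAt m u n ω ≤ lam ^ (n1 - 1) * (4 / 7 * Ms) :=
        calc _ ≤ lam ^ (n1 - 1) * lam ^ (k + 1) * varAt m u n ω := by gcongr
          _ = lam ^ (n1 - 1) * (varAt m u n ω * lam ^ (k + 1)) := by ring
          _ ≤ _ := mul_le_mul_of_nonneg_left h3 (by positivity)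
      linarith
    · have h1 : lam ^ nStar lam δ L ≤ lam ^ n1 :=
        pow_le_pow_of_le_one hl.le hl1.le (by omega)
      have h2 : lam ^ nStar lam δ L * varAt m u n ω ≤ 7 / 16 * varAt m u n ω := by
        gcongr
        linarith
      linarith [h.varTol_pos, mul_pos h.varTol_pos hMs]
  · have hμ0 : 0 ≤ (1 + e) * lam := by positivity
    have hμ1 : (1 + e) * lam ≤ 1 / 500 := by nlinarith
    -- Here λ is tiny and L = 1, so (8/5)³√λ is far below 1, and 101/100 · 4/7 + 2/1000 ≤ 3/5 bounds
    -- the excess.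
    refine ⟨3 / 5, by norm_num, by norm_num, by nlinarith, ?_, ?_⟩
    · intro N hN hN'
      refine (hpath N hN').trans ?_
      have h1 : ((1 + e) * lam) ^ N ≤ ((1 + e) * lam) ^ (k + 1) :=
        pow_le_pow_of_le_one hμ0 (by linarith) (by omega)
      have h2 : (1 + e) ^ (k + 1) ≤ (1 + e) ^ 2 :=
        pow_le_pow_right₀ (by linarith) (by omega)
      have h3 : (1 + e) ^ 2 ≤ 101 / 100 := by nlinarith
      have h4 : ((1 + e) * lam) ^ N * varAt m u n ω ≤ 101 / 100 * (4 / 7 * Ms) :=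
        calc _ ≤ ((1 + e) * lam) ^ (k + 1) * varAt m u n ω := by gcongr
          _ = (1 + e) ^ (k + 1) * (varAt m u n ω * lam ^ (k + 1)) := by rw [mul_pow]; ring
          _ ≤ _ := by
            have : varAt m u n ω * lam ^ (k + 1) ≤ 4 / 7 * Ms := by linarith
            exact mul_le_mul (h2.trans h3) this (by positivity) (by norm_num)
      have : e * Ms ≤ 1 / 1000 * Ms := by gcongr
      linarith
    · have h1 : ((1 + e) * lam) ^ nStar lam δ L ≤ ((1 + e) * lam) ^ 1 :=
        pow_le_pow_of_le_one hμ0 (by linarith) (by omega)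
      have h2 : ((1 + e) * lam) ^ nStar lam δ L * varAt m u n ω ≤ 7 / 16 * varAt m u n ω := by
        gcongr
        linarith
      linarith

/-- The pathwise bound over a window without large errors. -/
lemma locMagnitude_window_le (hL : 1 ≤ L) (u : Input Ω d q K) (ω : Ω) (n : ℕ)
    (hv : 7 / 4 * varAt m u n ω * lam ^ (2 * L) < Ms)
    (hy : ∀ j < nStar lam δ L, errAt m u sX lam (n + j) ω ≤ varTol lam δ L) :
    locMagnitude m.dist lam L (forecastCov m u (n + nStar lam δ L) ω) ≤
      7 / 16 * varAt m u n ω + (1 + 2 * varTol lam δ L) * Ms + Ms *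
        ∑ j ∈ Finset.range (nStar lam δ L),
          max (errAt m u sX lam (n + j) ω / fineTol lam δ L - 1) 0 := by
  have hl := h.hl
  have hl1 := h.lam_lt_one
  have hMs := h.Ms_pos
  have hδ := h.hδ
  have hv0 := varAt_nonneg (m := m) u n ω
  have hτ := h.varTol_pos
  have hε := h.fineTol_pos
  have := h.nonempty_fin
  classical
  -- The least such k is used: k + 1 contractions bring the variance down to order M_*, while
  -- minimality gives M_* ≤ 7/4 V λ^k when k > 0, which later pays for the k lost half levels.
  have hex : ∃ k, 7 / 4 * varAt m u n ω * lam ^ (k + 1) < Ms :=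
    ⟨2 * L - 1, by rwa [show 2 * L - 1 + 1 = 2 * L by omega]⟩
  obtain ⟨k, hk⟩ : ∃ k, k = Nat.find hex := ⟨_, rfl⟩
  have hk1 : 7 / 4 * varAt m u n ω * lam ^ (k + 1) < Ms := hk ▸ Nat.find_spec hex
  have hk2 : k ≤ 2 * L - 1 := by
    rw [hk]
    refine Nat.find_min' hex ?_
    rwa [show 2 * L - 1 + 1 = 2 * L by omega]
  have hk3 : k = 0 ∨ Ms ≤ 7 / 4 * varAt m u n ω * lam ^ k := by
    rcases Nat.eq_zero_or_pos k with h0 | h0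
    · exact Or.inl h0
    · have := Nat.find_min hex (m := k - 1) (by omega)
      rw [Nat.sub_add_cancel h0, not_lt] at this
      exact Or.inr this
  obtain ⟨x, hx0, hx1, hx, hwin, hend⟩ := h.exists_excess hL u ω n hy (k := k) (by omega) hk1.le
  have hnS : 2 * L ≤ nStar lam δ L := by unfold nStar; omega
  set Z := ∑ j ∈ Finset.range (nStar lam δ L),
    max (errAt m u sX lam (n + j) ω / fineTol lam δ L - 1) 0 with hZ
  have hZ0 : 0 ≤ Z := Finset.sum_nonneg fun j _ => le_max_right _ _
  have hyZ : ∀ j < nStar lam δ L, errAt m u sX lam (n + j) ω ≤ fineTol lam δ L * (1 + Z) := by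
    intro j hj
    have h1 : max (errAt m u sX lam (n + j) ω / fineTol lam δ L - 1) 0 ≤ Z :=
      Finset.single_le_sum (f := fun j => max (errAt m u sX lam (n + j) ω / fineTol lam δ L - 1) 0)
        (fun j _ => le_max_right _ _) (Finset.mem_range.2 hj)
    have h2 : errAt m u sX lam (n + j) ω / fineTol lam δ L ≤ 1 + Z := by
      linarith [le_max_left (errAt m u sX lam (n + j) ω / fineTol lam δ L - 1) 0]
    rwa [div_le_iff₀ hε, mul_comm] at h2
  set N0 := k + (nStar lam δ L - 2 * L) with hN0
  set S := 2 * L - k with hS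
  have hNS : N0 + S = nStar lam δ L := by omega
  -- Of the two bounds on the error, `varTol` guarantees Y ≤ δ/1000, and `fineTol` (1 + Z) enters
  -- the final estimate. As k ≤ 2L - 1, S ≥ 1 and the sharp off-diagonal bound is available.
  have hcov := (h.abs_forecastCov_add_le u ω (n + N0) S (Y := min (varTol lam δ L)
    (fineTol lam δ L * (1 + Z))) hx0 hx1 hx ((min_le_left _ _).trans h.varTol_le)
    (fun s hs => by
      rw [add_assoc]
      exact hwin (N0 + s) (by omega) (by omega))
    (fun s hs => by
      rw [add_assoc]
      exact le_min (hy _ (by omega)) (hyZ _ (by omega)))).2 (by omega)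
  rw [add_assoc, hNS] at hcov
  have hB : (0 : ℝ) ≤ 7 / 16 * varAt m u n ω := by linarith
  have hMZ : 0 ≤ Ms * Z := mul_nonneg hMs.le hZ0
  have hτM := mul_pos hτ hMs
  refine locMagnitude_le fun i j => ?_
  by_cases hij : i = j
  · subst hij
    rw [h.std.dist_self, min_eq_left (Nat.cast_nonneg L), neg_zero, Real.rpow_zero, mul_one]
    have h2 : |forecastCov m u (n + nStar lam δ L) ω i i| ≤ varAt m u (n + nStar lam δ L) ω :=
      abs_ensembleCov_le_maxVar _ i i
    linarith
  · have hs : 0 < √lam := Real.sqrt_pos.2 hl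
    have hss : √lam ^ 2 = lam := Real.sq_sqrt hl.le
    have hp : 0 < lam ^ L := pow_pos hl L
    have h1 := mul_le_mul_of_nonneg_right (hcov i j hij)
      (Real.rpow_nonneg hl.le (-(min (m.dist i j) (L : ℝ))))
    refine h1.trans ?_
    rw [mul_assoc]
    refine (mul_le_mul_of_nonneg_left (max_rpow_mul_rpow_neg_min_le hl hl1.le
      ((pow_nonneg hs.le S).trans (le_max_left _ _)) _ L) hMs.le).trans ?_
    rw [max_mul_of_nonneg _ _ (inv_nonneg.2 hp.le), mul_max_of_nonneg _ _ hMs.le,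
      mul_max_of_nonneg _ _ hMs.le]
    refine max_le (by linarith) (max_le ?_ ?_)
    -- Only 2L - k of the 2L half levels were gained, so the normalized floor is λ^(-k/2);
    -- minimality of k and the mean inequality absorb it into 7/16 V + M_*.
    · have e1 : √lam ^ S * (lam ^ L)⁻¹ = (√lam ^ k)⁻¹ := by
        rw [← hss, ← pow_mul, hss, ← show S + k = 2 * L by omega, pow_add]
        field_simp
      rw [e1]
      have hpk : 0 < √lam ^ k := pow_pos hs k
      rw [← div_eq_mul_inv, div_le_iff₀ hpk]
      rcases hk3 with h0 | h0
      · rw [h0, pow_zero, mul_one]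
        linarith
      · have e2 : lam ^ k = (√lam ^ k) ^ 2 := by rw [← pow_mul, mul_comm, pow_mul, hss]
        rw [e2] at h0
        have h3 := le_add_mul_of_le_mul_sq hMs hv0 hpk.le h0
        have := mul_nonneg (add_nonneg hτM.le hMZ) hpk.le
        linarith [mul_pos hτM hpk]
    -- `fineTol` is exactly δ/1000 at the finest level λ^L, so the error floor, normalized by
    -- λ^(-L), is at most 1 + Z.
    · have e1 : min (varTol lam δ L) (fineTol lam δ L * (1 + Z)) / (1 / 1000 * δ) * (lam ^ L)⁻¹ =
          min (varTol lam δ L) (fineTol lam δ L * (1 + Z)) / fineTol lam δ L := by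
        unfold fineTol
        field_simp
      have e2 : min (varTol lam δ L) (fineTol lam δ L * (1 + Z)) / fineTol lam δ L ≤ 1 + Z := by
        rw [div_le_iff₀ hε, mul_comm]
        exact min_le_right _ _
      rw [e1]
      have := mul_le_mul_of_nonneg_left e2 hMs.le
      linarith

end Regime

end

end

/-! ### Dissipation in conditional expectation and time averages. -/

section

lemma sum_Icc_add (f : ℕ → ℝ≥0∞) (N T : ℕ) :
    ∑ k ∈ Finset.Icc 1 (N + T), f k =
      ∑ k ∈ Finset.Icc 1 N, f k + ∑ k ∈ Finset.Icc 1 T, f (k + N) := by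
  induction T with
  | zero => simp
  | succ T ih =>
    rw [← add_assoc, Finset.sum_Icc_succ_top (by omega), ih, Finset.sum_Icc_succ_top (by omega),
      add_assoc, show N + T + 1 = T + 1 + N by omega]

/-- A sequence which is dissipative every `N` steps is bounded on average. -/
lemma sum_le_of_dissipative {a : ℕ → ℝ≥0∞} {b : ℝ≥0∞} {N : ℕ}
    (ha : ∀ n, a (n + N) ≤ 2⁻¹ * a n + b) (hfin : ∀ n, a n ≠ ∞) (T : ℕ) :
    ∑ k ∈ Finset.Icc 1 T, a k ≤ 2 * (∑ k ∈ Finset.Icc 1 N, a k + T * b) := by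
  set S := ∑ k ∈ Finset.Icc 1 T, a k with hS
  have hSfin : 2⁻¹ * S ≠ ∞ :=
    ENNReal.mul_ne_top (by simp) (ENNReal.sum_ne_top.2 fun k _ => hfin k)
  -- The sum is extended to N + T, and the shifted terms are bounded by dissipation; finiteness then
  -- allows subtracting half of S.
  have h1 : S ≤ ∑ k ∈ Finset.Icc 1 N, a k + T * b + 2⁻¹ * S :=
    calc S ≤ ∑ k ∈ Finset.Icc 1 (N + T), a k :=
          Finset.sum_le_sum_of_subset (Finset.Icc_subset_Icc_right (Nat.le_add_left T N))
      _ = ∑ k ∈ Finset.Icc 1 N, a k + ∑ k ∈ Finset.Icc 1 T, a (k + N) := sum_Icc_add a N T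
      _ ≤ ∑ k ∈ Finset.Icc 1 N, a k + ∑ k ∈ Finset.Icc 1 T, (2⁻¹ * a k + b) := by
          gcongr with k
          exact ha k
      _ = _ := by
          rw [Finset.sum_add_distrib, ← Finset.mul_sum, Finset.sum_const, Nat.card_Icc,
            Nat.add_sub_cancel, nsmul_eq_mul]
          ring
  have h2 : S = 2⁻¹ * S + 2⁻¹ * S := by
    rw [← add_mul, ENNReal.inv_two_add_inv_two, one_mul]
  have h3 : 2⁻¹ * S ≤ ∑ k ∈ Finset.Icc 1 N, a k + T * b := by
    rw [h2, ← h2] at h1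
    nth_rewrite 1 [h2] at h1
    exact (ENNReal.add_le_add_iff_right hSfin).1 h1
  calc S = 2 * (2⁻¹ * S) := by
        rw [← mul_assoc, ENNReal.mul_inv_cancel two_ne_zero ENNReal.ofNat_ne_top, one_mul]
    _ ≤ _ := by gcongr

lemma apply_self_le_opNorm {d : ℕ} (C : Matrix (Fin d) (Fin d) ℝ) (i : Fin d) :
    C i i ≤ opNorm C := by
  have h1 := (Matrix.toEuclideanCLM (𝕜 := ℝ) C).le_opNorm (EuclideanSpace.single i 1)
  rw [show ‖EuclideanSpace.single i (1 : ℝ)‖ = 1 by simp, mul_one] at h1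
  have h2 := PiLp.norm_apply_le (Matrix.toEuclideanCLM (𝕜 := ℝ) C (EuclideanSpace.single i 1)) i
  have h3 : (Matrix.toEuclideanCLM (𝕜 := ℝ) C (EuclideanSpace.single i 1)) i = C i i := by
    rw [Matrix.ofLp_toEuclideanCLM]
    simp
  rw [h3, Real.norm_eq_abs] at h2
  exact (le_abs_self _).trans (h2.trans h1)

/-- A bound on the conditional expectation from bounds on the integrals over all events. -/
lemma condLExp_le_of_forall_setLIntegral_le {Ω : Type*} {m₀ mΩ : MeasurableSpace Ω}
    {P : Measure Ω} [IsFiniteMeasure P] (hm : m₀ ≤ mΩ) {X Y : Ω → ℝ≥0∞} (hY : Measurable[m₀] Y)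
    (h : ∀ A, MeasurableSet[m₀] A → ∫⁻ ω in A, X ω ∂P ≤ ∫⁻ ω in A, Y ω ∂P) :
    condLExp m₀ P X ≤ᵐ[P] Y := by
  apply ae_le_of_ae_le_trim (hm := hm)
  apply ae_le_of_forall_setLIntegral_le_of_sigmaFinite (μ := P.trim hm)
    (measurable_condLExp m₀ P X)
  intro A hA _
  rw [setLIntegral_condLExp_trim hm _ _ hA, setLIntegral_trim hm hY hA]
  exact h A hA

section

variable {Ω : Type*} [mΩ : MeasurableSpace Ω] {P : Measure Ω} {d q K L : ℕ} {m : Model d q}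
  {sX lam δ Ms : ℝ}

namespace Regime

variable (h : Regime m sX lam δ Ms absConst L K)
include h

lemma followsLocalizedStructure (u : Input Ω d q K) {M : ℕ → Ω → ℝ}
    (hM : ∀ n ω, M n ω = locMagnitude m.dist lam L (forecastCov m u n ω)) :
    FollowsLocalizedStructure m.dist (forecastCov m u) M (fun x => lam ^ x) (L : ℝ) := by
  have hl := h.hl
  have hl1 := h.lam_lt_one
  have key : ∀ n ω i j, |forecastCov m u n ω i j| ≤ M n ω * lam ^ min (m.dist i j) (L : ℝ) := by
    intro n ω i j
    have h1 := le_locMagnitude (L := L) m.dist lam (forecastCov m u n ω) i j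
    rwa [← hM, Real.rpow_neg hl.le, ← div_eq_mul_inv,
      div_le_iff₀ (Real.rpow_pos_of_pos hl _)] at h1
  refine ⟨fun x _ y _ hxy => Real.rpow_le_rpow_of_exponent_ge hl hl1.le hxy, fun x hx =>
    ⟨Real.rpow_nonneg hl.le _, Real.rpow_le_one hl.le hl1.le hx⟩, Real.rpow_zero _, ?_, ?_⟩
  · intro n ω i j hij
    have := key n ω i j
    rwa [min_eq_left hij] at this
  · intro n ω i j hij
    have := key n ω i j
    rwa [min_eq_right hij.le] at this

/-- The localization is not worse than the variances, up to the largest weight. -/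
lemma setLIntegral_locMagnitude_le_varAt (u : Input Ω d q K) (n : ℕ) (A : Set Ω) :
    ∫⁻ ω in A, ENNReal.ofReal (locMagnitude m.dist lam L (forecastCov m u n ω)) ∂P ≤
      ENNReal.ofReal (lam ^ L)⁻¹ * ∫⁻ ω in A, ENNReal.ofReal (varAt m u n ω) ∂P := by
  rw [← lintegral_const_mul _ (h.measurable_varAt u n).ennreal_ofReal]
  refine lintegral_mono fun ω => ?_
  rw [← ENNReal.ofReal_mul (inv_nonneg.2 (pow_pos h.hl L).le)]
  exact ENNReal.ofReal_le_ofReal (h.locMagnitude_forecastCov_le u n ω)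

/-- Of the n_* powers of λ, L cancel the crude weight and the rest leave at most 1/16. The constant
λ^(-L)M_* costs at most 7/16 v + M_*, because v is large or L = 0. Together 1/16 + 7/16 = 1/2. -/
lemma inv_pow_mul_le {v : ℝ} (hv : 0 ≤ v) (hLv : L = 0 ∨ Ms ≤ 7 / 4 * v * lam ^ (2 * L)) :
    (lam ^ L)⁻¹ * (lam ^ nStar lam δ L * v + Ms) ≤ 1 / 2 * v + Ms := by
  have hMs := h.Ms_pos
  have hp : 0 < lam ^ L := pow_pos h.hl L
  have hp1 : lam ^ L ≤ 1 := pow_le_one₀ h.hl.le h.lam_lt_one.le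
  have hpow := h.pow_steps_le
  have hnS : nStar lam δ L = L + (L + ⌈Real.log (4 / δ) / Real.log (1 / lam)⌉₊) := by
    unfold nStar
    omega
  have hMv : Ms ≤ (7 / 16 * v + Ms) * lam ^ L := by
    rcases hLv with rfl | hLv
    · rw [pow_zero]
      linarith
    · rw [mul_comm 2 L, pow_mul] at hLv
      exact le_add_mul_of_le_mul_sq hMs hv hp.le hLv
  have h1 : lam ^ (L + ⌈Real.log (4 / δ) / Real.log (1 / lam)⌉₊) ≤ 1 / 16 := by
    rw [pow_add]
    have := mul_le_mul hp1 hpow (pow_nonneg h.hl.le _) zero_le_one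
    linarith [h.delta_lt]
  rw [inv_mul_le_iff₀ hp, hnS, pow_add]
  have h2 := mul_le_mul_of_nonneg_left h1 (mul_nonneg hp.le hv)
  linarith

variable [IsProbabilityMeasure P] {u : Input Ω d q K} (hu : u.IsNoiseFor m P)
  (hSig : ∀ n, m.Sig n = sX ^ 2 • (1 : Matrix (Fin d) (Fin d) ℝ))
include hu hSig

/-- Dissipation when the initial variances are so large that localization plays no role. -/
lemma setLIntegral_locMagnitude_le_of_large (n : ℕ) {A : Set Ω}
    (hA : MeasurableSet[u.filtration n] A)
    (hAv : ∀ ω ∈ A, L = 0 ∨ Ms ≤ 7 / 4 * varAt m u n ω * lam ^ (2 * L)) :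
    ∫⁻ ω in A, ENNReal.ofReal (locMagnitude m.dist lam L
        (forecastCov m u (n + nStar lam δ L) ω)) ∂P ≤
      ∫⁻ ω in A, ENNReal.ofReal (1 / 2 * varAt m u n ω + (1 + δ) * Ms) ∂P := by
  have hMs := h.Ms_pos
  have hi : 0 ≤ (lam ^ L)⁻¹ := inv_nonneg.2 (pow_pos h.hl L).le
  have hq0 : 0 ≤ lam ^ nStar lam δ L := pow_nonneg h.hl.le _
  refine (h.setLIntegral_locMagnitude_le_varAt u _ A).trans ?_
  have h1 := h.setLIntegral_varAt_add_le hu hSig n (nStar lam δ L) hA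
  have h2 : ENNReal.ofReal ((1 - lam ^ nStar lam δ L) * Ms) ≤ ENNReal.ofReal Ms :=
    ENNReal.ofReal_le_ofReal (by nlinarith)
  calc _ ≤ ENNReal.ofReal (lam ^ L)⁻¹ * (ENNReal.ofReal (lam ^ nStar lam δ L) *
          ∫⁻ ω in A, ENNReal.ofReal (varAt m u n ω) ∂P + ENNReal.ofReal Ms * P A) := by
        gcongr
        exact h1.trans (by gcongr)
    _ = ∫⁻ ω in A, ENNReal.ofReal ((lam ^ L)⁻¹ *
          (lam ^ nStar lam δ L * varAt m u n ω + Ms)) ∂P := by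
        rw [← h.setLIntegral_affine u n hq0 hMs.le, ← lintegral_const_mul _
          (((h.measurable_varAt u n).const_mul _).add_const _).ennreal_ofReal]
        exact lintegral_congr fun ω => (ENNReal.ofReal_mul hi).symm
    _ ≤ _ := by
        refine setLIntegral_mono' (u.filtration.le n _ hA) fun ω hω =>
          ENNReal.ofReal_le_ofReal ((h.inv_pow_mul_le (varAt_nonneg u n ω) (hAv ω hω)).trans ?_)
        linarith [mul_pos h.hδ hMs]

/-- Dissipation when the initial variances are moderate. -/
lemma setLIntegral_locMagnitude_le_of_moderate (hL : 1 ≤ L) (n : ℕ) {A : Set Ω}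
    (hA : MeasurableSet[u.filtration n] A)
    (hAv : ∀ ω ∈ A, 7 / 4 * varAt m u n ω * lam ^ (2 * L) < Ms) :
    ∫⁻ ω in A, ENNReal.ofReal (locMagnitude m.dist lam L
        (forecastCov m u (n + nStar lam δ L) ω)) ∂P ≤
      ∫⁻ ω in A, ENNReal.ofReal (1 / 2 * varAt m u n ω + (1 + δ) * Ms) ∂P := by
  classical
  have hMs := h.Ms_pos
  have hδ := h.hδ
  have hδ4 := h.delta_lt
  have hτ := h.varTol_pos
  have hτδ := h.varTol_le
  have hp : 0 < lam ^ L := pow_pos h.hl L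
  have hi : 0 ≤ (lam ^ L)⁻¹ := inv_nonneg.2 hp.le
  have hN : (0 : ℝ) < nStar lam δ L := by exact_mod_cast h.one_le_nStar
  set N := nStar lam δ L with hNdef
  set G : ℕ → Set Ω := fun j => {ω | varTol lam δ L < errAt m u sX lam (n + j) ω} with hG
  have hGm : ∀ j, MeasurableSet (G j) := fun j =>
    u.filtration.le _ _ (h.measurableSet_large (u := u) (n + j))
  have hVm : Measurable fun ω => ENNReal.ofReal (lam ^ L)⁻¹ *
      ENNReal.ofReal (varAt m u (n + N) ω) :=
    (h.measurable_varAt u (n + N)).ennreal_ofReal.const_mul _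
  have hEm : ∀ j, Measurable fun ω => ENNReal.ofReal Ms *
      ENNReal.ofReal (errAt m u sX lam (n + j) ω / fineTol lam δ L - 1) := fun j =>
    (((h.measurable_errAt u (n + j)).div_const _).sub_const _).ennreal_ofReal.const_mul _
  -- If no step of the window errs beyond `varTol`, the pathwise estimate holds; otherwise some G_j
  -- occurs and the crude bound λ^(-L)V is charged to it.
  have hpt : ∀ ω ∈ A, ENNReal.ofReal (locMagnitude m.dist lam L (forecastCov m u (n + N) ω)) ≤
      ENNReal.ofReal (7 / 16 * varAt m u n ω + (1 + 2 * varTol lam δ L) * Ms) +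
        (∑ j ∈ Finset.range N, ENNReal.ofReal Ms *
          ENNReal.ofReal (errAt m u sX lam (n + j) ω / fineTol lam δ L - 1) +
        ∑ j ∈ Finset.range N, (G j).indicator (fun ω => ENNReal.ofReal (lam ^ L)⁻¹ *
          ENNReal.ofReal (varAt m u (n + N) ω)) ω) := by
    intro ω hω
    by_cases hy : ∀ j < N, errAt m u sX lam (n + j) ω ≤ varTol lam δ L
    · refine (ENNReal.ofReal_le_ofReal (h.locMagnitude_window_le hL u ω n (hAv ω hω) hy)).trans ?_
      rw [← add_assoc]
      refine le_add_of_le_left ?_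
      refine ENNReal.ofReal_add_le.trans (add_le_add le_rfl ?_)
      rw [ENNReal.ofReal_mul hMs.le, ENNReal.ofReal_sum_of_nonneg fun j _ => le_max_right _ _,
        Finset.mul_sum]
      refine Finset.sum_le_sum fun j _ => ?_
      rw [ENNReal.ofReal_max, ENNReal.ofReal_zero, max_eq_left zero_le]
    · push Not at hy
      obtain ⟨j, hj, hjG⟩ := hy
      refine le_add_of_le_right (le_add_of_le_right ?_)
      refine le_trans ?_ (Finset.single_le_sum (f := fun j => (G j).indicator
        (fun ω => ENNReal.ofReal (lam ^ L)⁻¹ * ENNReal.ofReal (varAt m u (n + N) ω)) ω)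
        (fun _ _ => zero_le) (Finset.mem_range.2 hj))
      rw [Set.indicator_of_mem (show ω ∈ G j from hjG), ← ENNReal.ofReal_mul hi]
      exact ENNReal.ofReal_le_ofReal (h.locMagnitude_forecastCov_le u (n + N) ω)
  have hA' := u.filtration.le n _ hA
  refine (setLIntegral_mono' hA' hpt).trans ?_
  have hm1 : Measurable fun ω => ENNReal.ofReal
      (7 / 16 * varAt m u n ω + (1 + 2 * varTol lam δ L) * Ms) :=
    (((h.measurable_varAt u n).const_mul _).add_const _).ennreal_ofReal
  rw [lintegral_add_left hm1, lintegral_add_left (Finset.measurable_sum _ fun j _ => hEm j),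
    lintegral_finsetSum _ fun j _ => hEm j,
    lintegral_finsetSum _ fun j _ => hVm.indicator (hGm j),
    h.setLIntegral_affine u n (by norm_num) (by positivity),
    h.setLIntegral_affine u n (by norm_num) (by positivity)]
  set I := ∫⁻ ω in A, ENNReal.ofReal (varAt m u n ω) ∂P with hI
  have h2 : ∑ j ∈ Finset.range N, ∫⁻ ω in A, ENNReal.ofReal Ms *
      ENNReal.ofReal (errAt m u sX lam (n + j) ω / fineTol lam δ L - 1) ∂P ≤
        ENNReal.ofReal (δ / 8 * Ms) * P A := by
    have g : ∀ j ∈ Finset.range N, ∫⁻ ω in A, ENNReal.ofReal Ms *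
        ENNReal.ofReal (errAt m u sX lam (n + j) ω / fineTol lam δ L - 1) ∂P ≤
          ENNReal.ofReal Ms * (ENNReal.ofReal (δ / (8 * N)) * P A) := by
      intro j _
      rw [lintegral_const_mul _
        (((h.measurable_errAt u (n + j)).div_const _).sub_const _).ennreal_ofReal]
      gcongr
      exact h.setLIntegral_errAt_excess_le hu hSig (n + j)
        (u.filtration.mono (Nat.le_add_right n j) _ hA)
    refine (Finset.sum_le_sum g).trans (le_of_eq ?_)
    rw [Finset.sum_const, Finset.card_range, nsmul_eq_mul, ← ENNReal.ofReal_natCast,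
      ← mul_assoc, ← mul_assoc, ← ENNReal.ofReal_mul hN.le, ← ENNReal.ofReal_mul (by positivity)]
    congr 2
    field_simp
  -- The tail bound δλ^L/(64 n_*) cancels both the crude weight λ^(-L) and the number n_* of
  -- possible times of failure.
  have h3 : ∑ j ∈ Finset.range N, ∫⁻ ω in A, (G j).indicator (fun ω =>
      ENNReal.ofReal (lam ^ L)⁻¹ * ENNReal.ofReal (varAt m u (n + N) ω)) ω ∂P ≤
        ENNReal.ofReal (δ / 64) * (I + 3 * ENNReal.ofReal Ms * P A) := by
    have g : ∀ j ∈ Finset.range N, ∫⁻ ω in A, (G j).indicator (fun ω =>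
        ENNReal.ofReal (lam ^ L)⁻¹ * ENNReal.ofReal (varAt m u (n + N) ω)) ω ∂P ≤
          ENNReal.ofReal (lam ^ L)⁻¹ * (ENNReal.ofReal (δ * lam ^ L / (64 * N)) *
            (I + 3 * ENNReal.ofReal Ms * P A)) := by
      intro j hj
      rw [lintegral_indicator (hGm j), Measure.restrict_restrict (hGm j), Set.inter_comm,
        lintegral_const_mul _ (h.measurable_varAt u (n + N)).ennreal_ofReal]
      gcongr
      exact h.setLIntegral_varAt_large_le hu hSig n (Finset.mem_range.1 hj) hA
    refine (Finset.sum_le_sum g).trans (le_of_eq ?_)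
    rw [Finset.sum_const, Finset.card_range, nsmul_eq_mul, ← ENNReal.ofReal_natCast,
      ← mul_assoc, ← mul_assoc, ← ENNReal.ofReal_mul hN.le, ← ENNReal.ofReal_mul (by positivity)]
    congr 2
    field_simp
  have h4 : ENNReal.ofReal (7 / 16) + ENNReal.ofReal (δ / 64) ≤ ENNReal.ofReal (1 / 2) := by
    rw [← ENNReal.ofReal_add (by norm_num) (by positivity)]
    exact ENNReal.ofReal_le_ofReal (by linarith)
  -- The error budget is δ/500 + δ/8 + 3δ/64 < δ.
  have h5 : ENNReal.ofReal ((1 + 2 * varTol lam δ L) * Ms) + ENNReal.ofReal (δ / 8 * Ms) +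
      ENNReal.ofReal (δ / 64) * (3 * ENNReal.ofReal Ms) ≤ ENNReal.ofReal ((1 + δ) * Ms) := by
    rw [← ENNReal.ofReal_ofNat 3, ← ENNReal.ofReal_mul (by norm_num),
      ← ENNReal.ofReal_mul (by positivity), ← ENNReal.ofReal_add (by positivity) (by positivity),
      ← ENNReal.ofReal_add (by positivity) (by positivity)]
    refine ENNReal.ofReal_le_ofReal ?_
    have : varTol lam δ L * Ms ≤ 1 / 1000 * δ * Ms := by gcongr
    linarith [mul_pos hδ hMs]
  calc _ ≤ ENNReal.ofReal (7 / 16) * I + ENNReal.ofReal ((1 + 2 * varTol lam δ L) * Ms) * P A +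
        (ENNReal.ofReal (δ / 8 * Ms) * P A +
          ENNReal.ofReal (δ / 64) * (I + 3 * ENNReal.ofReal Ms * P A)) := by gcongr
    _ = (ENNReal.ofReal (7 / 16) + ENNReal.ofReal (δ / 64)) * I +
        (ENNReal.ofReal ((1 + 2 * varTol lam δ L) * Ms) + ENNReal.ofReal (δ / 8 * Ms) +
          ENNReal.ofReal (δ / 64) * (3 * ENNReal.ofReal Ms)) * P A := by ring
    _ ≤ _ := by gcongr

/-- Whether λ^(2L)V_n is large compared with M_* is known at time n, so each event of F_n splits
into the two regimes. The right side keeps the variance instead of the localization magnitude, which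
is stronger. -/
lemma setLIntegral_locMagnitude_le (n : ℕ) {A : Set Ω} (hA : MeasurableSet[u.filtration n] A) :
    ∫⁻ ω in A, ENNReal.ofReal (locMagnitude m.dist lam L
        (forecastCov m u (n + nStar lam δ L) ω)) ∂P ≤
      ∫⁻ ω in A, ENNReal.ofReal (1 / 2 * varAt m u n ω + (1 + δ) * Ms) ∂P := by
  rcases Nat.eq_zero_or_pos L with h0 | hL
  · exact h.setLIntegral_locMagnitude_le_of_large hu hSig n hA fun ω _ => Or.inl h0
  set E := {ω | Ms ≤ 7 / 4 * varAt m u n ω * lam ^ (2 * L)} with hE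
  have hEm : MeasurableSet[u.filtration n] E := h.measurable_varAt_filtration u n
    (measurableSet_le (f := fun _ => Ms) (g := fun x => 7 / 4 * x * lam ^ (2 * L))
      measurable_const (by fun_prop))
  have hEm' := u.filtration.le n _ hEm
  rw [← lintegral_inter_add_sdiff (μ := P) _ A hEm', ← lintegral_inter_add_sdiff (μ := P)
    (fun ω => ENNReal.ofReal (1 / 2 * varAt m u n ω + (1 + δ) * Ms)) A hEm']
  refine add_le_add (h.setLIntegral_locMagnitude_le_of_large hu hSig n (hA.inter hEm)
    fun ω hω => Or.inr hω.2) (h.setLIntegral_locMagnitude_le_of_moderate hu hSig hL n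
      (hA.diff hEm) fun ω hω => ?_)
  exact not_le.1 hω.2

/-- The localization magnitude is dissipative in conditional expectation. -/
lemma condLExp_locMagnitude_le (n : ℕ) :
    condLExp (u.filtration n) P (fun ω => ENNReal.ofReal (locMagnitude m.dist lam L
        (forecastCov m u (n + nStar lam δ L) ω))) ≤ᵐ[P]
      fun ω => ENNReal.ofReal (1 / 2 * varAt m u n ω + (1 + δ) * Ms) :=
  condLExp_le_of_forall_setLIntegral_le (u.filtration.le n)
    (((h.measurable_varAt_filtration u n).const_mul _).add_const _).ennreal_ofReal
    fun _ hA => h.setLIntegral_locMagnitude_le hu hSig n hA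

/-- The average of the localization magnitude. -/
lemma average_locMagnitude_le {T : ℕ} (hT : 1 ≤ T) :
    (∑ k ∈ Finset.Icc 1 T, ∫⁻ ω, ENNReal.ofReal (locMagnitude m.dist lam L
        (forecastCov m u k ω)) ∂P) / (T : ℝ≥0∞) ≤
      ENNReal.ofReal (2 * (nStar lam δ L : ℝ) / ((T : ℝ) * lam ^ L)) *
          ((∫⁻ ω, ENNReal.ofReal (opNorm (forecastCov m u 0 ω)) ∂P) + ENNReal.ofReal Ms) +
        ENNReal.ofReal (2 * (1 + δ) * Ms) := by
  have hl := h.hl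
  have hMs := h.Ms_pos
  have hδ := h.hδ
  have hn : (0 : ℝ) < nStar lam δ L := by exact_mod_cast h.one_le_nStar
  have hT0 : (0 : ℝ) < T := by exact_mod_cast hT
  have := h.nonempty_fin
  have hp : 0 < lam ^ L := pow_pos hl L
  set N := nStar lam δ L with hN
  set a := fun k => ∫⁻ ω, ENNReal.ofReal (locMagnitude m.dist lam L (forecastCov m u k ω)) ∂P
    with ha
  set V := ∫⁻ ω, ENNReal.ofReal (opNorm (forecastCov m u 0 ω)) ∂P with hV
  have h0 : ∫⁻ ω, ENNReal.ofReal (varAt m u 0 ω) ∂P ≤ V :=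
    lintegral_mono fun ω => ENNReal.ofReal_le_ofReal
      (ciSup_le fun i => apply_self_le_opNorm (forecastCov m u 0 ω) i)
  have h1 : ∀ k, a k ≤ ENNReal.ofReal (lam ^ L)⁻¹ * (V + ENNReal.ofReal Ms) := by
    intro k
    have g1 := h.setLIntegral_locMagnitude_le_varAt (P := P) u k Set.univ
    have g2 := h.setLIntegral_varAt_add_le' hu hSig 0 k (A := Set.univ) MeasurableSet.univ
    simp only [Measure.restrict_univ, measure_univ, mul_one, zero_add] at g1 g2
    refine g1.trans ?_
    gcongr
    exact g2.trans (add_le_add h0 le_rfl)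
  -- With infinite initial moment the right side is infinite; otherwise all expectations are finite,
  -- as the summation argument requires.
  by_cases hVt : V = ∞
  · have : 0 < 2 * (N : ℝ) / ((T : ℝ) * lam ^ L) := by positivity
    rw [hVt, top_add, ENNReal.mul_top (ENNReal.ofReal_pos.2 this).ne', top_add]
    exact le_top
  have hafin : ∀ k, a k ≠ ∞ := fun k => ne_top_of_le_ne_top
    (ENNReal.mul_ne_top ENNReal.ofReal_ne_top (ENNReal.add_ne_top.2 ⟨hVt, ENNReal.ofReal_ne_top⟩))
    (h1 k)
  have hdiss : ∀ n, a (n + N) ≤ 2⁻¹ * a n + ENNReal.ofReal ((1 + δ) * Ms) := by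
    intro n
    have g1 := h.setLIntegral_locMagnitude_le hu hSig n (A := Set.univ) MeasurableSet.univ
    rw [h.setLIntegral_affine u n (by norm_num) (by positivity)] at g1
    simp only [Measure.restrict_univ, measure_univ, mul_one] at g1
    refine g1.trans (add_le_add (mul_le_mul' (le_of_eq ?_) (lintegral_mono fun ω =>
      ENNReal.ofReal_le_ofReal (h.varAt_le_locMagnitude u n ω))) le_rfl)
    rw [one_div, ENNReal.ofReal_inv_of_pos two_pos, ENNReal.ofReal_ofNat]
  have h2 := sum_le_of_dissipative hdiss hafin T
  have h3 : ∑ k ∈ Finset.Icc 1 N, a k ≤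
      N * (ENNReal.ofReal (lam ^ L)⁻¹ * (V + ENNReal.ofReal Ms)) := by
    refine (Finset.sum_le_sum fun k _ => h1 k).trans ?_
    simp
  have hTne : (T : ℝ≥0∞) ≠ 0 := by
    rw [Nat.cast_ne_zero]
    omega
  rw [ENNReal.div_le_iff hTne (ENNReal.natCast_ne_top T)]
  refine h2.trans ((mul_le_mul' le_rfl (add_le_add h3 le_rfl)).trans (le_of_eq ?_))
  have e1 : ENNReal.ofReal (2 * (N : ℝ) / ((T : ℝ) * lam ^ L)) * T =
      2 * (N * ENNReal.ofReal (lam ^ L)⁻¹) := by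
    rw [← ENNReal.ofReal_natCast T, ← ENNReal.ofReal_natCast N, ← ENNReal.ofReal_ofNat 2,
      ← ENNReal.ofReal_mul (by positivity), ← ENNReal.ofReal_mul (by positivity),
      ← ENNReal.ofReal_mul (by positivity)]
    congr 1
    field_simp
  have e2 : ENNReal.ofReal (2 * (1 + δ) * Ms) = 2 * ENNReal.ofReal ((1 + δ) * Ms) := by
    rw [mul_assoc, ENNReal.ofReal_mul two_pos.le, ENNReal.ofReal_ofNat]
  calc _ = 2 * (N * ENNReal.ofReal (lam ^ L)⁻¹) * (V + ENNReal.ofReal Ms) +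
        2 * ENNReal.ofReal ((1 + δ) * Ms) * T := by ring
    _ = _ := by rw [← e1, e2]; ring

end Regime

end

end

end LEnKF

end

theorem theorem2p6 :
    ∃ c : ℝ, 0 < c ∧
      ∀ (d q K L : ℕ) (Ω : Type*) [MeasurableSpace Ω] (P : Measure Ω) [IsProbabilityMeasure P]
        (m : LEnKF.Model d q) (u : LEnKF.Input Ω d q K) (sigmaXi lam δ Mstar : ℝ),
        0 < d → m.Standing → u.IsNoiseFor m P →
        0 < sigmaXi → (∀ n, m.Sig n = sigmaXi ^ 2 • (1 : Matrix (Fin d) (Fin d) ℝ)) →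
        (∀ i j, i ≠ j → 2 * m.l < m.dist (m.obs i) (m.obs j)) →
        0 < lam → lam < m.r⁻¹ → LEnKF.WeakInteraction m lam →
        0 < δ → δ < min (1 / 4) (1 / 2 * (lam⁻¹ - m.r)) →
        (m.r + 2 * δ) * sigmaXi ^ 2 / (1 - lam) ≤ Mstar →
        LEnKF.psi m.r m.sigmaO sigmaXi lam Mstar δ ≤ Mstar →
        max (1 / (c * δ ^ 2 * lam ^ (2 * L)) *
              Real.log (16 * (d : ℝ) ^ 2 * (LEnKF.nStar lam δ L : ℝ) / δ ^ 2))
            (LEnKF.Gam c (2 * m.r / δ) d) < (K : ℝ) →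
        ∀ M : ℕ → Ω → ℝ,
        (∀ n ω, M n ω = LEnKF.locMagnitude m.dist lam L (LEnKF.forecastCov m u n ω)) →
        LEnKF.FollowsLocalizedStructure m.dist (LEnKF.forecastCov m u) M
            (fun x => lam ^ x) (L : ℝ) ∧
        (∀ n : ℕ,
          condLExp (u.filtration n) P
              (fun ω => ENNReal.ofReal (M (n + LEnKF.nStar lam δ L) ω))
            ≤ᵐ[P] fun ω => ENNReal.ofReal (1 / 2 * M n ω + (1 + 2 * δ) * Mstar)) ∧
        (∀ T : ℕ, 1 ≤ T →
          (∑ k ∈ Finset.Icc 1 T, ∫⁻ ω, ENNReal.ofReal (M k ω) ∂P) / (T : ℝ≥0∞)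
            ≤ ENNReal.ofReal (2 * (LEnKF.nStar lam δ L : ℝ) / ((T : ℝ) * lam ^ L)) *
                ((∫⁻ ω, ENNReal.ofReal (LEnKF.opNorm (LEnKF.forecastCov m u 0 ω)) ∂P)
                  + ENNReal.ofReal Mstar)
              + ENNReal.ofReal (2 * (1 + δ) * Mstar)) := by
  refine ⟨LEnKF.absConst, by unfold LEnKF.absConst; norm_num, ?_⟩
  intro d q K L Ω _ P _ m u sigmaXi lam δ Mstar hd hm hu hX hSig hsep hl hlr hweak hδ hδ' hM hpsi
    hK M hMdef
  have h : LEnKF.Regime m sigmaXi lam δ Mstar LEnKF.absConst L K :=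
    ⟨hd, hm, hX, hsep, hl, hlr, hweak, hδ, hδ', hM, hpsi, hK⟩
  refine ⟨h.followsLocalizedStructure u hMdef, fun n => ?_, fun T hT => ?_⟩
  · simp only [hMdef]
    filter_upwards [h.condLExp_locMagnitude_le hu hSig n] with ω hω
    refine hω.trans (ENNReal.ofReal_le_ofReal ?_)
    -- The largest variance is dominated by M_n, whose diagonal weights equal 1, and 1 + δ is
    -- relaxed to 1 + 2δ.
    have h1 := h.varAt_le_locMagnitude u n ω
    have h2 := mul_pos hδ h.Ms_pos
    linarith
  · simp only [hMdef]
    exact h.average_locMagnitude_le hu hSig hT
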